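/- **Setting.** Let $G$ be a connected directed graph (loops and parallel edges allowed) embedded without crossings on the flat torus $\mathbb T=\mathbb R^2/\mathbb Z^2$. Let $M$ be the meridian (vertical side of the unit square, directed bottom-to-top) and $H$ the horizon (horizontal side, directed left-to-right); neither passes through a vertex or runs along an edge of $G$, and $M\cap H$ is a single point, which lies in a face of $G$. The embedding is given by the rotation system of the planarization $G^\times$ of $G\cup M\cup H$, and *linear time* means time linear in the size of $G^\times$. The graph $G$ is *essentially-acyclic* if every directed cycle of $G$ is non-contractible. Cycles and walks are directed. For closed walks $C,C'$ and a maximal common subwalk (possibly a single vertex), $C$ *crosses* $C'$ there *left-to-right* [*right-to-left*] if $C$ enters the subwalk from the left [right] of $C'$ and leaves it to the right [left] of $C'$; otherwise they *touch* there. The *algebraic crossing number* $\hat\imath(C,C')$ is the number of left-to-right crossings minus the number of right-to-left crossings of $C$ with $C'$; $C$ *crosses $C'$ algebraically* if $\hat\imath(C,C')\neq0$. Let $m(C)=\hat\imath(C,M)$ and $h(C)=\hat\imath(H,C)$; $(m(C),h(C))$ is the homotopy class of $C$, and $C$ is *1-orbital* if it has the same homotopy class as $M$, namely $(0,1)$.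 A closed walk is *simple* if it visits each vertex at most once, and *weakly simple* if it visits each vertex at most twice, does not cross itself, and is not a proper power of a shorter closed walk (so that simple curves exist arbitrarily close to it). Two cycles *touch only unidirectionally* if at each common vertex either at most three incident edge-ends belong to the two cycles, or the clockwise cyclic order of the four incident edge-ends is two incoming ones followed by two outgoing ones. **Lemma.** Let $G$ be essentially-acyclic, and let $C_\ell$ and $C_r$ be two cycles of $G$ such that $C_\ell$ crosses $C_r$ only right-to-left and at least once, and such that $C_\ell$ and $C_r$ touch only unidirectionally. Let $e$ be an edge of $C_\ell$. Then one can find in linear time (by one random-access-machine program that works for all inputs $G^\times, C_\ell, C_r, e$) a weakly simple closed walk $C$ in $G$ that contains $e$ and crosses both $C_\ell$ and $C_r$ algebraically, and such that moreover * if $\hat\imath(C_r,C_\ell)\ge 2$, then $C$ is simple; * if $m(C_\ell)<0<m(C_r)$ and $h(C_\ell),h(C_r)>0$, then $C$ is simple and 1-orbital. -/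

import Mathlib

/-! ## Directed graphs on an oriented closed surface -/

/-- A directed (multi)graph cellularly embedded on an oriented closed surface, described by its
rotation system. Every edge consists of two darts `d` and `twin d`; a dart `d` sits at the vertex
`vert d` and leads to the vertex `vert (twin d)`. `rot d` is the next dart in clockwise order around
`vert d`. `fwd d = true` means that the edge of `d` is directed away from `vert d` along `d`, so
exactly one of the two darts of an edge is forward. Loops and parallel edges are allowed. -/
structure EmbDigraph (V D : Type) where
  vert : D → V
  rot : Equiv.Perm D
  twin : Equiv.Perm D
  fwd : D → Bool
  twin_twin : ∀ d, twin (twin d) = d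
  fwd_twin : ∀ d, fwd (twin d) = !fwd d
  vert_surjective : Function.Surjective vert
  vert_eq_iff : ∀ d d', vert d = vert d' ↔ rot.SameCycle d d'

namespace EmbDigraph

variable {V D : Type} (X : EmbDigraph V D)

/-- The permutation whose cycles are the facial walks: after `d`, take the dart that follows
`twin d` clockwise at the vertex to which `d` leads. -/
def facePerm : Equiv.Perm D := X.rot * X.twin

/-- The number of faces. -/
noncomputable def numFaces : ℕ := Nat.card (Quotient (Equiv.Perm.SameCycle.setoid X.facePerm))

/-- The darts of the facial walk that starts with `d`. -/
noncomputable def facialWalk (d : D) : List D :=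
  List.iterate X.facePerm d (Function.minimalPeriod X.facePerm d)

/-- `Cw a b c`: the darts `a`, `b`, `c` sit at one vertex, are distinct, and rotating clockwise
from `a` one meets `b` before `c`. -/
def Cw (a b c : D) : Prop :=
  ∃ i j : ℕ, 0 < i ∧ i < j ∧ j < Function.minimalPeriod X.rot a ∧
    X.rot^[i] a = b ∧ X.rot^[j] a = c

/-- Two vertices joined by an edge with the property `p` (in either direction). -/
def Joined (p : D → Prop) (u v : V) : Prop :=
  ∃ d, p d ∧ X.vert d = u ∧ X.vert (X.twin d) = v

/-- `IsWalk u l v`: the list of darts `l` is an (undirected) walk from `u` to `v`. -/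
def IsWalk : V → List D → V → Prop
  | u, [], v => u = v
  | u, d :: l, v => X.vert d = u ∧ IsWalk (X.vert (X.twin d)) l v

/-- Elementary homotopies: insert a spur, or insert the boundary walk of a face. -/
inductive HomotopyStep : List D → List D → Prop
  | spur (l₁ l₂ : List D) (d : D) : HomotopyStep (l₁ ++ l₂) (l₁ ++ [d, X.twin d] ++ l₂)
  | face (l₁ l₂ : List D) (d : D) : HomotopyStep (l₁ ++ l₂) (l₁ ++ X.facialWalk d ++ l₂)

/-- The closed walk `l` at the vertex `v` is contractible: it can be transformed into the trivial
walk at `v` by elementary homotopies and their inverses, staying within closed walks at `v`. -/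
def NullHomotopic (v : V) (l : List D) : Prop :=
  X.IsWalk v l v ∧
    Relation.EqvGen (fun a b => X.HomotopyStep a b ∧ X.IsWalk v a v ∧ X.IsWalk v b v) l []

/-- A directed closed walk, as a cyclic sequence of forward darts. Its `i`-th visit is to the vertex
`vert (dart i)`, which it enters through `dart (i - 1)` and leaves through `dart i`. -/
structure ClosedWalk where
  len : ℕ
  len_neZero : NeZero len
  dart : ZMod len → D
  fwd_dart : ∀ i, X.fwd (dart i) = true
  chain : ∀ i, X.vert (X.twin (dart i)) = X.vert (dart (i + 1))

attribute [instance] ClosedWalk.len_neZero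

end EmbDigraph

namespace EmbDigraph.ClosedWalk

variable {V D : Type} {X : EmbDigraph V D}

/-- The edge with forward dart `d` is on the closed walk. -/
def Contains (C : X.ClosedWalk) (d : D) : Prop := ∃ i, C.dart i = d

/-- The closed walk visits the vertex `v`. -/
def Visits (C : X.ClosedWalk) (v : V) : Prop := ∃ i, X.vert (C.dart i) = v

/-- Every vertex is visited at most once. -/
def Simple (C : X.ClosedWalk) : Prop := ∀ i j, X.vert (C.dart i) = X.vert (C.dart j) → i = j

/-- The darts of the closed walk, listed from position `0`. -/
def toList (C : X.ClosedWalk) : List D := (List.range C.len).map fun i => C.dart (i : ZMod C.len)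

/-- The closed walk is homotopic to a point. -/
def Contractible (C : X.ClosedWalk) : Prop := X.NullHomotopic (X.vert (C.dart 0)) C.toList

/-- The dart through which the walk arrives at its `j`-th visited vertex, seen from that vertex. -/
def inDart (C : X.ClosedWalk) (j : ZMod C.len) : D := X.twin (C.dart (j - 1))

/-- The dart `x` lies to the left of `C` at the `j`-th visit of `C`. -/
def IsLeft (C : X.ClosedWalk) (j : ZMod C.len) (x : D) : Prop := X.Cw (C.inDart j) x (C.dart j)

/-- The dart `x` lies to the right of `C` at the `j`-th visit of `C`. -/
def IsRight (C : X.ClosedWalk) (j : ZMod C.len) (x : D) : Prop := X.Cw (C.dart j) x (C.inDart j)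

/-- The `i`-th visit of `C` and the `j`-th visit of `C'` are the beginning of a maximal common
subwalk with `k` edges (`k = 0` is allowed). -/
def MaxShared (C C' : X.ClosedWalk) (i : ZMod C.len) (j : ZMod C'.len) (k : ℕ) : Prop :=
  X.vert (C.dart i) = X.vert (C'.dart j) ∧
  C.dart (i - 1) ≠ C'.dart (j - 1) ∧
  (∀ t : ℕ, t < k → C.dart (i + t) = C'.dart (j + t)) ∧
  C.dart (i + k) ≠ C'.dart (j + k)

/-- `C` crosses `C'` left-to-right at the maximal common subwalk that begins at `(i, j)`. -/
def CrossesLR (C C' : X.ClosedWalk) (i : ZMod C.len) (j : ZMod C'.len) : Prop :=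
  ∃ k : ℕ, MaxShared C C' i j k ∧
    C'.IsLeft j (C.inDart i) ∧ C'.IsRight (j + k) (C.dart (i + k))

/-- `C` crosses `C'` right-to-left at the maximal common subwalk that begins at `(i, j)`. -/
def CrossesRL (C C' : X.ClosedWalk) (i : ZMod C.len) (j : ZMod C'.len) : Prop :=
  ∃ k : ℕ, MaxShared C C' i j k ∧
    C'.IsRight j (C.inDart i) ∧ C'.IsLeft (j + k) (C.dart (i + k))

/-- The algebraic crossing number: left-to-right crossings minus right-to-left crossings of `C`
with `C'`, summed over all maximal common subwalks. -/
noncomputable def crossingNumber (C C' : X.ClosedWalk) : ℤ :=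
  (Nat.card {p : ZMod C.len × ZMod C'.len // CrossesLR C C' p.1 p.2} : ℤ) -
    (Nat.card {p : ZMod C.len × ZMod C'.len // CrossesRL C C' p.1 p.2} : ℤ)

/-- A closed walk is weakly simple if every vertex is visited at most twice and the walk does not
cross itself. The last clause says that the walk is not a proper power of a shorter closed walk: the
two strands of a closed walk that winds twice around a noncontractible cycle never separate, yet no
simple curve is close to it. -/
def WeaklySimple (C : X.ClosedWalk) : Prop :=
  (∀ v : V, Nat.card {i : ZMod C.len // X.vert (C.dart i) = v} ≤ 2) ∧
  (∀ i j, ¬ CrossesLR C C i j ∧ ¬ CrossesRL C C i j) ∧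
  (∀ i j, i ≠ j → ∃ t : ℕ, C.dart (i + t) ≠ C.dart (j + t))

/-- `C` crosses `C'` only right-to-left, and at least once. -/
def CrossesOnlyRL (C C' : X.ClosedWalk) : Prop :=
  (∀ i j, ¬ CrossesLR C C' i j) ∧ ∃ i j, CrossesRL C C' i j

/-- `p`, `q`, `r`, `s` are distinct darts that occur in this clockwise cyclic order at a vertex. -/
def Cw4 (X : EmbDigraph V D) (p q r s : D) : Prop := X.Cw p q r ∧ X.Cw p r s

/-- At every common vertex of `C` and `C'`, at most three incident darts are used by `C` and `C'`
(the incoming or the outgoing ones coincide), or the clockwise order of the four darts is: two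
incoming ones followed by two outgoing ones. -/
def TouchUnidirectionally (C C' : X.ClosedWalk) : Prop :=
  ∀ i j, X.vert (C.dart i) = X.vert (C'.dart j) →
    C.inDart i = C'.inDart j ∨ C.dart i = C'.dart j ∨
    Cw4 X (C.inDart i) (C'.inDart j) (C.dart i) (C'.dart j) ∨
    Cw4 X (C.inDart i) (C'.inDart j) (C'.dart j) (C.dart i) ∨
    Cw4 X (C'.inDart j) (C.inDart i) (C.dart i) (C'.dart j) ∨
    Cw4 X (C'.inDart j) (C.inDart i) (C'.dart j) (C.dart i)

end EmbDigraph.ClosedWalk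

/-! ## Directed graphs on the flat torus -/

/-- An edge of the planarization is a piece of an edge of the graph, of the meridian or of the
horizon. -/
inductive EdgeKind where
  | graph
  | meridian
  | horizon

/-- A connected directed graph `G` embedded on the flat torus, together with its intersections with
the meridian `M` (directed bottom-to-top) and the horizon `H` (directed left-to-right), stored as the
planarization of `G ∪ M ∪ H`. The vertices of the planarization are the vertices of `G` and the
crossing points. The edges of kind `graph` are the edges of `G`, subdivided at their crossings with
`M` and `H` and directed as in `G`. -/
structure TorusGraph (V D : Type) [Fintype V] [Fintype D] extends EmbDigraph V D where
  connected : ∀ u v : V, Relation.ReflTransGen (toEmbDigraph.Joined fun _ => True) u v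
  /-- Euler's formula `|V| - |E| + |F| = 0`; the number of edges is half the number of darts. -/
  euler : 2 * Fintype.card V + 2 * toEmbDigraph.numFaces = Fintype.card D
  kind : D → EdgeKind
  kind_twin : ∀ d, kind (twin d) = kind d
  /-- The meridian. -/
  M : toEmbDigraph.ClosedWalk
  /-- The horizon. -/
  H : toEmbDigraph.ClosedWalk
  M_simple : M.Simple
  H_simple : H.Simple
  M_contains : ∀ d, M.Contains d ↔ kind d = EdgeKind.meridian ∧ fwd d = true
  H_contains : ∀ d, H.Contains d ↔ kind d = EdgeKind.horizon ∧ fwd d = true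
  /-- Each vertex on the meridian or the horizon is a crossing point: it has four darts, and two
  curves of different kinds go straight through it. -/
  crossing_point : ∀ d, kind d ≠ EdgeKind.graph →
    rot (rot (rot (rot d))) = d ∧ kind (rot d) ≠ kind d ∧
    kind (rot (rot d)) = kind d ∧ fwd (rot (rot d)) = !fwd d ∧
    kind (rot (rot (rot d))) = kind (rot d) ∧ fwd (rot (rot (rot d))) = !fwd (rot d)
  /-- Meridian and horizon meet exactly once. -/
  orbits_meet : ∃! v, M.Visits v ∧ H.Visits v
  /-- There, the horizon leaves to the right of the meridian. -/
  orbits_cross : ∀ d, kind d = EdgeKind.meridian → fwd d = true →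
    kind (rot d) = EdgeKind.horizon → fwd (rot d) = true
  /-- The graph `G` is connected. -/
  graph_connected : ∀ d d', kind d = EdgeKind.graph → kind d' = EdgeKind.graph →
    Relation.ReflTransGen (toEmbDigraph.Joined fun x => kind x = EdgeKind.graph) (vert d) (vert d')

namespace TorusGraph

variable {V D : Type} [Fintype V] [Fintype D] (G : TorusGraph V D)

/-- A directed closed walk on the torus along edges of the planarization. -/
abbrev Walk := G.toEmbDigraph.ClosedWalk

/-- The walk uses only edges of the graph `G`, so it is a directed closed walk in `G` (at a crossing
point it necessarily goes straight on). -/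
def InGraph (C : G.Walk) : Prop := ∀ i, G.kind (C.dart i) = EdgeKind.graph

/-- A directed cycle of the graph `G`. -/
def IsCycle (C : G.Walk) : Prop := G.InGraph C ∧ C.Simple

/-- All directed cycles of `G` are noncontractible. -/
def EssentiallyAcyclic : Prop := ∀ C : G.Walk, G.IsCycle C → ¬ C.Contractible

/-- How often the walk crosses the meridian left-to-right, algebraically. -/
noncomputable def m (C : G.Walk) : ℤ := C.crossingNumber G.M

/-- How often the walk is crossed by the horizon left-to-right, algebraically, i.e. how often it
crosses the horizon bottom-to-top. -/
noncomputable def h (C : G.Walk) : ℤ := G.H.crossingNumber C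

/-- The homotopy class. -/
noncomputable def homotopyClass (C : G.Walk) : ℤ × ℤ := (G.m C, G.h C)

/-- Parallel closed walks. -/
def Parallel (C C' : G.Walk) : Prop := G.homotopyClass C = G.homotopyClass C'

/-- Parallel to the first orbit, the meridian. -/
def IsOneOrbital (C : G.Walk) : Prop := G.Parallel C G.M

end TorusGraph

/-! ## A random access machine with a step count -/

namespace RAM

/-- The memory: registers and arrays of natural numbers. A program mentions finitely many of them. -/
structure State where
  reg : ℕ → ℕ
  arr : ℕ → ℕ → ℕ

/-- Tests compare two registers. -/
inductive Test where
  | eq (x y : ℕ)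
  | ne (x y : ℕ)
  | lt (x y : ℕ)

/-- The outcome of a test. -/
def Test.Holds (s : State) : Test → Prop
  | .eq x y => s.reg x = s.reg y
  | .ne x y => s.reg x ≠ s.reg y
  | .lt x y => s.reg x < s.reg y

/-- Programs. Numbers can only be copied, compared, incremented, decremented and used as array
indices, so that the words of the machine grow by at most one per step and a unit cost per
instruction is realistic. -/
inductive Program where
  /-- do nothing -/
  | skip
  /-- `x := c` -/
  | const (x c : ℕ)
  /-- `x := y` -/
  | copy (x y : ℕ)
  /-- `x := x + 1` -/
  | inc (x : ℕ)
  /-- `x := x - 1` (truncated at `0`) -/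
  | dec (x : ℕ)
  /-- `x := a[y]` -/
  | load (x a y : ℕ)
  /-- `a[x] := y` -/
  | store (a x y : ℕ)
  /-- `p` followed by `q` -/
  | seq (p q : Program)
  /-- `if b then p else q` -/
  | ite (b : Test) (p q : Program)
  /-- `while b do p` -/
  | while (b : Test) (p : Program)

/-- Write a register. -/
def State.setReg (s : State) (x v : ℕ) : State := { s with reg := Function.update s.reg x v }

/-- Write an array cell. -/
def State.setArr (s : State) (a i v : ℕ) : State :=
  { s with arr := Function.update s.arr a (Function.update (s.arr a) i v) }

/-- `Exec p s t s'`: started in the memory `s`, the program `p` halts after exactly `t` steps with the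
memory `s'`. Every elementary instruction and every evaluation of a test is one step. -/
inductive Exec : Program → State → ℕ → State → Prop
  | skip (s : State) : Exec .skip s 1 s
  | const (s : State) (x c : ℕ) : Exec (.const x c) s 1 (s.setReg x c)
  | copy (s : State) (x y : ℕ) : Exec (.copy x y) s 1 (s.setReg x (s.reg y))
  | inc (s : State) (x : ℕ) : Exec (.inc x) s 1 (s.setReg x (s.reg x + 1))
  | dec (s : State) (x : ℕ) : Exec (.dec x) s 1 (s.setReg x (s.reg x - 1))
  | load (s : State) (x a y : ℕ) : Exec (.load x a y) s 1 (s.setReg x (s.arr a (s.reg y)))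
  | store (s : State) (a x y : ℕ) : Exec (.store a x y) s 1 (s.setArr a (s.reg x) (s.reg y))
  | seq {p q : Program} {s s' s'' : State} {t t' : ℕ} :
      Exec p s t s' → Exec q s' t' s'' → Exec (.seq p q) s (t + t') s''
  | ite_true {b : Test} {p q : Program} {s s' : State} {t : ℕ} :
      b.Holds s → Exec p s t s' → Exec (.ite b p q) s (t + 1) s'
  | ite_false {b : Test} {p q : Program} {s s' : State} {t : ℕ} :
      ¬ b.Holds s → Exec q s t s' → Exec (.ite b p q) s (t + 1) s'
  | while_true {b : Test} {p : Program} {s s' s'' : State} {t t' : ℕ} :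
      b.Holds s → Exec p s t s' → Exec (.while b p) s' t' s'' →
      Exec (.while b p) s (t + t' + 1) s''
  | while_false {b : Test} {p : Program} {s : State} :
      ¬ b.Holds s → Exec (.while b p) s 1 s

end RAM

/-! ## Input and output -/

/-- A number that stands for the kind of an edge. -/
def EdgeKind.code : EdgeKind → ℕ
  | .graph => 0
  | .meridian => 1
  | .horizon => 2

/-- The table of a function on `Fin n`, padded by zeros. -/
def tableOf {n : ℕ} (f : Fin n → ℕ) : ℕ → ℕ := fun i => if hi : i < n then f ⟨i, hi⟩ else 0

/-- The list of the darts of a closed walk, padded by zeros. -/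
def walkTable {V : Type} {n : ℕ} {X : EmbDigraph V (Fin n)} (C : X.ClosedWalk) : ℕ → ℕ :=
  fun i => if i < C.len then (C.dart (i : ZMod C.len) : ℕ) else 0

/-- The input: the planarization with its rotation system (one table each for the vertex, the
clockwise successor, the twin, the direction and the kind of a dart), two closed walks as lists of
darts, and a dart. Everything else is zero. -/
def inputState {v n : ℕ} (G : TorusGraph (Fin v) (Fin n)) (Cl Cr : G.Walk) (e : Fin n) :
    RAM.State where
  reg x := match x with
    | 1 => v
    | 2 => n
    | 3 => Cl.len
    | 4 => Cr.len
    | 5 => e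
    | _ => 0
  arr a := match a with
    | 1 => tableOf fun d => (G.vert d : ℕ)
    | 2 => tableOf fun d => (G.rot d : ℕ)
    | 3 => tableOf fun d => (G.twin d : ℕ)
    | 4 => tableOf fun d => (G.fwd d).toNat
    | 5 => tableOf fun d => (G.kind d).code
    | 6 => walkTable Cl
    | 7 => walkTable Cr
    | _ => fun _ => 0

/-- The memory shows the closed walk `C` as output: its length in register `0` and its darts, in
order, at the beginning of array `0`. -/
def IsOutput {V : Type} {n : ℕ} {X : EmbDigraph V (Fin n)} (s : RAM.State) (C : X.ClosedWalk) :
    Prop :=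
  s.reg 0 = C.len ∧ ∀ i : ℕ, i < C.len → s.arr 0 i = (C.dart (i : ZMod C.len) : ℕ)

set_option linter.unusedSectionVars false

/-! ## The clockwise order at a vertex -/

namespace EmbDigraph

variable {V D : Type} (X : EmbDigraph V D)

/-! Write L and R for the two cycles and k for the algebraic crossing number of R with L. The walk
sought runs along L from one crossing to another and then back along R to its starting point.

Crossing numbers are first made local. Whether a maximal common subwalk is a crossing depends only
on the sides at its two ends, so the crossing number is minus the sum of an antisymmetric edge
function, the `flux`, along the walk (`crossingNumber_eq_neg_sum_flux`). The flux vanishes around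
every face (`sum_flux_face`). By Euler's formula and a dimension count such a function is a
potential difference plus multiples of the fluxes through M and H (`exists_potential`). Hence
crossing numbers are determinants of homotopy classes (`crossingNumber_eq_det`).

Since L crosses R in one direction only and the cycles touch only unidirectionally, the end of each
crossing can be marked on both cycles, and the flux along an arc between marks counts the marks on
it (`flux_dartL`, `flux_dartR`). Each cycle carries k marks (`marksL_len`, `marksR_len`). A walk
composed of an arc of L from mark to mark with α marks and a returning arc of R with β marks has
crossing number -α with R and β with L (`crossingNumbers_twoArcs`); both are nonzero.

Suppose that the arc of L is proper and the composed walk is not simple. Cutting it at a common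
inner vertex gives two closed walks whose crossing numbers with L and R have the same signs as
before (`exists_split`). If α = 1, one of them has crossing number zero with R, so it is homologous
to a positive multiple of R and crosses L at least k times, whereas β ≤ k - 1
(`simple_of_marksL_eq_one`). In the case of opposed signs one takes α = m(R). Then 1 ≤ β ≤ k - 1
forces the class (0,1), and a cut would produce two walks with positive h whose sum is 1
(`orbital_of_marksL_eq`). The arc of L can be all of L only if k = 1; then the walk is L followed by
R, and changing over at the crossing turns it into a touching (`weaklySimple_of_isTwoArcs`).

To contain e, the arc starts at the last mark at or before e (`exists_arc_of_marks`). Time is linear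
because the darts to the left of R at different vertices are disjoint (`Simple.sum_numLeft_le`), and
everything else is a bounded number of rounds along L or R. -/

theorem vert_rot (d : D) : X.vert (X.rot d) = X.vert d :=
  ((X.vert_eq_iff _ _).2 ⟨1, by simp⟩).symm

theorem vert_iterate_rot (i : ℕ) (d : D) : X.vert (X.rot^[i] d) = X.vert d := by
  induction i with
  | zero => rfl
  | succ i ih => rw [Function.iterate_succ_apply', vert_rot, ih]

variable [Finite D]

theorem rot_mem_periodicPts (a : D) : a ∈ Function.periodicPts X.rot :=
  (X.rot.injective).mem_periodicPts a

theorem rot_period_pos (a : D) : 0 < Function.minimalPeriod X.rot a :=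
  Function.minimalPeriod_pos_of_mem_periodicPts (X.rot_mem_periodicPts a)

theorem exists_iterate_rot {a b : D} (h : X.vert a = X.vert b) :
    ∃ i < Function.minimalPeriod X.rot a, X.rot^[i] a = b := by
  obtain ⟨i, hi⟩ := ((X.vert_eq_iff _ _).1 h).exists_nat_pow_eq
  refine ⟨i % Function.minimalPeriod X.rot a, Nat.mod_lt _ (X.rot_period_pos a), ?_⟩
  rw [Function.iterate_mod_minimalPeriod_eq, Equiv.Perm.iterate_eq_pow, hi]

variable {X}

theorem Cw.vert_left {a b c : D} (h : X.Cw a b c) : X.vert a = X.vert b := by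
  obtain ⟨i, j, -, -, -, rfl, -⟩ := h
  rw [vert_iterate_rot]

theorem Cw.rotate {a b c : D} (h : X.Cw a b c) : X.Cw b c a := by
  obtain ⟨i, j, h0, hij, hj, rfl, rfl⟩ := h
  have hN : Function.minimalPeriod X.rot (X.rot^[i] a) = Function.minimalPeriod X.rot a :=
    Function.minimalPeriod_apply_iterate (X.rot_mem_periodicPts a) i
  refine ⟨j - i, Function.minimalPeriod X.rot a - i, by omega, by omega, by omega, ?_, ?_⟩
  · rw [← Function.iterate_add_apply, Nat.sub_add_cancel hij.le]
  · rw [← Function.iterate_add_apply, Nat.sub_add_cancel (by omega),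
      Function.iterate_minimalPeriod]

theorem Cw.ne_left {a b c : D} (h : X.Cw a b c) : a ≠ b := by
  obtain ⟨i, j, h0, hij, hj, rfl, -⟩ := h
  intro h
  have := (Function.iterate_eq_iterate_iff_of_lt_minimalPeriod (f := X.rot) (x := a)
    (m := 0) (n := i) (by omega) (by omega)).1 h
  omega

theorem Cw.ne_right {a b c : D} (h : X.Cw a b c) : b ≠ c := h.rotate.ne_left

theorem Cw.not_swap {a b c : D} (h : X.Cw a b c) : ¬ X.Cw a c b := by
  obtain ⟨i, j, h0, hij, hj, rfl, rfl⟩ := h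
  rintro ⟨i', j', h0', hij', hj', h1, h2⟩
  have := (Function.iterate_eq_iterate_iff_of_lt_minimalPeriod (f := X.rot) (x := a)
    (by omega) (by omega)).1 h1
  have := (Function.iterate_eq_iterate_iff_of_lt_minimalPeriod (f := X.rot) (x := a)
    (by omega) (by omega)).1 h2
  omega

theorem cw_or_cw {a b c : D} (hab : X.vert a = X.vert b) (hac : X.vert a = X.vert c)
    (h1 : a ≠ b) (h2 : b ≠ c) (h3 : a ≠ c) : X.Cw a b c ∨ X.Cw a c b := by
  obtain ⟨i, hi, rfl⟩ := X.exists_iterate_rot hab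
  obtain ⟨j, hj, rfl⟩ := X.exists_iterate_rot hac
  have hi0 : i ≠ 0 := by rintro rfl; exact h1 rfl
  have hj0 : j ≠ 0 := by rintro rfl; exact h3 rfl
  have hij : i ≠ j := by rintro rfl; exact h2 rfl
  rcases lt_or_gt_of_ne hij with h | h
  · exact Or.inl ⟨i, j, by omega, h, hj, rfl, rfl⟩
  · exact Or.inr ⟨j, i, by omega, h, hi, rfl, rfl⟩

theorem Cw.trans_left {a b c d : D} (h : X.Cw a b c) (h' : X.Cw a c d) : X.Cw a b d := by
  obtain ⟨i, j, h0, hij, hj, rfl, rfl⟩ := h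
  obtain ⟨i', j', h0', hij', hj', h1, rfl⟩ := h'
  have := (Function.iterate_eq_iterate_iff_of_lt_minimalPeriod (f := X.rot) (x := a)
    (by omega) (by omega)).1 h1
  exact ⟨i, j', h0, by omega, hj', rfl, rfl⟩

theorem Cw.trans_right {a b c d : D} (h : X.Cw a b c) (h' : X.Cw a c d) : X.Cw b c d :=
  (h'.rotate.trans_left h.rotate.rotate).rotate.rotate

open Classical in
/-- Passing from one dart to the next one clockwise, one enters the sector from `a` to `c` exactly
at `a` and leaves it exactly before `c`. -/
theorem cw_rot_sub_cw {a c : D} (x : D) (hac : X.vert a = X.vert c) (hne : a ≠ c) :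
    (if X.Cw a (X.rot x) c then (1 : ℤ) else 0) - (if X.Cw a x c then 1 else 0) =
      (if x = a then 1 else 0) - (if X.rot x = c then 1 else 0) := by
  obtain ⟨j, hj, rfl⟩ := X.exists_iterate_rot hac
  have hj0 : j ≠ 0 := by rintro rfl; exact hne rfl
  by_cases hx : X.vert a = X.vert x
  · obtain ⟨i, hi, rfl⟩ := X.exists_iterate_rot hx
    have key : ∀ k < Function.minimalPeriod X.rot a,
        X.Cw a (X.rot^[k] a) (X.rot^[j] a) ↔ 0 < k ∧ k < j := by
      intro k hk
      constructor
      · rintro ⟨i', j', h0', hij', hj', h1, h2⟩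
        have := (Function.iterate_eq_iterate_iff_of_lt_minimalPeriod (f := X.rot) (x := a)
          (by omega) (by omega)).1 h1
        have := (Function.iterate_eq_iterate_iff_of_lt_minimalPeriod (f := X.rot) (x := a)
          (by omega) (by omega)).1 h2
        omega
      · rintro ⟨h1, h2⟩
        exact ⟨k, j, h1, h2, hj, rfl, rfl⟩
    have e1 : X.rot^[i] a = a ↔ i = 0 :=
      Function.iterate_eq_iterate_iff_of_lt_minimalPeriod (f := X.rot) (x := a) (n := 0) hi
        (by omega)
    rw [← Function.iterate_succ_apply' X.rot i a, key i hi]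
    simp only [e1]
    by_cases hi' : i + 1 < Function.minimalPeriod X.rot a
    · have e2 : X.rot^[i + 1] a = X.rot^[j] a ↔ i + 1 = j :=
        Function.iterate_eq_iterate_iff_of_lt_minimalPeriod (f := X.rot) (x := a) hi' hj
      simp only [Nat.succ_eq_add_one]
      rw [key _ hi']
      simp only [e2]
      split_ifs <;> omega
    -- Here `x` is the last dart before `a`, so the rotation wraps around to `a` itself.
    · have e : i + 1 = Function.minimalPeriod X.rot a := by omega
      have e0 : X.rot^[i + 1] a = X.rot^[0] a := by
        rw [e, Function.iterate_minimalPeriod]; rfl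
      have e2 : X.rot^[0] a = X.rot^[j] a ↔ 0 = j :=
        Function.iterate_eq_iterate_iff_of_lt_minimalPeriod (f := X.rot) (x := a) (by omega) hj
      simp only [Nat.succ_eq_add_one]
      rw [e0, key 0 (by omega)]
      simp only [e2]
      split_ifs <;> omega
  · have h1 : ¬ X.Cw a (X.rot x) (X.rot^[j] a) := fun h => hx (by
      rw [h.vert_left, vert_rot])
    have h2 : ¬ X.Cw a x (X.rot^[j] a) := fun h => hx h.vert_left
    have h3 : x ≠ a := by rintro rfl; exact hx rfl
    have h4 : X.rot x ≠ X.rot^[j] a := fun h => hx (by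
      rw [← X.vert_rot x, h, vert_iterate_rot])
    simp [h1, h2, h3, h4]

end EmbDigraph

/-! ## The crossing number as a sum of local contributions -/

namespace EmbDigraph.ClosedWalk

variable {V D : Type} {X : EmbDigraph V D}

theorem vert_inDart (C : X.ClosedWalk) (i : ZMod C.len) :
    X.vert (C.inDart i) = X.vert (C.dart i) := by
  have := C.chain (i - 1)
  rwa [sub_add_cancel] at this

theorem inDart_add_one (C : X.ClosedWalk) (i : ZMod C.len) :
    C.inDart (i + 1) = X.twin (C.dart i) := by
  rw [inDart, add_sub_cancel_right]

theorem fwd_inDart (C : X.ClosedWalk) (i : ZMod C.len) : X.fwd (C.inDart i) = false := by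
  rw [inDart, X.fwd_twin, C.fwd_dart]; rfl

theorem inDart_ne_dart (C C' : X.ClosedWalk) (i : ZMod C.len) (j : ZMod C'.len) :
    C.inDart i ≠ C'.dart j := by
  intro h
  have := C.fwd_inDart i
  rw [h, C'.fwd_dart] at this
  cases this

theorem dart_ne_inDart (C C' : X.ClosedWalk) (i : ZMod C.len) (j : ZMod C'.len) :
    C.dart i ≠ C'.inDart j := (inDart_ne_dart C' C j i).symm

theorem inDart_eq_iff {C C' : X.ClosedWalk} {i : ZMod C.len} {j : ZMod C'.len} :
    C.inDart i = C'.inDart j ↔ C.dart (i - 1) = C'.dart (j - 1) := by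
  rw [inDart, inDart, X.twin.injective.eq_iff]

theorem MaxShared.inDart_ne {C C' : X.ClosedWalk} {i : ZMod C.len} {j : ZMod C'.len} {k : ℕ}
    (h : MaxShared C C' i j k) : C.inDart i ≠ C'.inDart j := by
  rw [Ne, inDart_eq_iff]; exact h.2.1

theorem vert_succ_eq_of_dart_eq {C C' : X.ClosedWalk} {i : ZMod C.len} {j : ZMod C'.len}
    (h : C.dart i = C'.dart j) : X.vert (C.dart (i + 1)) = X.vert (C'.dart (j + 1)) := by
  rw [← C.chain, ← C'.chain, h]

theorem MaxShared.vert_eq {C C' : X.ClosedWalk} {i : ZMod C.len} {j : ZMod C'.len} {k : ℕ}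
    (h : MaxShared C C' i j k) : X.vert (C.dart (i + k)) = X.vert (C'.dart (j + k)) := by
  cases k with
  | zero => simpa using h.1
  | succ k =>
    have := vert_succ_eq_of_dart_eq (h.2.2.1 k (Nat.lt_succ_self k))
    push_cast
    rwa [← add_assoc, ← add_assoc]

theorem MaxShared.symm {C C' : X.ClosedWalk} {i : ZMod C.len} {j : ZMod C'.len} {k : ℕ}
    (h : MaxShared C C' i j k) : MaxShared C' C j i k :=
  ⟨h.1.symm, h.2.1.symm, fun t ht => (h.2.2.1 t ht).symm, h.2.2.2.symm⟩

theorem MaxShared.length_unique {C C' : X.ClosedWalk} {i : ZMod C.len} {j : ZMod C'.len}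
    {k k' : ℕ} (h : MaxShared C C' i j k) (h' : MaxShared C C' i j k') : k = k' := by
  rcases lt_trichotomy k k' with hk | hk | hk
  · exact absurd (h'.2.2.1 k hk) h.2.2.2
  · exact hk
  · exact absurd (h.2.2.1 k' hk) h'.2.2.2

/-- Of two shared subwalks with the same end, a strictly shorter one would begin inside the longer
one, where the preceding darts agree; this contradicts its maximality. -/
theorem MaxShared.start_unique {C C' : X.ClosedWalk} {i i' : ZMod C.len} {j j' : ZMod C'.len}
    {k k' : ℕ} (h : MaxShared C C' i j k) (h' : MaxShared C C' i' j' k')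
    (hi : i + k = i' + k') (hj : j + k = j' + k') : i = i' ∧ j = j' := by
  wlog hk : k ≤ k' generalizing i i' j j' k k'
  · have := this h' h hi.symm hj.symm (by omega)
    exact ⟨this.1.symm, this.2.symm⟩
  obtain ⟨m, rfl⟩ := Nat.exists_eq_add_of_le hk
  have ei : i = i' + (m : ZMod C.len) := by
    push_cast at hi; linear_combination hi
  have ej : j = j' + (m : ZMod C'.len) := by
    push_cast at hj; linear_combination hj
  cases m with
  | zero => simpa using And.intro ei ej
  | succ m =>
    refine absurd ?_ h.2.1
    have := h'.2.2.1 m (by omega)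
    rwa [show i - 1 = i' + (m : ZMod C.len) by rw [ei]; push_cast; ring,
      show j - 1 = j' + (m : ZMod C'.len) by rw [ej]; push_cast; ring]

theorem natCast_mul_len_left (C C' : X.ClosedWalk) :
    ((C.len * C'.len : ℕ) : ZMod C.len) = 0 ∧ ((C.len * C'.len : ℕ) : ZMod C'.len) = 0 := by
  constructor <;> push_cast <;> simp

/-- The walks must separate again: after `C.len * C'.len` steps both are back at `(i, j)`, and one
step earlier their darts differ by hypothesis. The next lemma does the same backwards. -/
theorem exists_maxShared {C C' : X.ClosedWalk} {i : ZMod C.len} {j : ZMod C'.len}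
    (hv : X.vert (C.dart i) = X.vert (C'.dart j)) (hne : C.dart (i - 1) ≠ C'.dart (j - 1)) :
    ∃ k, MaxShared C C' i j k := by
  classical
  have hex : ∃ t : ℕ, C.dart (i + t) ≠ C'.dart (j + t) := by
    refine ⟨C.len * C'.len - 1, ?_⟩
    have hpos : 1 ≤ C.len * C'.len :=
      Nat.mul_pos (Nat.pos_of_ne_zero C.len_neZero.out) (Nat.pos_of_ne_zero C'.len_neZero.out)
    rw [Nat.cast_sub hpos, Nat.cast_sub hpos, (natCast_mul_len_left C C').1,
      (natCast_mul_len_left C C').2]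
    simpa [sub_eq_add_neg] using hne
  refine ⟨Nat.find hex, hv, hne, fun t ht => ?_, Nat.find_spec hex⟩
  simpa using Nat.find_min hex ht

theorem exists_maxShared_end {C C' : X.ClosedWalk} {i : ZMod C.len} {j : ZMod C'.len}
    (hv : X.vert (C.dart i) = X.vert (C'.dart j)) (hne : C.dart i ≠ C'.dart j) :
    ∃ k : ℕ, MaxShared C C' (i - k) (j - k) k := by
  classical
  have hex : ∃ t : ℕ, C.dart (i - t - 1) ≠ C'.dart (j - t - 1) := by
    refine ⟨C.len * C'.len - 1, ?_⟩
    have hpos : 1 ≤ C.len * C'.len :=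
      Nat.mul_pos (Nat.pos_of_ne_zero C.len_neZero.out) (Nat.pos_of_ne_zero C'.len_neZero.out)
    rw [Nat.cast_sub hpos, Nat.cast_sub hpos, (natCast_mul_len_left C C').1,
      (natCast_mul_len_left C C').2]
    simpa using hne
  have hmin : ∀ t < Nat.find hex, C.dart (i - t - 1) = C'.dart (j - t - 1) :=
    fun t ht => by simpa using Nat.find_min hex ht
  set k := Nat.find hex with hk
  have hshare : ∀ t < k, C.dart (i - k + t) = C'.dart (j - k + t) := by
    intro t ht
    have := hmin (k - 1 - t) (by omega)
    rw [Nat.cast_sub (by omega), Nat.cast_sub (by omega), Nat.cast_sub (by omega),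
      Nat.cast_sub (by omega)] at this
    convert this using 2 <;> push_cast <;> ring
  refine ⟨k, ?_, Nat.find_spec hex, hshare, by simpa using hne⟩
  by_cases h0 : k = 0
  · simpa [h0] using hv
  · simpa using congrArg X.vert (hshare 0 (by omega))

/-! ### Sides -/

variable [Finite D]

theorem isLeft_or_isRight {C : X.ClosedWalk} {j : ZMod C.len} {x : D}
    (hv : X.vert x = X.vert (C.dart j)) (h1 : x ≠ C.inDart j) (h2 : x ≠ C.dart j) :
    C.IsLeft j x ∨ C.IsRight j x := by
  rcases cw_or_cw (X := X) (a := C.inDart j) (b := x) (c := C.dart j)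
    (by rw [vert_inDart, hv]) (vert_inDart C j) h1.symm h2 (inDart_ne_dart C C j j) with h | h
  · exact Or.inl h
  · exact Or.inr h.rotate.rotate.rotate.rotate

theorem IsLeft.not_isRight {C : X.ClosedWalk} {j : ZMod C.len} {x : D} (h : C.IsLeft j x) :
    ¬ C.IsRight j x := fun h' =>
  Cw.not_swap h (Cw.rotate (Cw.rotate h'))

theorem IsLeft.vert_eq {C : X.ClosedWalk} {j : ZMod C.len} {x : D} (h : C.IsLeft j x) :
    X.vert x = X.vert (C.dart j) := by
  rw [← Cw.vert_left h, vert_inDart]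

theorem IsLeft.ne_inDart {C : X.ClosedWalk} {j : ZMod C.len} {x : D} (h : C.IsLeft j x) :
    x ≠ C.inDart j := (Cw.ne_left h).symm

theorem IsLeft.ne_dart {C : X.ClosedWalk} {j : ZMod C.len} {x : D} (h : C.IsLeft j x) :
    x ≠ C.dart j := Cw.ne_right h

/-- Crossing left-to-right and being crossed right-to-left are the same. -/
theorem CrossesLR.symm {C C' : X.ClosedWalk} {i : ZMod C.len} {j : ZMod C'.len}
    (h : CrossesLR C C' i j) : CrossesRL C' C j i := by
  obtain ⟨k, hk, hin, hout⟩ := h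
  refine ⟨k, hk.symm, ?_⟩
  unfold IsLeft IsRight at *
  rcases Nat.eq_zero_or_pos k with rfl | hpos
  · simp only [Nat.cast_zero, add_zero] at *
    have h' := hout.rotate.rotate
    exact ⟨(hin.trans_left h').rotate.rotate, hin.trans_right h'⟩
  -- On a subwalk with an edge, the outgoing darts agree at the beginning and the incoming ones at
  -- the end, so only three darts are involved at each end and the claim is a rotation of them.
  · have h0 : C.dart i = C'.dart j := by simpa using hk.2.2.1 0 hpos
    have h1 : C.inDart (i + k) = C'.inDart (j + k) := by
      rw [inDart_eq_iff]
      have := hk.2.2.1 (k - 1) (by omega)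
      rw [Nat.cast_sub hpos, Nat.cast_sub hpos] at this
      convert this using 2 <;> push_cast <;> ring
    rw [h0, h1]
    exact ⟨hin.rotate.rotate, hout.rotate.rotate⟩

theorem CrossesRL.symm {C C' : X.ClosedWalk} {i : ZMod C.len} {j : ZMod C'.len}
    (h : CrossesRL C C' i j) : CrossesLR C' C j i := by
  obtain ⟨k, hk, hin, hout⟩ := h
  refine ⟨k, hk.symm, ?_⟩
  unfold IsLeft IsRight at *
  rcases Nat.eq_zero_or_pos k with rfl | hpos
  · simp only [Nat.cast_zero, add_zero] at *
    have h' := hout.rotate.rotate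
    have h1 := hin.trans_left h'
    have h2 := hin.trans_right h'
    exact ⟨h2, h1.rotate.rotate⟩
  · have h0 : C.dart i = C'.dart j := by simpa using hk.2.2.1 0 hpos
    have h1 : C.inDart (i + k) = C'.inDart (j + k) := by
      rw [inDart_eq_iff]
      have := hk.2.2.1 (k - 1) (by omega)
      rw [Nat.cast_sub hpos, Nat.cast_sub hpos] at this
      convert this using 2 <;> push_cast <;> ring
    rw [h0, h1]
    exact ⟨hin.rotate, hout.rotate⟩

theorem crossingNumber_swap (C C' : X.ClosedWalk) :
    C'.crossingNumber C = - C.crossingNumber C' := by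
  have e1 : Nat.card {p : ZMod C.len × ZMod C'.len // CrossesLR C C' p.1 p.2} =
      Nat.card {p : ZMod C'.len × ZMod C.len // CrossesRL C' C p.1 p.2} :=
    Nat.card_congr ((Equiv.prodComm _ _).subtypeEquiv fun p =>
      ⟨fun h => h.symm, fun h => h.symm⟩)
  have e2 : Nat.card {p : ZMod C.len × ZMod C'.len // CrossesRL C C' p.1 p.2} =
      Nat.card {p : ZMod C'.len × ZMod C.len // CrossesLR C' C p.1 p.2} :=
    Nat.card_congr ((Equiv.prodComm _ _).subtypeEquiv fun p =>
      ⟨fun h => h.symm, fun h => h.symm⟩)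
  unfold crossingNumber
  rw [e1, e2]
  ring

open Classical in
/-- The number of visits of `C` at which the dart `x` lies to the left of `C`. -/
noncomputable def leftCount (C : X.ClosedWalk) (x : D) : ℤ :=
  ∑ j : ZMod C.len, if C.IsLeft j x then 1 else 0

/-- The algebraic number of times the dart `d` crosses, right-to-left, a copy of `C` pushed slightly
to the left. -/
noncomputable def flux (C : X.ClosedWalk) (d : D) : ℤ :=
  C.leftCount d - C.leftCount (X.twin d)

-- A maximal common subwalk contributes [LR] - [RL], which equals [enters from the left] - [leaves
-- to the left]. An incoming dart to the left of `C'` can occur only where such a subwalk begins,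
-- and an outgoing dart to the left only where one ends. So the two sums over subwalks extend to all
-- pairs of visits.
open Classical in
theorem crossingNumber_eq_sum_prod (C C' : X.ClosedWalk) :
    C.crossingNumber C' =
      ∑ p : ZMod C.len × ZMod C'.len, (if C'.IsLeft p.2 (C.inDart p.1) then (1 : ℤ) else 0) -
      ∑ p : ZMod C.len × ZMod C'.len, (if C'.IsLeft p.2 (C.dart p.1) then (1 : ℤ) else 0) := by
  let P := ZMod C.len × ZMod C'.len
  -- The maximal common subwalks, recorded by beginning and end; each of the two determines the
  -- subwalk.
  let R := {x : P × P // ∃ k : ℕ, MaxShared C C' x.1.1 x.1.2 k ∧ x.1.1 + k = x.2.1 ∧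
    x.1.2 + k = x.2.2}
  let st : R → P := fun r => r.1.1
  let en : R → P := fun r => r.1.2
  have st_inj : Function.Injective st := by
    rintro ⟨⟨⟨i, j⟩, ⟨i1, j1⟩⟩, k, hk, h1, h2⟩ ⟨⟨⟨i', j'⟩, ⟨i1', j1'⟩⟩, k', hk', h1', h2'⟩ h
    simp only [st] at h
    obtain ⟨rfl, rfl⟩ := h
    have := hk.length_unique hk'
    subst this
    simp only at h1 h2 h1' h2'
    subst h1 h2 h1' h2'
    rfl
  have en_inj : Function.Injective en := by
    rintro ⟨⟨⟨i, j⟩, ⟨i1, j1⟩⟩, k, hk, h1, h2⟩ ⟨⟨⟨i', j'⟩, ⟨i1', j1'⟩⟩, k', hk', h1', h2'⟩ h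
    simp only [en] at h
    obtain ⟨rfl, rfl⟩ := h
    obtain ⟨rfl, rfl⟩ := hk.start_unique hk' (h1.trans h1'.symm) (h2.trans h2'.symm)
    rfl
  have hLin : ∑ r : R, (if C'.IsLeft (st r).2 (C.inDart (st r).1) then (1 : ℤ) else 0) =
      ∑ p : P, (if C'.IsLeft p.2 (C.inDart p.1) then (1 : ℤ) else 0) := by
    refine Fintype.sum_of_injective st st_inj _ _ (fun p hp => ?_) (fun r => rfl)
    rw [if_neg]
    intro h
    apply hp
    obtain ⟨k, hk⟩ := exists_maxShared (C := C) (C' := C') (i := p.1) (j := p.2)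
      (by rw [← vert_inDart, h.vert_eq]) (fun e => h.ne_inDart (inDart_eq_iff.2 e))
    exact ⟨⟨(p, (p.1 + k, p.2 + k)), k, hk, rfl, rfl⟩, rfl⟩
  have hLout : ∑ r : R, (if C'.IsLeft (en r).2 (C.dart (en r).1) then (1 : ℤ) else 0) =
      ∑ p : P, (if C'.IsLeft p.2 (C.dart p.1) then (1 : ℤ) else 0) := by
    refine Fintype.sum_of_injective en en_inj _ _ (fun p hp => ?_) (fun r => rfl)
    rw [if_neg]
    intro h
    apply hp
    obtain ⟨k, hk⟩ := exists_maxShared_end (C := C) (C' := C') (i := p.1) (j := p.2)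
      h.vert_eq h.ne_dart
    exact ⟨⟨((p.1 - k, p.2 - k), p), k, hk, by simp, by simp⟩, rfl⟩
  have hLR : ∑ r : R, (if C'.IsLeft (st r).2 (C.inDart (st r).1) ∧
        C'.IsRight (en r).2 (C.dart (en r).1) then (1 : ℤ) else 0) =
      ∑ p : P, (if CrossesLR C C' p.1 p.2 then (1 : ℤ) else 0) := by
    refine Fintype.sum_of_injective st st_inj _ _ (fun p hp => ?_) ?_
    · rw [if_neg]
      rintro ⟨k, hk, -⟩
      exact hp ⟨⟨(p, (p.1 + k, p.2 + k)), k, hk, rfl, rfl⟩, rfl⟩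
    · rintro ⟨⟨⟨i, j⟩, ⟨i1, j1⟩⟩, k, hk, h1, h2⟩
      simp only at h1 h2 hk
      subst h1 h2
      congr 1
      refine propext ⟨fun h => ⟨k, hk, h⟩, ?_⟩
      rintro ⟨k', hk', h⟩
      have := hk.length_unique hk'
      subst this
      exact h
  have hRL : ∑ r : R, (if C'.IsRight (st r).2 (C.inDart (st r).1) ∧
        C'.IsLeft (en r).2 (C.dart (en r).1) then (1 : ℤ) else 0) =
      ∑ p : P, (if CrossesRL C C' p.1 p.2 then (1 : ℤ) else 0) := by
    refine Fintype.sum_of_injective st st_inj _ _ (fun p hp => ?_) ?_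
    · rw [if_neg]
      rintro ⟨k, hk, -⟩
      exact hp ⟨⟨(p, (p.1 + k, p.2 + k)), k, hk, rfl, rfl⟩, rfl⟩
    · rintro ⟨⟨⟨i, j⟩, ⟨i1, j1⟩⟩, k, hk, h1, h2⟩
      simp only at h1 h2 hk
      subst h1 h2
      congr 1
      refine propext ⟨fun h => ⟨k, hk, h⟩, ?_⟩
      rintro ⟨k', hk', h⟩
      have := hk.length_unique hk'
      subst this
      exact h
  have hcard : C.crossingNumber C' = ∑ p : P, (if CrossesLR C C' p.1 p.2 then (1 : ℤ) else 0) -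
      ∑ p : P, (if CrossesRL C C' p.1 p.2 then (1 : ℤ) else 0) := by
    rw [crossingNumber, Nat.card_eq_fintype_card, Nat.card_eq_fintype_card,
      Fintype.card_subtype, Fintype.card_subtype, Finset.sum_boole, Finset.sum_boole]
  rw [hcard, ← hLR, ← hRL, ← hLin, ← hLout, ← Finset.sum_sub_distrib, ← Finset.sum_sub_distrib]
  refine Finset.sum_congr rfl ?_
  rintro ⟨⟨⟨i, j⟩, ⟨i1, j1⟩⟩, k, hk, h1, h2⟩ -
  simp only at h1 h2 hk
  subst h1 h2
  simp only [st, en]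
  have d1 := isLeft_or_isRight (C := C') (j := j) (x := C.inDart i)
    (by rw [vert_inDart, hk.1]) hk.inDart_ne (inDart_ne_dart _ _ _ _)
  have d2 := isLeft_or_isRight (C := C') (j := j + k) (x := C.dart (i + k))
    hk.vert_eq (dart_ne_inDart _ _ _ _) hk.2.2.2
  have n1 := fun h : C'.IsLeft j (C.inDart i) => h.not_isRight
  have n2 := fun h : C'.IsLeft (j + k) (C.dart (i + k)) => h.not_isRight
  by_cases a1 : C'.IsLeft j (C.inDart i) <;> by_cases a2 : C'.IsLeft (j + k) (C.dart (i + k)) <;>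
    simp_all

theorem crossingNumber_eq_sum (C C' : X.ClosedWalk) :
    C.crossingNumber C' = ∑ i, (C'.leftCount (C.inDart i) - C'.leftCount (C.dart i)) := by
  rw [crossingNumber_eq_sum_prod, Fintype.sum_prod_type, Fintype.sum_prod_type,
    ← Finset.sum_sub_distrib]
  rfl

/-- The incoming dart of a visit is the twin of the preceding dart, so the contributions of visits
can be regrouped as contributions of edges. -/
theorem crossingNumber_eq_neg_sum_flux (C C' : X.ClosedWalk) :
    C.crossingNumber C' = - ∑ i, C'.flux (C.dart i) := by
  have h : ∑ i, C'.leftCount (C.inDart i) = ∑ i, C'.leftCount (X.twin (C.dart i)) := by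
    rw [← Equiv.sum_comp (Equiv.addRight (1 : ZMod C.len))]
    refine Finset.sum_congr rfl fun i _ => ?_
    rw [Equiv.coe_addRight, inDart_add_one]
  rw [crossingNumber_eq_sum, Finset.sum_sub_distrib, h, ← Finset.sum_sub_distrib,
    ← Finset.sum_neg_distrib]
  refine Finset.sum_congr rfl fun i _ => ?_
  rw [flux]; ring

theorem flux_twin (C : X.ClosedWalk) (d : D) : C.flux (X.twin d) = - C.flux d := by
  rw [flux, flux, X.twin_twin]; ring

end EmbDigraph.ClosedWalk

/-! ## Crossing numbers on the torus -/

namespace EmbDigraph.ClosedWalk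

variable {V D : Type} {X : EmbDigraph V D} [Fintype D]

open Classical in
theorem leftCount_rot_sub (C : X.ClosedWalk) (x : D) :
    C.leftCount (X.rot x) - C.leftCount x =
      ∑ j, ((if x = C.inDart j then (1 : ℤ) else 0) -
        (if X.rot x = C.dart j then (1 : ℤ) else 0)) := by
  rw [leftCount, leftCount, ← Finset.sum_sub_distrib]
  exact Finset.sum_congr rfl fun j _ =>
    cw_rot_sub_cw x (vert_inDart C j) (inDart_ne_dart C C j j)

open Classical in
/-- The flux through the boundary of a face vanishes. -/
theorem sum_flux_face (C : X.ClosedWalk)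
    (q : Quotient (Equiv.Perm.SameCycle.setoid X.facePerm)) :
    ∑ d : D, (if (Quotient.mk _ d : Quotient (Equiv.Perm.SameCycle.setoid X.facePerm)) = q
      then C.flux d else 0) = 0 := by
  set cl : D → Quotient (Equiv.Perm.SameCycle.setoid X.facePerm) := fun d => Quotient.mk _ d
    with hcl
  have hface : ∀ d, cl (X.facePerm d) = cl d := fun d =>
    Quotient.sound (a := X.facePerm d) (b := d) ⟨-1, by simp⟩
  -- Shifting the first terms by one step along the face turns differences across edges into
  -- differences across the corners of the face.
  have h1 : ∑ d : D, (if cl d = q then C.leftCount d else 0) =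
      ∑ d : D, (if cl d = q then C.leftCount (X.rot (X.twin d)) else 0) := by
    rw [← Equiv.sum_comp X.facePerm]
    refine Finset.sum_congr rfl fun d _ => ?_
    rw [hface]
    rfl
  have h2 : ∑ d : D, (if cl d = q then C.flux d else 0) =
      ∑ d : D, (if cl d = q then
        (C.leftCount (X.rot (X.twin d)) - C.leftCount (X.twin d)) else 0) := by
    have e : ∀ d : D, (if cl d = q then C.flux d else 0) =
        (if cl d = q then C.leftCount d else 0) -
          (if cl d = q then C.leftCount (X.twin d) else 0) := fun d => by
      rw [flux]; split_ifs <;> simp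
    have e' : ∀ d : D, (if cl d = q then
        (C.leftCount (X.rot (X.twin d)) - C.leftCount (X.twin d)) else 0) =
        (if cl d = q then C.leftCount (X.rot (X.twin d)) else 0) -
          (if cl d = q then C.leftCount (X.twin d) else 0) := fun d => by
      split_ifs <;> simp
    rw [Finset.sum_congr rfl fun d _ => e d, Finset.sum_congr rfl fun d _ => e' d,
      Finset.sum_sub_distrib, Finset.sum_sub_distrib, h1]
  -- At a corner, `leftCount` jumps up just after an incoming dart of `C` and down just before an
  -- outgoing one. Both conditions are rewritten as conditions on `d`, so that the sum over `d` can
  -- be evaluated.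
  have h3 : ∀ d : D, (if cl d = q then
        (C.leftCount (X.rot (X.twin d)) - C.leftCount (X.twin d)) else 0) =
      ∑ j, ((if d = C.dart (j - 1) then (if cl d = q then (1 : ℤ) else 0) else 0) -
        (if d = X.facePerm.symm (C.dart j) then (if cl d = q then (1 : ℤ) else 0) else 0)) := by
    intro d
    rw [leftCount_rot_sub]
    split_ifs with h
    · refine Finset.sum_congr rfl fun j _ => ?_
      have e1 : X.twin d = C.inDart j ↔ d = C.dart (j - 1) := X.twin.injective.eq_iff
      have e2 : X.rot (X.twin d) = C.dart j ↔ d = X.facePerm.symm (C.dart j) := by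
        rw [Equiv.eq_symm_apply]; rfl
      simp only [e1, e2]
    · simp
  rw [h2, Finset.sum_congr rfl fun d _ => h3 d, Finset.sum_comm]
  simp only [Finset.sum_sub_distrib, Finset.sum_ite_eq', Finset.mem_univ, if_true]
  have h4 : ∀ j, cl (X.facePerm.symm (C.dart j)) = cl (C.dart j) := fun j => by
    rw [← hface, Equiv.apply_symm_apply]
  simp only [h4]
  -- The visit `j` adds one for the face of the dart `j - 1` and subtracts one for the face of the
  -- dart `j`; around the closed walk this cancels.
  rw [sub_eq_zero, ← Equiv.sum_comp (Equiv.addRight (1 : ZMod C.len))]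
  simp

theorem sum_head_sub_tail {R : Type} [AddCommGroup R] (C : X.ClosedWalk) (g : V → R) :
    ∑ i, (g (X.vert (X.twin (C.dart i))) - g (X.vert (C.dart i))) = 0 := by
  rw [Finset.sum_sub_distrib, sub_eq_zero,
    ← Equiv.sum_comp (Equiv.addRight (1 : ZMod C.len)) fun i => g (X.vert (C.dart i))]
  exact Finset.sum_congr rfl fun i _ => by rw [C.chain]; rfl

theorem crossingNumber_self (C : X.ClosedWalk) : C.crossingNumber C = 0 := by
  have := crossingNumber_swap C C
  omega

end EmbDigraph.ClosedWalk

namespace EmbDigraph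

variable {V D : Type} {X : EmbDigraph V D} [Finite D]

theorem cw_of_rot {a b c : D} (h1 : X.rot a = b) (h2 : X.rot b = c) (hab : a ≠ b) (hac : a ≠ c) :
    X.Cw a b c := by
  subst h1 h2
  have hpos := X.rot_period_pos a
  have hper := Function.iterate_minimalPeriod (f := X.rot) (x := a)
  refine ⟨1, 2, one_pos, one_lt_two, ?_, rfl, rfl⟩
  by_contra hlt
  have : Function.minimalPeriod X.rot a = 1 ∨ Function.minimalPeriod X.rot a = 2 := by omega
  rcases this with h | h <;> rw [h] at hper
  · exact hab hper.symm
  · exact hac hper.symm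

end EmbDigraph

namespace TorusGraph

open EmbDigraph EmbDigraph.ClosedWalk

variable {V D : Type} [Fintype V] [Fintype D] (G : TorusGraph V D)

/-- The darts at a crossing point. -/
theorem eq_of_vert_eq_crossing {x d : D} (hx : G.kind x ≠ EdgeKind.graph)
    (h : G.vert x = G.vert d) :
    d = x ∨ d = G.rot x ∨ d = G.rot (G.rot x) ∨ d = G.rot (G.rot (G.rot x)) := by
  obtain ⟨i, -, rfl⟩ := G.exists_iterate_rot h
  have h4 : G.rot^[4] x = x := (G.crossing_point x hx).1
  have : G.rot^[i % 4] x = G.rot^[i] x := by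
    conv_rhs => rw [← Nat.mod_add_div i 4, Function.iterate_add_apply, Function.iterate_mul]
    rw [Function.iterate_fixed h4]
  rw [← this]
  have : i % 4 < 4 := Nat.mod_lt _ (by norm_num)
  interval_cases i % 4
  · exact Or.inl rfl
  · exact Or.inr (Or.inl rfl)
  · exact Or.inr (Or.inr (Or.inl rfl))
  · exact Or.inr (Or.inr (Or.inr rfl))

open Classical in
/-- For the meridian or the horizon, sides can be read off from the next dart. -/
theorem leftCount_orbit {W : G.Walk} {κ : EdgeKind} (hκ : κ ≠ EdgeKind.graph) (hW : W.Simple)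
    (hc : ∀ d, W.Contains d ↔ G.kind d = κ ∧ G.fwd d = true) {d : D} (hd : G.kind d ≠ κ) :
    W.leftCount d = if G.kind (G.rot d) = κ ∧ G.fwd (G.rot d) = true then 1 else 0 := by
  -- The orbit goes straight through each of its four-valent vertices, so exactly one dart lies on
  -- each side.
  have hin : ∀ j, W.inDart j = G.rot (G.rot (W.dart j)) := by
    intro j
    have hk : G.kind (W.dart j) = κ := ((hc _).1 ⟨j, rfl⟩).1
    have hk' : G.kind (W.inDart j) = κ := by
      rw [inDart, G.kind_twin]; exact ((hc _).1 ⟨_, rfl⟩).1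
    have hcp := G.crossing_point (W.dart j) (by rw [hk]; exact hκ)
    rcases G.eq_of_vert_eq_crossing (by rw [hk]; exact hκ) (vert_inDart W j).symm with
      h | h | h | h
    · exact absurd h (inDart_ne_dart _ _ _ _)
    · rw [h] at hk'; exact absurd (hk'.trans hk.symm) hcp.2.1
    · exact h
    · rw [h, hcp.2.2.2.2.1] at hk'; exact absurd (hk'.trans hk.symm) hcp.2.1
  have h4 : ∀ j, G.rot (G.rot (G.rot (G.rot (W.dart j)))) = W.dart j := fun j =>
    (G.crossing_point _ (by rw [((hc _).1 ⟨j, rfl⟩).1]; exact hκ)).1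
  have hleft : ∀ j, W.IsLeft j d ↔ G.rot d = W.dart j := by
    intro j
    have hk : G.kind (W.dart j) = κ := ((hc _).1 ⟨j, rfl⟩).1
    constructor
    · intro h
      rcases G.eq_of_vert_eq_crossing (by rw [hk]; exact hκ) h.vert_eq.symm with e | e | e | e
      · exact absurd e h.ne_dart
      · refine absurd h fun h' => h'.not_isRight ?_
        subst e
        have hne : W.dart j ≠ G.rot (W.dart j) := fun e => hd (by rw [← e, hk])
        refine cw_of_rot rfl (hin j).symm hne (dart_ne_inDart _ _ _ _)
      · exact absurd (e.trans (hin j).symm) h.ne_inDart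
      · rw [e, h4]
    · intro h
      have e : d = G.rot (W.inDart j) := G.rot.injective (by rw [h, hin, h4])
      refine cw_of_rot e.symm h (fun e' => hd ?_) (inDart_ne_dart _ _ _ _)
      rw [← e', inDart, G.kind_twin]; exact ((hc _).1 ⟨_, rfl⟩).1
  unfold leftCount
  by_cases hr : G.kind (G.rot d) = κ ∧ G.fwd (G.rot d) = true
  · obtain ⟨j, hj⟩ := (hc _).2 hr
    rw [if_pos hr, Finset.sum_eq_single j, if_pos ((hleft j).2 hj.symm)]
    · intro j' _ hj'
      rw [if_neg]
      intro h
      exact hj' (hW _ _ (by rw [hj, ← (hleft j').1 h]))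
    · simp
  · rw [if_neg hr]
    refine Finset.sum_eq_zero fun j _ => if_neg fun h => hr ?_
    exact (hc _).1 ⟨j, ((hleft j).1 h).symm⟩

/-- Only the visit at the common vertex contributes. There `orbits_cross` makes the horizon leave to
the right of the meridian, hence arrive from its left. -/
theorem crossingNumber_H_M : G.H.crossingNumber G.M = 1 := by
  classical
  obtain ⟨v, ⟨⟨j, hj⟩, ⟨i, hi⟩⟩, huniq⟩ := G.orbits_meet
  have hkM : G.kind (G.M.dart j) = EdgeKind.meridian := ((G.M_contains _).1 ⟨j, rfl⟩).1
  have hkH : ∀ i, G.kind (G.H.dart i) = EdgeKind.horizon := fun i =>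
    ((G.H_contains _).1 ⟨i, rfl⟩).1
  have hkH' : ∀ i, G.kind (G.H.inDart i) = EdgeKind.horizon := fun i => by
    rw [inDart, G.kind_twin]; exact hkH _
  have hMne : G.kind (G.M.dart j) ≠ EdgeKind.graph := by rw [hkM]; simp
  obtain ⟨hc1, hc2, hc3, hc4, hc5, hc6⟩ := G.crossing_point _ hMne
  have hout : G.H.dart i = G.rot (G.M.dart j) := by
    rcases G.eq_of_vert_eq_crossing hMne (hj.trans hi.symm) with e | e | e | e
    · have := hkH i; rw [e, hkM] at this; cases this
    · exact e
    · have := hkH i; rw [e, hc3, hkM] at this; cases this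
    · have hk := hkH i
      have hf := G.H.fwd_dart i
      rw [e, hc5] at hk
      have := G.orbits_cross _ hkM (G.M.fwd_dart j) hk
      rw [e, hc6, this] at hf
      cases hf
  have hinn : G.H.inDart i = G.rot (G.rot (G.rot (G.M.dart j))) := by
    rcases G.eq_of_vert_eq_crossing hMne (hj.trans (hi.symm.trans (vert_inDart _ _).symm)) with
      e | e | e | e
    · have := hkH' i; rw [e, hkM] at this; cases this
    · exact absurd (e.trans hout.symm) (inDart_ne_dart _ _ _ _)
    · have := hkH' i; rw [e, hc3, hkM] at this; cases this
    · exact e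
  have hl : ∀ d, G.kind d = EdgeKind.horizon → G.M.leftCount d =
      if G.kind (G.rot d) = EdgeKind.meridian ∧ G.fwd (G.rot d) = true then 1 else 0 := fun d hd =>
    G.leftCount_orbit (by simp) G.M_simple G.M_contains (by rw [hd]; simp)
  rw [crossingNumber_eq_sum, Finset.sum_eq_single i]
  · rw [hl _ (hkH' i), hl _ (hkH i), hinn, hout, hc1, if_pos ⟨hkM, G.M.fwd_dart j⟩, if_neg]
    · simp
    · rintro ⟨-, h⟩
      rw [hc4, G.M.fwd_dart] at h
      cases h
  · intro i' _ hi'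
    have hno : ∀ d, G.vert d = G.vert (G.H.dart i') →
        ¬ (G.kind (G.rot d) = EdgeKind.meridian ∧ G.fwd (G.rot d) = true) := by
      intro d hd h
      obtain ⟨j', hj'⟩ := (G.M_contains _).2 h
      have := huniq (G.vert (G.H.dart i')) ⟨⟨j', by rw [hj', vert_rot, hd]⟩, ⟨i', rfl⟩⟩
      exact hi' (G.H_simple _ _ (this.trans hi.symm))
    rw [hl _ (hkH' i'), hl _ (hkH i'), if_neg (hno _ (vert_inDart _ _)), if_neg (hno _ rfl)]
    simp
  · simp

theorem m_M : G.m G.M = 0 := crossingNumber_self _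

theorem h_M : G.h G.M = 1 := G.crossingNumber_H_M

theorem m_eq (C : G.Walk) : G.m C = - ∑ i, G.M.flux (C.dart i) :=
  crossingNumber_eq_neg_sum_flux _ _

theorem h_eq (C : G.Walk) : G.h C = ∑ i, G.H.flux (C.dart i) := by
  rw [h, crossingNumber_swap, crossingNumber_eq_neg_sum_flux, neg_neg]

theorem isOneOrbital_iff (C : G.Walk) : G.IsOneOrbital C ↔ G.m C = 0 ∧ G.h C = 1 := by
  rw [IsOneOrbital, Parallel, homotopyClass, homotopyClass, m_M, h_M, Prod.mk.injEq]

/-! ### First cohomology of the torus by a dimension count -/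

/-- The darts that are directed like their edges. -/
abbrev FwdDart := {d : D // G.fwd d = true}

/-- The faces. -/
abbrev Face := Quotient (Equiv.Perm.SameCycle.setoid G.facePerm)

theorem card_darts : Fintype.card D = 2 * Fintype.card G.FwdDart := by
  have h : Fintype.card {d : D // ¬ G.fwd d = true} = Fintype.card G.FwdDart :=
    Fintype.card_congr (G.twin.subtypeEquiv fun d => by rw [G.fwd_twin]; simp)
  have e := Fintype.card_congr (Equiv.sumCompl fun d : D => G.fwd d = true)
  rw [Fintype.card_sum, h] at e
  exact e.symm.trans (two_mul _).symm

/-- The dual graph is connected: rotating at a vertex is a passage across an edge followed by a step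
along a face, and the planarization is connected. -/
theorem eq_of_twin_face_eq {R : Type} (c : G.Face → R)
    (hc : ∀ d, c (Quotient.mk _ (G.twin d)) = c (Quotient.mk _ d)) (f f' : G.Face) :
    c f = c f' := by
  have hface : ∀ d, (Quotient.mk _ (G.facePerm d) : G.Face) = Quotient.mk _ d := fun d =>
    Quotient.sound (a := G.facePerm d) (b := d) ⟨-1, by simp⟩
  have hrot : ∀ d, c (Quotient.mk _ (G.rot d)) = c (Quotient.mk _ d) := by
    intro d
    have : G.rot d = G.facePerm (G.twin d) := by
      change _ = G.rot (G.twin (G.twin d)); rw [G.twin_twin]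
    rw [this, hface, hc]
  have hvert : ∀ d d', G.vert d = G.vert d' →
      c (Quotient.mk _ d) = c (Quotient.mk _ d') := by
    intro d d' h
    obtain ⟨i, -, rfl⟩ := G.exists_iterate_rot h
    induction i with
    | zero => rfl
    | succ i ih =>
      rw [Function.iterate_succ_apply', hrot]
      exact ih (G.vert_iterate_rot i d).symm
  induction f using Quotient.inductionOn with | _ d
  induction f' using Quotient.inductionOn with | _ d'
  have key : ∀ u, Relation.ReflTransGen (G.Joined fun _ => True) (G.vert d) u →
      ∀ x, G.vert x = u → c (Quotient.mk _ d) = c (Quotient.mk _ x) := by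
    intro u hu
    induction hu with
    | refl => exact fun x hx => hvert _ _ hx.symm
    | tail _ hj ih =>
      obtain ⟨y, -, hy1, hy2⟩ := hj
      intro x hx
      rw [ih y hy1, ← hc, hvert _ x (hy2.trans hx.symm)]
  exact key _ (G.connected _ _) d' rfl

open Classical in
/-- The boundary map from edges to faces, transposed. -/
noncomputable def faceMatrix : Matrix G.Face G.FwdDart ℚ := fun f d =>
  (if (Quotient.mk _ d.1 : G.Face) = f then 1 else 0) -
    (if (Quotient.mk _ (G.twin d.1) : G.Face) = f then 1 else 0)

/-- The kernel of the transpose consists of the functions on faces that agree across every edge. By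
`eq_of_twin_face_eq` they are constant, so this kernel has dimension at most one. -/
theorem card_face_le_rank : Nat.card G.Face ≤ G.faceMatrix.rank + 1 := by
  classical
  have d0 : D := G.M.dart 0
  let f0 : G.Face := Quotient.mk _ d0
  let K := LinearMap.ker G.faceMatrix.transpose.mulVecLin
  let ev : K →ₗ[ℚ] ℚ := (LinearMap.proj f0).comp K.subtype
  have hev : Function.Injective ev := by
    rw [injective_iff_map_eq_zero]
    rintro ⟨c, hc⟩ h0
    have h0' : c f0 = 0 := h0
    have hmul : ∀ d : G.FwdDart, c (Quotient.mk _ (G.twin d.1)) = c (Quotient.mk _ d.1) := by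
      intro d
      have h1 : G.faceMatrix.transpose.mulVec c d = 0 := congrFun hc d
      simp only [Matrix.mulVec, dotProduct, Matrix.transpose_apply, faceMatrix, sub_mul, ite_mul,
        one_mul, zero_mul, Finset.sum_sub_distrib, Finset.sum_ite_eq, Finset.mem_univ,
        if_true] at h1
      linarith
    have hmul' : ∀ d, c (Quotient.mk _ (G.twin d)) = c (Quotient.mk _ d) := by
      intro d
      cases hd : G.fwd d with
      | true => exact hmul ⟨d, hd⟩
      | false =>
        have := hmul ⟨G.twin d, by rw [G.fwd_twin, hd]; rfl⟩
        simp only [G.twin_twin] at this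
        exact this.symm
    ext f
    have := G.eq_of_twin_face_eq c hmul' f f0
    simpa [h0'] using this
  have h1 : Module.finrank ℚ K ≤ 1 := by
    simpa using LinearMap.finrank_le_finrank_of_injective hev
  have h2 := LinearMap.finrank_range_add_finrank_ker G.faceMatrix.transpose.mulVecLin
  rw [Module.finrank_fintype_fun_eq_card] at h2
  have h3 : G.faceMatrix.rank = Module.finrank ℚ
      (LinearMap.range G.faceMatrix.transpose.mulVecLin) := by
    rw [← Matrix.rank_transpose]; rfl
  rw [Nat.card_eq_fintype_card]
  change _ + Module.finrank ℚ K = _ at h2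
  omega

/-- The coboundary of a potential plus multiples of the fluxes through the orbits. -/
noncomputable def cocycleMap : ((V → ℚ) × ℚ × ℚ) →ₗ[ℚ] (G.FwdDart → ℚ) where
  toFun x d := x.1 (G.vert (G.twin d.1)) - x.1 (G.vert d.1) + x.2.1 * (G.M.flux d.1 : ℤ) +
    x.2.2 * (G.H.flux d.1 : ℤ)
  map_add' x y := by ext d; simp; ring
  map_smul' r x := by ext d; simp; ring

/-- Summing an element of the kernel along `H` and along `M` kills the potential and isolates the
two coefficients, which therefore vanish. The potential is then constant because the planarization
is connected. -/
theorem finrank_ker_cocycleMap : Module.finrank ℚ (LinearMap.ker G.cocycleMap) ≤ 1 := by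
  let v0 : V := G.vert (G.M.dart 0)
  let ev : LinearMap.ker G.cocycleMap →ₗ[ℚ] ℚ :=
    ((LinearMap.proj v0).comp (LinearMap.fst ℚ (V → ℚ) (ℚ × ℚ))).comp (Submodule.subtype _)
  have hev : Function.Injective ev := by
    rw [injective_iff_map_eq_zero]
    rintro ⟨⟨g, a, b⟩, hx⟩ h0
    have h0' : g v0 = 0 := h0
    have hd : ∀ d : G.FwdDart, g (G.vert (G.twin d.1)) - g (G.vert d.1) +
        a * (G.M.flux d.1 : ℤ) + b * (G.H.flux d.1 : ℤ) = 0 := fun d => congrFun hx d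
    have hsum : ∀ C : G.Walk, a * (-(G.m C : ℚ)) + b * (G.h C : ℚ) = 0 := by
      intro C
      have h1 : ∑ i, (g (G.vert (G.twin (C.dart i))) - g (G.vert (C.dart i)) +
        a * (G.M.flux (C.dart i) : ℤ) + b * (G.H.flux (C.dart i) : ℤ)) = 0 :=
        Finset.sum_eq_zero fun i _ => hd ⟨C.dart i, C.fwd_dart i⟩
      rw [Finset.sum_add_distrib, Finset.sum_add_distrib, sum_head_sub_tail, ← Finset.mul_sum,
        ← Finset.mul_sum] at h1
      rw [m_eq, h_eq]
      push_cast
      linarith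
    have ha : a = 0 := by
      have := hsum G.H
      have e1 : G.m G.H = 1 := G.crossingNumber_H_M
      have e2 : G.h G.H = 0 := crossingNumber_self _
      rw [e1, e2] at this
      simpa using this
    have hb : b = 0 := by
      have := hsum G.M
      rw [m_M, h_M] at this
      simpa using this
    subst ha hb
    have hfwd : ∀ d : G.FwdDart, g (G.vert (G.twin d.1)) = g (G.vert d.1) := fun d => by
      have := hd d
      linarith
    have hg : ∀ u, Relation.ReflTransGen (G.Joined fun _ => True) v0 u → g u = 0 := by
      intro u hu
      induction hu with
      | refl => exact h0'
      | tail _ hj ih =>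
        obtain ⟨y, -, hy1, hy2⟩ := hj
        rw [← hy2]
        rw [← hy1] at ih
        cases hd : G.fwd y with
        | true => rw [hfwd ⟨y, hd⟩, ih]
        | false =>
          have := hfwd ⟨G.twin y, by rw [G.fwd_twin, hd]; rfl⟩
          simp only [G.twin_twin] at this
          rw [← this, ih]
    ext u
    · exact hg u (G.connected _ _)
    · rfl
    · rfl
  simpa using LinearMap.finrank_le_finrank_of_injective hev

/-- By antisymmetry, the backward darts of a face supply exactly the negative terms of the matrix.
-/
theorem mulVec_faceMatrix (ψ : D → ℚ) (hψ : ∀ d, ψ (G.twin d) = - ψ d) (f : G.Face) :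
    G.faceMatrix.mulVec (fun d => ψ d.1) f =
      (open Classical in ∑ d, if (Quotient.mk _ d : G.Face) = f then ψ d else 0) := by
  classical
  have h1 : ∑ d : {d : D // ¬ G.fwd d = true},
      (if (Quotient.mk _ d.1 : G.Face) = f then ψ d.1 else 0) =
      ∑ d : G.FwdDart, (if (Quotient.mk _ (G.twin d.1) : G.Face) = f then ψ (G.twin d.1) else 0) :=
    (Equiv.sum_comp (G.twin.subtypeEquiv fun d => by rw [G.fwd_twin]; simp :
      G.FwdDart ≃ {d : D // ¬ G.fwd d = true})
      (fun d => (if (Quotient.mk _ d.1 : G.Face) = f then ψ d.1 else 0))).symm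
  rw [← Fintype.sum_subtype_add_sum_subtype (fun d => G.fwd d = true), h1,
    ← Finset.sum_add_distrib]
  simp only [Matrix.mulVec, dotProduct]
  refine Finset.sum_congr rfl fun d _ => ?_
  rw [faceMatrix, hψ]
  split_ifs <;> ring

/-- The first cohomology of the torus is generated by the fluxes through meridian and horizon. -/
theorem exists_potential (ψ : D → ℚ) (hψ : ∀ d, ψ (G.twin d) = - ψ d)
    (hf : ∀ f : G.Face, (open Classical in
      ∑ d, if (Quotient.mk _ d : G.Face) = f then ψ d else 0) = 0) :
    ∃ (g : V → ℚ) (a b : ℚ), ∀ d, G.fwd d = true →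
      ψ d = g (G.vert (G.twin d)) - g (G.vert d) + a * (G.M.flux d : ℤ) +
        b * (G.H.flux d : ℤ) := by
  classical
  let K := LinearMap.ker G.faceMatrix.mulVecLin
  have hle : LinearMap.range G.cocycleMap ≤ K := by
    rintro _ ⟨⟨g, a, b⟩, rfl⟩
    rw [LinearMap.mem_ker]
    have key := G.mulVec_faceMatrix (fun d => g (G.vert (G.twin d)) - g (G.vert d) +
      a * (G.M.flux d : ℤ) + b * (G.H.flux d : ℤ)) (by
        intro d
        simp only [flux_twin, G.twin_twin]
        push_cast
        ring)
    ext f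
    refine (key f).trans ?_
    have hsplit : ∀ d, (if (Quotient.mk _ d : G.Face) = f then
        (g (G.vert (G.twin d)) - g (G.vert d) + a * (G.M.flux d : ℤ) + b * (G.H.flux d : ℤ))
          else 0) =
        (if (Quotient.mk _ d : G.Face) = f then g (G.vert (G.twin d)) else 0) -
        (if (Quotient.mk _ d : G.Face) = f then g (G.vert d) else 0) +
        a * ((if (Quotient.mk _ d : G.Face) = f then G.M.flux d else 0 : ℤ) : ℚ) +
        b * ((if (Quotient.mk _ d : G.Face) = f then G.H.flux d else 0 : ℤ) : ℚ) := by
      intro d; split_ifs <;> simp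
    have hg : ∑ d, (if (Quotient.mk _ d : G.Face) = f then g (G.vert (G.twin d)) else 0) =
        ∑ d, (if (Quotient.mk _ d : G.Face) = f then g (G.vert d) else 0) := by
      rw [← Equiv.sum_comp G.facePerm fun d =>
        (if (Quotient.mk _ d : G.Face) = f then g (G.vert d) else 0)]
      refine Finset.sum_congr rfl fun d _ => ?_
      have : (Quotient.mk _ (G.facePerm d) : G.Face) = Quotient.mk _ d :=
        Quotient.sound (a := G.facePerm d) (b := d) ⟨-1, by simp⟩
      rw [this]
      have : G.vert (G.facePerm d) = G.vert (G.twin d) := G.vert_rot _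
      rw [this]
    simp only [hsplit]
    rw [Finset.sum_add_distrib, Finset.sum_add_distrib, Finset.sum_sub_distrib, hg, sub_self,
      ← Finset.mul_sum, ← Finset.mul_sum, ← Int.cast_sum, ← Int.cast_sum, sum_flux_face,
      sum_flux_face]
    simp
  have h1 := LinearMap.finrank_range_add_finrank_ker G.cocycleMap
  have h2 := LinearMap.finrank_range_add_finrank_ker G.faceMatrix.mulVecLin
  have h3 := G.finrank_ker_cocycleMap
  have h4 := G.card_face_le_rank
  have h5 : Module.finrank ℚ (LinearMap.range G.faceMatrix.mulVecLin) = G.faceMatrix.rank := rfl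
  have h6 := G.euler
  have h7 := G.card_darts
  have h8 : G.numFaces = Nat.card G.Face := rfl
  simp only [Module.finrank_prod, Module.finrank_fintype_fun_eq_card, Module.finrank_self] at h1 h2
  -- The range has dimension at least |V| + 2 - 1, and the kernel of the face matrix at most |E| -
  -- |F| + 1. These bounds agree by Euler's formula.
  have heq : LinearMap.range G.cocycleMap = K := by
    refine Submodule.eq_of_le_of_finrank_le hle ?_
    change _ + Module.finrank ℚ K = _ at h2
    omega
  have hmem : (fun d : G.FwdDart => ψ d.1) ∈ K := by
    rw [LinearMap.mem_ker]
    ext f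
    exact (G.mulVec_faceMatrix ψ hψ f).trans (hf f)
  rw [← heq] at hmem
  obtain ⟨⟨g, a, b⟩, hx⟩ := hmem
  exact ⟨g, a, b, fun d hd => (congrFun hx ⟨d, hd⟩).symm⟩

/-- Crossing numbers on the torus are determinants of homotopy classes. -/
theorem crossingNumber_eq_det (C W : G.Walk) :
    C.crossingNumber W = G.m C * G.h W - G.h C * G.m W := by
  classical
  obtain ⟨g, a, b, hgab⟩ := G.exists_potential (fun d => (W.flux d : ℤ))
    (fun d => by rw [flux_twin]; push_cast; ring) (fun f => by
      have := sum_flux_face W f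
      have h := congrArg (Int.cast : ℤ → ℚ) this
      push_cast at h
      exact h)
  -- The potential cancels along a closed walk, so crossing numbers with `W` are linear in the
  -- homotopy class. Taking `M` and `H` for `Z` then determines the coefficients.
  have key : ∀ Z : G.Walk, (Z.crossingNumber W : ℚ) = a * G.m Z - b * G.h Z := by
    intro Z
    have h1 : ∑ i, ((W.flux (Z.dart i) : ℤ) : ℚ) =
        ∑ i, (g (G.vert (G.twin (Z.dart i))) - g (G.vert (Z.dart i)) +
        a * (G.M.flux (Z.dart i) : ℤ) + b * (G.H.flux (Z.dart i) : ℤ)) :=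
      Finset.sum_congr rfl fun i _ => hgab _ (Z.fwd_dart i)
    rw [Finset.sum_add_distrib, Finset.sum_add_distrib, sum_head_sub_tail, ← Finset.mul_sum,
        ← Finset.mul_sum] at h1
    rw [m_eq, h_eq, crossingNumber_eq_neg_sum_flux]
    push_cast
    linarith
  have hM := key G.M
  have hH := key G.H
  have hC := key C
  have e1 : G.m G.H = 1 := G.crossingNumber_H_M
  have e2 : G.h G.H = 0 := crossingNumber_self _
  have e3 : G.M.crossingNumber W = - G.m W := crossingNumber_swap _ _
  have e4 : G.H.crossingNumber W = G.h W := rfl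
  rw [m_M, h_M, e3] at hM
  rw [e1, e2, e4] at hH
  push_cast at hM hH
  have ha : a = G.h W := by linarith
  have hb : b = G.m W := by linarith
  rw [ha, hb] at hC
  have : (C.crossingNumber W : ℚ) = ((G.m C * G.h W - G.h C * G.m W : ℤ) : ℚ) := by
    push_cast
    linarith
  exact_mod_cast this

end TorusGraph

/-! ## Two cycles that cross in one direction only -/

namespace EmbDigraph.ClosedWalk

variable {V D : Type} {X : EmbDigraph V D}

/-- At the common vertex given by `i` and `j`, the walk `C` is on a common subwalk with `C'` that it
has entered from the left of `C'`. -/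
def EntersLeft (C C' : X.ClosedWalk) (i : ZMod C.len) (j : ZMod C'.len) : Prop :=
  ∃ k : ℕ, (∀ t < k, C.dart (i - t - 1) = C'.dart (j - t - 1)) ∧
    C'.IsLeft (j - k) (C.inDart (i - k))

/-- The state of the first walk at its `i`-th vertex: whether it is on a common subwalk that it has
entered from the left of the second walk. -/
def StateLeft (L R : X.ClosedWalk) (i : ZMod L.len) : Prop :=
  ∃ j, X.vert (L.dart i) = X.vert (R.dart j) ∧ EntersLeft L R i j

theorem Simple.eq_of_dart_eq {C : X.ClosedWalk} (h : C.Simple) {i j : ZMod C.len}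
    (hd : C.dart i = C.dart j) : i = j := h _ _ (congrArg X.vert hd)

variable [Finite D]

-- The state is inherited along a shared edge and reset by the side of the incoming dart otherwise.
-- The scanning program runs the same recursion.
open Classical in
theorem entersLeft_succ {C C' : X.ClosedWalk} (i : ZMod C.len) (j : ZMod C'.len) :
    EntersLeft C C' (i + 1) (j + 1) ↔
      if C.dart i = C'.dart j then EntersLeft C C' i j else C'.IsLeft (j + 1) (C.inDart (i + 1)) := by
  constructor
  · rintro ⟨k, hk, hl⟩
    cases k with
    | zero =>
      have hl' : C'.IsLeft (j + 1) (C.inDart (i + 1)) := by simpa using hl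
      rw [if_neg]
      · exact hl'
      · intro h
        refine hl'.ne_inDart (inDart_eq_iff.2 ?_)
        simpa using h
    | succ k =>
      have h0 : C.dart i = C'.dart j := by simpa using hk 0 (Nat.succ_pos k)
      rw [if_pos h0]
      refine ⟨k, fun t ht => ?_, ?_⟩
      · have := hk (t + 1) (by omega)
        convert this using 2 <;> push_cast <;> ring
      · convert hl using 1 <;> push_cast
        · ring
        · congr 1; ring
  · split_ifs with h
    · rintro ⟨k, hk, hl⟩
      refine ⟨k + 1, fun t ht => ?_, ?_⟩
      · cases t with
        | zero => simpa using h
        | succ t =>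
          have := hk t (by omega)
          convert this using 2 <;> push_cast <;> ring
      · convert hl using 1 <;> push_cast
        · ring
        · congr 1; ring
    · intro hl
      exact ⟨0, by simp, by simpa using hl⟩

theorem entersLeft_of_dart_ne {C C' : X.ClosedWalk} {i : ZMod C.len} {j : ZMod C'.len}
    (h : C.dart (i - 1) ≠ C'.dart (j - 1)) :
    EntersLeft C C' i j ↔ C'.IsLeft j (C.inDart i) := by
  have := entersLeft_succ (C := C) (C' := C') (i - 1) (j - 1)
  rwa [if_neg h, sub_add_cancel, sub_add_cancel] at this

theorem entersLeft_add {C C' : X.ClosedWalk} {i : ZMod C.len} {j : ZMod C'.len} {k : ℕ}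
    (h : ∀ t : ℕ, t < k → C.dart (i + t) = C'.dart (j + t)) :
    EntersLeft C C' (i + k) (j + k) ↔ EntersLeft C C' i j := by
  induction k with
  | zero => simp
  | succ k ih =>
    have := entersLeft_succ (C := C) (C' := C') (i + k) (j + k)
    rw [if_pos (h k (Nat.lt_succ_self k)), add_assoc, add_assoc] at this
    push_cast
    rw [this]
    exact ih fun t ht => h t (by omega)

theorem MaxShared.entersLeft_iff {C C' : X.ClosedWalk} {i : ZMod C.len} {j : ZMod C'.len} {k : ℕ}
    (h : MaxShared C C' i j k) :
    EntersLeft C C' (i + k) (j + k) ↔ C'.IsLeft j (C.inDart i) := by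
  rw [entersLeft_add h.2.2.1, entersLeft_of_dart_ne h.2.1]

theorem MaxShared.isRight_of_not_isLeft {C C' : X.ClosedWalk} {i : ZMod C.len} {j : ZMod C'.len}
    {k : ℕ} (h : MaxShared C C' i j k) (h' : ¬ C'.IsLeft j (C.inDart i)) :
    C'.IsRight j (C.inDart i) :=
  (isLeft_or_isRight (by rw [vert_inDart, h.1]) h.inDart_ne (inDart_ne_dart _ _ _ _)).resolve_left
    h'

theorem MaxShared.isRight_of_not_isLeft_end {C C' : X.ClosedWalk} {i : ZMod C.len}
    {j : ZMod C'.len} {k : ℕ} (h : MaxShared C C' i j k)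
    (h' : ¬ C'.IsLeft (j + k) (C.dart (i + k))) : C'.IsRight (j + k) (C.dart (i + k)) :=
  (isLeft_or_isRight h.vert_eq (dart_ne_inDart _ _ _ _) h.2.2.2).resolve_left h'

/-- Where a common subwalk ends that was entered from the left, a walk that does not cross
left-to-right leaves to the left. -/
theorem isLeft_of_entersLeft {C C' : X.ClosedWalk} (hLR : ∀ i j, ¬ CrossesLR C C' i j)
    {i : ZMod C.len} {j : ZMod C'.len} (hv : X.vert (C.dart i) = X.vert (C'.dart j))
    (hne : C.dart i ≠ C'.dart j) (h : EntersLeft C C' i j) : C'.IsLeft j (C.dart i) := by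
  obtain ⟨k, hk⟩ := exists_maxShared_end hv hne
  have h1 := hk.entersLeft_iff
  have h2 := hk.isRight_of_not_isLeft_end
  simp only [sub_add_cancel] at h1 h2
  by_contra h'
  exact hLR _ _ ⟨k, hk, h1.1 h, by simpa using h2 h'⟩

theorem entersLeft_of_isLeft {C C' : X.ClosedWalk} (hRL : ∀ i j, ¬ CrossesRL C C' i j)
    {i : ZMod C.len} {j : ZMod C'.len} (h : C'.IsLeft j (C.dart i)) : EntersLeft C C' i j := by
  obtain ⟨k, hk⟩ := exists_maxShared_end h.vert_eq h.ne_dart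
  have h1 := hk.entersLeft_iff
  simp only [sub_add_cancel] at h1
  by_contra h'
  exact hRL _ _ ⟨k, hk, hk.isRight_of_not_isLeft (fun hl => h' (h1.2 hl)), by simpa using h⟩

theorem crossesRL_of_not_entersLeft {C C' : X.ClosedWalk}
    {i : ZMod C.len} {j : ZMod C'.len} (h : C'.IsLeft j (C.dart i)) (h' : ¬ EntersLeft C C' i j) :
    ∃ k : ℕ, MaxShared C C' (i - k) (j - k) k ∧ C'.IsRight (j - k) (C.inDart (i - k)) := by
  obtain ⟨k, hk⟩ := exists_maxShared_end h.vert_eq h.ne_dart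
  have h1 := hk.entersLeft_iff
  simp only [sub_add_cancel] at h1
  exact ⟨k, hk, hk.isRight_of_not_isLeft (fun hl => h' (h1.2 hl))⟩

end EmbDigraph.ClosedWalk

namespace EmbDigraph

open ClosedWalk

variable {V D : Type} {X : EmbDigraph V D}

/-- Two cycles the first of which crosses the second only right-to-left, and which touch only
unidirectionally. -/
structure CrossingPair (L R : X.ClosedWalk) : Prop where
  simpleL : L.Simple
  simpleR : R.Simple
  crosses : L.CrossesOnlyRL R
  touch : L.TouchUnidirectionally R

namespace CrossingPair

variable {L R : X.ClosedWalk} (P : CrossingPair L R)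
include P

theorem not_crossesLR (i : ZMod L.len) (j : ZMod R.len) : ¬ CrossesLR L R i j := P.crosses.1 i j

variable [Finite D]

theorem not_crossesRL_swap (j : ZMod R.len) (i : ZMod L.len) : ¬ CrossesRL R L j i :=
  fun h => P.not_crossesLR i j h.symm

/-- The common subwalk through a common vertex has a beginning. -/
theorem exists_start {i : ZMod L.len} {j : ZMod R.len}
    (hv : X.vert (L.dart i) = X.vert (R.dart j)) :
    ∃ k : ℕ, L.dart (i - k - 1) ≠ R.dart (j - k - 1) ∧
      (∀ t : ℕ, t < k → L.dart (i - k + t) = R.dart (j - k + t)) ∧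
      X.vert (L.dart (i - k)) = X.vert (R.dart (j - k)) := by
  classical
  have hex : ∃ t : ℕ, L.dart (i - t - 1) ≠ R.dart (j - t - 1) := by
    -- No separation of the walks is given, so one is supplied by a crossing: if the walks agreed
    -- backwards forever, they would agree just before the beginning `i0` of a crossing subwalk.
    -- Simplicity of `R` identifies the position on `R` there.
    by_contra! hall
    obtain ⟨-, i0, j0, k, hk, -⟩ := P.crosses
    set t := (i - 1 - i0).val with ht
    have e : ((t : ℕ) : ZMod L.len) = i - 1 - i0 := by rw [ht, ZMod.natCast_zmod_val]
    have h1 := hall t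
    have h2 := hall (t + 1)
    have ei : i - t - 1 = i0 := by rw [e]; ring
    have ej : j - t - 1 = j0 := by
      apply P.simpleR
      rw [← h1, ei, hk.1]
    refine hk.2.1 ?_
    push_cast at h2
    rwa [← sub_sub, ei, ← sub_sub, ej] at h2
  have hmin : ∀ t < Nat.find hex, L.dart (i - t - 1) = R.dart (j - t - 1) :=
    fun t ht => by simpa using Nat.find_min hex ht
  set k := Nat.find hex with hk
  have hshare : ∀ t < k, L.dart (i - k + t) = R.dart (j - k + t) := by
    intro t ht
    have := hmin (k - 1 - t) (by omega)
    rw [Nat.cast_sub (by omega), Nat.cast_sub (by omega), Nat.cast_sub (by omega),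
      Nat.cast_sub (by omega)] at this
    convert this using 2 <;> push_cast <;> ring
  refine ⟨k, Nat.find_spec hex, hshare, ?_⟩
  by_cases h0 : k = 0
  · simpa [h0] using hv
  · simpa using congrArg X.vert (hshare 0 (by omega))

/-- This is where unidirectional touching enters. With the two incoming darts adjacent in the order
of four, the first sees the second on its left while the second sees the first on its right. If the
outgoing darts coincide, only three darts matter. An antiparallel touching could put each incoming
dart on the right of the other cycle. -/
theorem isLeft_start_iff {i : ZMod L.len} {j : ZMod R.len}
    (hv : X.vert (L.dart i) = X.vert (R.dart j)) (hne : L.inDart i ≠ R.inDart j) :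
    L.IsLeft i (R.inDart j) ↔ ¬ R.IsLeft j (L.inDart i) := by
  have key : ∀ {p q x y : D}, X.Cw p q x → X.Cw p q y → ¬ X.Cw q p x ∧ ¬ X.Cw q p y :=
    fun h1 h2 => ⟨h1.rotate.not_swap, h2.rotate.not_swap⟩
  have four : ∀ {p q r s : D}, Cw4 X p q r s → X.Cw p q r ∧ X.Cw p q s :=
    fun h => ⟨h.1, h.1.trans_left h.2⟩
  unfold IsLeft
  rcases P.touch i j hv with h | h | h | h | h | h
  · exact absurd h hne
  · rw [h]
    have hd := cw_or_cw (X := X) (a := L.inDart i) (b := R.inDart j) (c := R.dart j)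
      (by rw [vert_inDart, vert_inDart, hv]) (by rw [vert_inDart, hv]) hne (inDart_ne_dart _ _ _ _)
      (inDart_ne_dart _ _ _ _)
    constructor
    · exact fun h1 h2 => h1.rotate.not_swap h2
    · exact fun h1 => hd.resolve_right fun h2 => h1 h2.rotate.rotate
  · have h1 := four h
    exact ⟨fun _ => (key h1.1 h1.2).2, fun _ => h1.1⟩
  · have h1 := four h
    exact ⟨fun _ => (key h1.1 h1.2).1, fun _ => h1.2⟩
  · have h1 := four h
    exact ⟨fun h' => absurd h' (key h1.1 h1.2).1, fun h' => absurd h1.2 h'⟩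
  · have h1 := four h
    exact ⟨fun h' => absurd h' (key h1.1 h1.2).2, fun h' => absurd h1.1 h'⟩

/-- Both states are decided at the beginning of the common subwalk, where `isLeft_start_iff`
compares them. -/
theorem entersLeft_swap {i : ZMod L.len} {j : ZMod R.len}
    (hv : X.vert (L.dart i) = X.vert (R.dart j)) :
    EntersLeft R L j i ↔ ¬ EntersLeft L R i j := by
  obtain ⟨k, hne, hsh, hv'⟩ := P.exists_start hv
  have h1 := entersLeft_add (C := L) (C' := R) hsh
  have h2 := entersLeft_add (C := R) (C' := L) fun t ht => (hsh t ht).symm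
  rw [sub_add_cancel, sub_add_cancel] at h1 h2
  rw [h1, h2, entersLeft_of_dart_ne hne, entersLeft_of_dart_ne hne.symm]
  exact P.isLeft_start_iff hv' fun h => hne (inDart_eq_iff.1 h)

end CrossingPair

end EmbDigraph

/-! ### Marks: counting crossings along arcs of the two cycles -/

namespace EmbDigraph

open ClosedWalk

variable {V D : Type} {X : EmbDigraph V D}

open Classical in
/-- The indicator of a proposition. -/
noncomputable def ind (p : Prop) : ℤ := if p then 1 else 0

theorem ind_of {p : Prop} (h : p) : ind p = 1 := if_pos h

theorem ind_of_not {p : Prop} (h : ¬ p) : ind p = 0 := if_neg h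

theorem ind_nonneg (p : Prop) : 0 ≤ ind p := by
  unfold ind; split_ifs <;> norm_num

theorem ind_le_one (p : Prop) : ind p ≤ 1 := by
  unfold ind; split_ifs <;> norm_num

theorem ind_not (p : Prop) : ind (¬ p) = 1 - ind p := by
  by_cases h : p
  · rw [ind_of h, ind_of_not (not_not.2 h)]; rfl
  · rw [ind_of h, ind_of_not h]; rfl

/-- The `i`-th vertex of `L` is the end of a common subwalk at which `L` crosses `R`
right-to-left. -/
def MarkedL (L R : X.ClosedWalk) (i : ZMod L.len) : Prop :=
  (∃ j, R.IsLeft j (L.dart i)) ∧ ¬ StateLeft L R i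

/-- The `j`-th vertex of `R` is the end of a common subwalk at which `R` crosses `L`
left-to-right. -/
def MarkedR (L R : X.ClosedWalk) (j : ZMod R.len) : Prop :=
  StateLeft R L j ∧ (¬ ∃ i, L.IsLeft i (R.dart j)) ∧ ¬ ∃ i, L.dart i = R.dart j

/-- The number of marks among `a` consecutive vertices of `L`. -/
noncomputable def marksL (L R : X.ClosedWalk) (i : ZMod L.len) (a : ℕ) : ℤ :=
  ∑ t ∈ Finset.range a, ind (MarkedL L R (i + t))

/-- The number of marks among `b` consecutive vertices of `R`. -/
noncomputable def marksR (L R : X.ClosedWalk) (j : ZMod R.len) (b : ℕ) : ℤ :=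
  ∑ t ∈ Finset.range b, ind (MarkedR L R (j + t))

variable [Finite D]

theorem ClosedWalk.Simple.leftCount_eq {C : X.ClosedWalk} (h : C.Simple) (x : D) :
    C.leftCount x = ind (∃ j, C.IsLeft j x) := by
  classical
  unfold leftCount
  by_cases hx : ∃ j, C.IsLeft j x
  · obtain ⟨j, hj⟩ := hx
    rw [ind_of ⟨j, hj⟩, Finset.sum_eq_single j, if_pos hj]
    · exact fun j' _ hne => if_neg fun hj' => hne (h _ _ (by rw [← hj.vert_eq, hj'.vert_eq]))
    · simp
  · rw [ind_of_not hx]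
    exact Finset.sum_eq_zero fun j _ => if_neg fun hj => hx ⟨j, hj⟩

theorem ClosedWalk.Simple.not_isLeft_dart {C : X.ClosedWalk} (h : C.Simple) (i : ZMod C.len) :
    ¬ ∃ j, C.IsLeft j (C.dart i) := by
  rintro ⟨j, hj⟩
  have := h _ _ hj.vert_eq
  subst this
  exact hj.ne_dart rfl

theorem ClosedWalk.Simple.not_isLeft_inDart {C : X.ClosedWalk} (h : C.Simple) (i : ZMod C.len) :
    ¬ ∃ j, C.IsLeft j (C.inDart i) := by
  rintro ⟨j, hj⟩
  have := h i j (by rw [← vert_inDart, hj.vert_eq])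
  subst this
  exact hj.ne_inDart rfl

theorem ClosedWalk.Simple.flux_dart {C : X.ClosedWalk} (h : C.Simple) (i : ZMod C.len) :
    C.flux (C.dart i) = 0 := by
  rw [flux, h.leftCount_eq, h.leftCount_eq, ind_of_not (h.not_isLeft_dart i), ← inDart_add_one,
    ind_of_not (h.not_isLeft_inDart _), sub_zero]

theorem stateLeft_iff {C C' : X.ClosedWalk} (h : C'.Simple) {i : ZMod C.len} {j : ZMod C'.len}
    (hv : X.vert (C.dart i) = X.vert (C'.dart j)) : StateLeft C C' i ↔ EntersLeft C C' i j := by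
  constructor
  · rintro ⟨j', hv', he⟩
    have := h _ _ (hv'.symm.trans hv)
    rwa [← this]
  · exact fun he => ⟨j, hv, he⟩

theorem stateLeft_succ_of_dart_eq {C C' : X.ClosedWalk} (h : C'.Simple) {i : ZMod C.len}
    {j : ZMod C'.len} (hd : C.dart i = C'.dart j) :
    StateLeft C C' (i + 1) ↔ StateLeft C C' i := by
  rw [stateLeft_iff h (congrArg X.vert hd), stateLeft_iff h (vert_succ_eq_of_dart_eq hd),
    entersLeft_succ, if_pos hd]

theorem stateLeft_succ_of_dart_ne {C C' : X.ClosedWalk} {i : ZMod C.len}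
    (hd : ¬ ∃ j, C.dart i = C'.dart j) :
    StateLeft C C' (i + 1) ↔ ∃ j, C'.IsLeft j (C.inDart (i + 1)) := by
  constructor
  · rintro ⟨j, hv, he⟩
    refine ⟨j, (entersLeft_of_dart_ne ?_).1 he⟩
    rw [add_sub_cancel_right]
    exact fun h => hd ⟨_, h⟩
  · rintro ⟨j, hj⟩
    refine ⟨j, by rw [← vert_inDart, hj.vert_eq], (entersLeft_of_dart_ne ?_).2 hj⟩
    rw [add_sub_cancel_right]
    exact fun h => hd ⟨_, h⟩

/-- The flux along a walk changes sides only at common subwalks. -/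
theorem flux_eq_of_dart_ne {C C' : X.ClosedWalk} (h : C'.Simple) {i : ZMod C.len}
    (hd : ¬ ∃ j, C.dart i = C'.dart j) :
    C'.flux (C.dart i) = ind (∃ j, C'.IsLeft j (C.dart i)) - ind (StateLeft C C' (i + 1)) := by
  rw [flux, h.leftCount_eq, h.leftCount_eq, stateLeft_succ_of_dart_ne hd, inDart_add_one]

namespace CrossingPair

variable {L R : X.ClosedWalk} (P : CrossingPair L R)
include P

/-- On a shared edge the flux is zero and the state persists. On any other edge the flux is [leaves
left] minus the next state. Since `L` never crosses left-to-right, a walk that has entered from the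
left also leaves to the left, so [leaves left] is the sum of the state and the mark. -/
theorem flux_dartL (i : ZMod L.len) :
    R.flux (L.dart i) =
      ind (MarkedL L R i) + ind (StateLeft L R i) - ind (StateLeft L R (i + 1)) := by
  by_cases hd : ∃ j, L.dart i = R.dart j
  · obtain ⟨j, hj⟩ := hd
    rw [stateLeft_succ_of_dart_eq P.simpleR hj, hj, P.simpleR.flux_dart, ind_of_not]
    · ring
    · rintro ⟨h, -⟩
      rw [hj] at h
      exact P.simpleR.not_isLeft_dart j h
  · rw [flux_eq_of_dart_ne P.simpleR hd]
    congr 1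
    by_cases hs : StateLeft L R i
    · obtain ⟨j, hv, he⟩ := id hs
      rw [ind_of hs, ind_of_not (fun h : MarkedL L R i => h.2 hs), ind_of]
      · rfl
      · exact ⟨j, isLeft_of_entersLeft P.not_crossesLR hv (fun h => hd ⟨j, h⟩) he⟩
    · rw [ind_of_not hs, add_zero]
      congr 1
      exact propext ⟨fun h => ⟨h, hs⟩, fun h => h.1⟩

/-- The mirror image: `R` never crosses `L` right-to-left, so leaving to the left requires having
entered from the left, and [leaves left] is the state minus the mark. -/
theorem flux_dartR (j : ZMod R.len) :
    L.flux (R.dart j) =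
      ind (StateLeft R L j) - ind (StateLeft R L (j + 1)) - ind (MarkedR L R j) := by
  by_cases hd : ∃ i, R.dart j = L.dart i
  · obtain ⟨i, hi⟩ := hd
    rw [stateLeft_succ_of_dart_eq P.simpleL hi, hi, P.simpleL.flux_dart,
      ind_of_not fun h : MarkedR L R j => h.2.2 ⟨i, hi.symm⟩]
    ring
  · rw [flux_eq_of_dart_ne P.simpleL hd]
    by_cases hl : ∃ i, L.IsLeft i (R.dart j)
    · obtain ⟨i, hi⟩ := id hl
      have hs : StateLeft R L j := ⟨i, hi.vert_eq, entersLeft_of_isLeft P.not_crossesRL_swap hi⟩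
      rw [ind_of hl, ind_of hs, ind_of_not fun h : MarkedR L R j => h.2.1 hl]
      ring
    · rw [ind_of_not hl]
      have : ind (MarkedR L R j) = ind (StateLeft R L j) := by
        congr 1
        refine propext ⟨fun h => h.1, fun h => ⟨h, hl, ?_⟩⟩
        rintro ⟨i, hi⟩
        exact hd ⟨i, hi.symm⟩
      rw [this]
      ring

theorem ind_stateLeft_swap {i : ZMod L.len} {j : ZMod R.len}
    (hv : X.vert (L.dart i) = X.vert (R.dart j)) :
    ind (StateLeft R L j) = 1 - ind (StateLeft L R i) := by
  rw [stateLeft_iff P.simpleL hv.symm, stateLeft_iff P.simpleR hv, P.entersLeft_swap hv, ind_not]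

theorem markedR_of_markedL {i : ZMod L.len} {j : ZMod R.len}
    (hv : X.vert (L.dart i) = X.vert (R.dart j)) (h : MarkedL L R i) : MarkedR L R j := by
  obtain ⟨⟨j', hj⟩, hs⟩ := h
  have : j' = j := P.simpleR _ _ (by rw [← hj.vert_eq, hv])
  subst this
  rw [stateLeft_iff P.simpleR hv] at hs
  refine ⟨?_, ?_, ?_⟩
  · rw [stateLeft_iff P.simpleL hv.symm, P.entersLeft_swap hv]
    exact hs
  · rintro ⟨i', hi'⟩
    have : i' = i := P.simpleL _ _ (by rw [← hi'.vert_eq, hv])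
    subst this
    obtain ⟨k, hk, hr⟩ := crossesRL_of_not_entersLeft hj hs
    have hRL : CrossesRL L R (i' - k) (j' - k) := ⟨k, hk, hr, by simpa using hj⟩
    obtain ⟨k', hk', -, hr'⟩ := hRL.symm
    have := hk'.length_unique hk.symm
    subst this
    simp only [sub_add_cancel] at hr'
    exact hi'.not_isRight hr'
  · rintro ⟨i', hi'⟩
    have : i' = i := P.simpleL _ _ (by rw [hi', hv])
    subst this
    exact hj.ne_dart hi'

theorem markedL_of_crossesRL {i : ZMod L.len} {j : ZMod R.len} {k : ℕ} (hk : MaxShared L R i j k)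
    (hr : R.IsRight j (L.inDart i)) (hl : R.IsLeft (j + k) (L.dart (i + k))) :
    MarkedL L R (i + k) := by
  refine ⟨⟨_, hl⟩, ?_⟩
  rw [stateLeft_iff P.simpleR hk.vert_eq, hk.entersLeft_iff]
  exact fun h => h.not_isRight hr

/-- The states telescope. At a mark the state of `L` is zero, so between two marks the flux is just
the number of marks. -/
theorem sum_fluxL (i : ZMod L.len) (a : ℕ) :
    ∑ t ∈ Finset.range a, R.flux (L.dart (i + t)) =
      marksL L R i a + ind (StateLeft L R i) - ind (StateLeft L R (i + a)) := by
  unfold marksL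
  induction a with
  | zero => simp
  | succ a ih =>
    rw [Finset.sum_range_succ, Finset.sum_range_succ, ih, P.flux_dartL]
    push_cast
    rw [add_assoc i]
    ring

theorem sum_fluxR (j : ZMod R.len) (b : ℕ) :
    ∑ t ∈ Finset.range b, L.flux (R.dart (j + t)) =
      ind (StateLeft R L j) - ind (StateLeft R L (j + b)) - marksR L R j b := by
  unfold marksR
  induction b with
  | zero => simp
  | succ b ih =>
    rw [Finset.sum_range_succ, Finset.sum_range_succ, ih, P.flux_dartR]
    push_cast
    rw [add_assoc j]
    ring

end CrossingPair

theorem marksL_nonneg (L R : X.ClosedWalk) (i : ZMod L.len) (a : ℕ) : 0 ≤ marksL L R i a :=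
  Finset.sum_nonneg fun _ _ => ind_nonneg _

theorem marksR_nonneg (L R : X.ClosedWalk) (j : ZMod R.len) (b : ℕ) : 0 ≤ marksR L R j b :=
  Finset.sum_nonneg fun _ _ => ind_nonneg _

theorem marksL_pos {L R : X.ClosedWalk} {i : ZMod L.len} {a : ℕ} (h : MarkedL L R i)
    (ha : 0 < a) : 1 ≤ marksL L R i a := by
  have := Finset.single_le_sum (f := fun t : ℕ => ind (MarkedL L R (i + t)))
    (fun _ _ => ind_nonneg _) (Finset.mem_range.2 ha)
  refine le_trans (le_of_eq ?_) this
  simp [ind_of h]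

theorem marksR_pos {L R : X.ClosedWalk} {j : ZMod R.len} {b : ℕ} (h : MarkedR L R j)
    (hb : 0 < b) : 1 ≤ marksR L R j b := by
  have := Finset.single_le_sum (f := fun t : ℕ => ind (MarkedR L R (j + t)))
    (fun _ _ => ind_nonneg _) (Finset.mem_range.2 hb)
  refine le_trans (le_of_eq ?_) this
  simp [ind_of h]

theorem marksL_add (L R : X.ClosedWalk) (i : ZMod L.len) (a a' : ℕ) :
    marksL L R i (a + a') = marksL L R i a + marksL L R (i + a) a' := by
  unfold marksL
  rw [Finset.sum_range_add]
  simp [add_assoc]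

theorem marksR_add (L R : X.ClosedWalk) (j : ZMod R.len) (b b' : ℕ) :
    marksR L R j (b + b') = marksR L R j b + marksR L R (j + b) b' := by
  unfold marksR
  rw [Finset.sum_range_add]
  simp [add_assoc]

theorem sum_zmod_val {n : ℕ} [NeZero n] {M : Type} [AddCommMonoid M] (F : ℕ → M) :
    ∑ k : ZMod n, F k.val = ∑ t ∈ Finset.range n, F t := by
  cases n with
  | zero => exact absurd rfl (NeZero.ne 0)
  | succ n => exact Fin.sum_univ_eq_sum_range F (n + 1)

theorem sum_zmod_shift {n : ℕ} [NeZero n] {M : Type} [AddCommMonoid M] (F : ZMod n → M)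
    (i : ZMod n) : ∑ k : ZMod n, F k = ∑ t ∈ Finset.range n, F (i + t) := by
  rw [← Equiv.sum_comp (Equiv.addLeft i), ← sum_zmod_val fun t => F (i + t)]
  exact Finset.sum_congr rfl fun k _ => by simp

namespace CrossingPair

variable {L R : X.ClosedWalk} (P : CrossingPair L R)
include P

/-- After a full turn the two end states cancel. -/
theorem marksL_len (i : ZMod L.len) : marksL L R i L.len = R.crossingNumber L := by
  rw [crossingNumber_swap, crossingNumber_eq_neg_sum_flux, neg_neg, sum_zmod_shift _ i,
    P.sum_fluxL]
  simp

theorem marksR_len (j : ZMod R.len) : marksR L R j R.len = R.crossingNumber L := by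
  rw [crossingNumber_eq_neg_sum_flux, sum_zmod_shift _ j, P.sum_fluxR]
  simp

theorem crossingNumber_pos : 1 ≤ R.crossingNumber L := by
  obtain ⟨-, i, j, k, hk, hr, hl⟩ := P.crosses
  rw [← P.marksL_len (i + k)]
  exact marksL_pos (P.markedL_of_crossesRL hk hr hl) (Nat.pos_of_ne_zero L.len_neZero.out)

end CrossingPair

end EmbDigraph

/-! ## Closed walks composed of an arc of each of two closed walks -/

namespace EmbDigraph

open ClosedWalk

variable {V D : Type} {X : EmbDigraph V D}

/-- The `n`-th dart on the way along `a` edges of `C` from `i` and then along `C'` from `j`. -/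
def arcDart (C C' : X.ClosedWalk) (i : ZMod C.len) (a : ℕ) (j : ZMod C'.len) (n : ℕ) : D :=
  if n < a then C.dart (i + n) else C'.dart (j + (n - a : ℕ))

/-- The arc of `C` with `a` edges from `i`, followed by the arc of `C'` with `b` edges from `j`. -/
def twoArcs (C C' : X.ClosedWalk) (i : ZMod C.len) (a : ℕ) (j : ZMod C'.len) (b : ℕ)
    (hpos : 0 < a + b) (h1 : X.vert (C.dart (i + a)) = X.vert (C'.dart j))
    (h2 : X.vert (C'.dart (j + b)) = X.vert (C.dart i)) : X.ClosedWalk where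
  len := a + b
  len_neZero := ⟨hpos.ne'⟩
  dart k := arcDart C C' i a j k.val
  fwd_dart k := by
    unfold arcDart
    split_ifs
    · exact C.fwd_dart _
    · exact C'.fwd_dart _
  chain k := by
    have : NeZero (a + b) := ⟨hpos.ne'⟩
    have hk : k.val < a + b := ZMod.val_lt k
    have hsucc : (k + 1).val = (k.val + 1) % (a + b) := by
      rw [ZMod.val_add, ZMod.val_one_eq_one_mod, Nat.add_mod_mod]
    have e1 : ∀ n : ℕ, X.vert (X.twin (C.dart (i + n))) = X.vert (C.dart (i + (n + 1 : ℕ))) := by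
      intro n
      rw [C.chain]; push_cast; rw [add_assoc]
    have e2 : ∀ n : ℕ, X.vert (X.twin (C'.dart (j + n))) = X.vert (C'.dart (j + (n + 1 : ℕ))) := by
      intro n
      rw [C'.chain]; push_cast; rw [add_assoc]
    rw [hsucc]
    generalize k.val = n at hk
    have e0 : X.vert (arcDart C C' i a j 0) = X.vert (C.dart i) := by
      unfold arcDart
      split_ifs with h
      · simp
      · have : a = 0 := by omega
        subst this
        simpa using h1.symm
    rcases (show n + 1 ≤ a + b by omega).lt_or_eq with h' | h'
    · rw [Nat.mod_eq_of_lt h']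
      unfold arcDart
      rcases lt_trichotomy (n + 1) a with h' | h' | h'
      · rw [if_pos (by omega), if_pos h', e1]
      · rw [if_pos (by omega), if_neg (by omega), e1, h', h1]
        simp
      · rw [if_neg (by omega), if_neg (by omega), e2, Nat.sub_add_comm (by omega)]
    · rw [h', Nat.mod_self, e0]
      unfold arcDart
      split_ifs with hn
      · have hb : b = 0 := by omega
        have ha : n + 1 = a := by omega
        subst hb
        rw [e1, ha, h1, ← h2]
        simp
      · rw [e2, ← h2, show n - a + 1 = b by omega]

section

variable {C C' : X.ClosedWalk} {i : ZMod C.len} {a : ℕ} {j : ZMod C'.len} {b : ℕ}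
  {hpos : 0 < a + b} {h1 : X.vert (C.dart (i + a)) = X.vert (C'.dart j)}
  {h2 : X.vert (C'.dart (j + b)) = X.vert (C.dart i)}

theorem sum_twoArcs {M : Type} [AddCommMonoid M] (F : D → M) :
    ∑ k, F ((twoArcs C C' i a j b hpos h1 h2).dart k) =
      ∑ t ∈ Finset.range a, F (C.dart (i + t)) + ∑ t ∈ Finset.range b, F (C'.dart (j + t)) := by
  have : NeZero (a + b) := ⟨hpos.ne'⟩
  have : ∑ k, F ((twoArcs C C' i a j b hpos h1 h2).dart k) =
      ∑ t ∈ Finset.range (a + b), F (arcDart C C' i a j t) :=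
    sum_zmod_val (n := a + b) fun t => F (arcDart C C' i a j t)
  rw [this, Finset.sum_range_add]
  congr 1
  · refine Finset.sum_congr rfl fun t ht => ?_
    rw [arcDart, if_pos (Finset.mem_range.1 ht)]
  · refine Finset.sum_congr rfl fun t _ => ?_
    rw [arcDart, if_neg (by omega), Nat.add_sub_cancel_left]

theorem twoArcs_dart_natCast {n : ℕ} (hn : n < a + b) :
    (twoArcs C C' i a j b hpos h1 h2).dart (n : ZMod (a + b)) = arcDart C C' i a j n := by
  change arcDart C C' i a j (n : ZMod (a + b)).val = _
  rw [ZMod.val_natCast_of_lt hn]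

theorem twoArcs_dart (k : ZMod (twoArcs C C' i a j b hpos h1 h2).len) :
    (twoArcs C C' i a j b hpos h1 h2).dart k = arcDart C C' i a j (ZMod.val (n := a + b) k) := rfl

end

theorem natCast_inj_of_le {p a t t' : ℕ} [NeZero p] (ha : a ≤ p) (ht : t < a) (ht' : t' < a)
    (h : (t : ZMod p) = t') : t = t' := by
  have := congrArg ZMod.val h
  rwa [ZMod.val_natCast_of_lt (by omega), ZMod.val_natCast_of_lt (by omega)] at this

variable [Finite D]

namespace CrossingPair

variable {L R : X.ClosedWalk} (P : CrossingPair L R) {i : ZMod L.len} {a : ℕ} {j : ZMod R.len}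
  {b : ℕ} {hpos : 0 < a + b} {h1 : X.vert (L.dart (i + a)) = X.vert (R.dart j)}
  {h2 : X.vert (R.dart (j + b)) = X.vert (L.dart i)}
include P

theorem crossingNumber_twoArcs_R : (twoArcs L R i a j b hpos h1 h2).crossingNumber R =
    - (marksL L R i a + ind (StateLeft L R i) - ind (StateLeft L R (i + a))) := by
  rw [crossingNumber_eq_neg_sum_flux, sum_twoArcs R.flux, P.sum_fluxL,
    Finset.sum_eq_zero fun (t : ℕ) _ => P.simpleR.flux_dart (j + t), add_zero]

/-- A cycle has no flux along itself, so only the arc of `R` contributes. Its end states are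
expressed through those of `L`, so that both formulas for a composed walk involve the same two
states. -/
theorem crossingNumber_twoArcs_L : (twoArcs L R i a j b hpos h1 h2).crossingNumber L =
    marksR L R j b + ind (StateLeft L R (i + a)) - ind (StateLeft L R i) := by
  rw [crossingNumber_eq_neg_sum_flux, sum_twoArcs L.flux, P.sum_fluxR,
    Finset.sum_eq_zero fun (t : ℕ) _ => P.simpleL.flux_dart (i + t), P.ind_stateLeft_swap h1,
    P.ind_stateLeft_swap h2.symm]
  ring

end CrossingPair

/-- Two visits of the same vertex split a walk composed of two arcs. -/
theorem exists_common_of_not_simple {C C' : X.ClosedWalk} {i : ZMod C.len} {a : ℕ}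
    {j : ZMod C'.len} {b : ℕ} {hpos : 0 < a + b}
    {h1 : X.vert (C.dart (i + a)) = X.vert (C'.dart j)}
    {h2 : X.vert (C'.dart (j + b)) = X.vert (C.dart i)} (hC : C.Simple) (hC' : C'.Simple)
    (ha : a < C.len) (hb : b < C'.len) (h : ¬ (twoArcs C C' i a j b hpos h1 h2).Simple) :
    ∃ t u : ℕ, 0 < t ∧ t < a ∧ 0 < u ∧ u < b ∧
      X.vert (C.dart (i + t)) = X.vert (C'.dart (j + u)) := by
  have : NeZero (a + b) := ⟨hpos.ne'⟩
  have key : ∃ t u : ℕ, t < a ∧ u < b ∧ X.vert (C.dart (i + t)) = X.vert (C'.dart (j + u)) := by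
    by_contra! hno
    refine h fun k k' hkk => ?_
    have hk : ZMod.val (n := a + b) k < a + b := ZMod.val_lt _
    have hk' : ZMod.val (n := a + b) k' < a + b := ZMod.val_lt _
    rw [twoArcs_dart, twoArcs_dart] at hkk
    refine ZMod.val_injective (a + b) ?_
    generalize ZMod.val (n := a + b) k = n at *
    generalize ZMod.val (n := a + b) k' = n' at *
    unfold arcDart at hkk
    split_ifs at hkk with c1 c2 c2
    · exact natCast_inj_of_le ha.le c1 c2 (add_left_cancel (hC _ _ hkk))
    · exact absurd hkk (hno _ _ c1 (by omega))
    · exact absurd hkk.symm (hno _ _ c2 (by omega))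
    · have := natCast_inj_of_le (p := C'.len) (t := n - a) (t' := n' - a) hb.le (by omega)
        (by omega) (add_left_cancel (hC' _ _ hkk))
      omega
  obtain ⟨t, u, ht, hu, hv⟩ := key
  -- The common vertex is inside both arcs: with `t = 0` the arc of `C'` would meet its own end
  -- vertex early, and with `u = 0` the arc of `C` would.
  refine ⟨t, u, Nat.pos_of_ne_zero ?_, ht, Nat.pos_of_ne_zero ?_, hu, hv⟩
  · rintro rfl
    have := hC' _ _ (hv.symm.trans (by simpa using h2.symm))
    have := natCast_inj_of_le (p := C'.len) (a := b + 1) (by omega) (by omega) (by omega)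
      (add_left_cancel this)
    omega
  · rintro rfl
    have := hC _ _ (hv.trans (by simpa using h1.symm))
    have := natCast_inj_of_le (p := C.len) (a := a + 1) (by omega) (by omega) (by omega)
      (add_left_cancel this)
    omega

theorem ClosedWalk.Simple.weaklySimple {C : X.ClosedWalk} (h : C.Simple) : C.WeaklySimple := by
  have hne : ∀ {i j k}, MaxShared C C i j k → False := by
    intro i j k hk
    have := h _ _ hk.1
    subst this
    exact hk.2.1 rfl
  refine ⟨fun v => ?_, fun i j => ⟨?_, ?_⟩, fun i j hij => ⟨0, fun hd => hij ?_⟩⟩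
  · have : Subsingleton {i : ZMod C.len // X.vert (C.dart i) = v} :=
      ⟨fun x y => Subtype.ext (h _ _ (x.2.trans y.2.symm))⟩
    exact (Finite.card_le_one_iff_subsingleton.2 this).trans one_le_two
  · rintro ⟨k, hk, -⟩
    exact hne hk
  · rintro ⟨k, hk, -⟩
    exact hne hk
  · have := h _ _ (congrArg X.vert hd)
    simpa using this

end EmbDigraph

/-! ### Homotopy classes of composed walks -/

namespace TorusGraph

open EmbDigraph EmbDigraph.ClosedWalk

variable {V D : Type} [Fintype V] [Fintype D] {G : TorusGraph V D} {L R : G.Walk}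
  (P : CrossingPair L R) {i : ZMod L.len} {a : ℕ} {j : ZMod R.len}
  {b : ℕ} {hpos : 0 < a + b} {h1 : G.vert (L.dart (i + a)) = G.vert (R.dart j)}
  {h2 : G.vert (R.dart (j + b)) = G.vert (L.dart i)}
include P

/-- A composed walk that is not simple is the sum of two composed walks in the nonnegative cone
spanned by the two cycles. -/
theorem exists_split (hi : MarkedL L R i) (ha' : MarkedL L R (i + a)) (ha : a < L.len)
    (hb : b < R.len) (h : ¬ (twoArcs L R i a j b hpos h1 h2).Simple) :
    ∃ Z₁ Z₂ : G.Walk,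
      G.m (twoArcs L R i a j b hpos h1 h2) = G.m Z₁ + G.m Z₂ ∧
      G.h (twoArcs L R i a j b hpos h1 h2) = G.h Z₁ + G.h Z₂ ∧
      ∀ Z, Z = Z₁ ∨ Z = Z₂ → Z.crossingNumber R ≤ 0 ∧ 0 ≤ Z.crossingNumber L ∧
        1 ≤ Z.crossingNumber L - Z.crossingNumber R := by
  obtain ⟨t, u, ht0, ht, hu0, hu, hv⟩ := exists_common_of_not_simple P.simpleL P.simpleR ha hb h
  have e1 : i + t + (a - t : ℕ) = i + a := by
    rw [Nat.cast_sub ht.le]; ring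
  have e2 : j + u + (b - u : ℕ) = j + b := by
    rw [Nat.cast_sub hu.le]; ring
  -- Cut at the common vertex: the end of the arc of `L` closes up with the beginning of the arc of
  -- `R`, and the remaining two pieces close up as well.
  let Z₁ : G.Walk := twoArcs L R (i + t) (a - t) j u (by omega) (by rw [e1, h1]) hv.symm
  let Z₂ : G.Walk := twoArcs L R i t (j + u) (b - u) (by omega) hv (by rw [e2, h2])
  have hsum : ∀ F : D → ℤ, ∑ k, F ((twoArcs L R i a j b hpos h1 h2).dart k) =
      ∑ k, F (Z₁.dart k) + ∑ k, F (Z₂.dart k) := by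
    intro F
    rw [sum_twoArcs, sum_twoArcs, sum_twoArcs]
    have ea : a = t + (a - t) := by omega
    have eb : b = u + (b - u) := by omega
    conv_lhs => rw [ea, eb, Finset.sum_range_add, Finset.sum_range_add]
    push_cast [add_assoc]
    ring
  refine ⟨Z₁, Z₂, ?_, ?_, ?_⟩
  · rw [m_eq, m_eq, m_eq, hsum]; ring
  · rw [h_eq, h_eq, h_eq, hsum]
  -- The state at the cut is at most one. It is outweighed in `Z₁` by the mark at the start of its
  -- arc of `R`, and in `Z₂` by the mark at the start of its arc of `L`. In the difference of
  -- crossing numbers the state cancels.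
  · have hj := P.markedR_of_markedL h1 ha'
    have s0 := ind_nonneg (StateLeft L R (i + t))
    have s1 := ind_le_one (StateLeft L R (i + t))
    rintro Z (rfl | rfl)
    · rw [P.crossingNumber_twoArcs_R, P.crossingNumber_twoArcs_L, e1, ind_of_not ha'.2]
      have m1 := marksL_nonneg L R (i + t) (a - t)
      have m2 := marksR_pos hj hu0
      omega
    · rw [P.crossingNumber_twoArcs_R, P.crossingNumber_twoArcs_L, ind_of_not hi.2]
      have m1 := marksL_pos hi ht0
      have m2 := marksR_nonneg L R (j + u) (b - u)
      omega

/-- A full turn of `R` would make the ends of the proper arc of `L` coincide. -/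
theorem lt_len_of_lt_len (h1 : G.vert (L.dart (i + a)) = G.vert (R.dart j))
    (h2 : G.vert (R.dart (j + b)) = G.vert (L.dart i)) (ha0 : 0 < a) (ha : a < L.len) (hb : b ≤ R.len) : b < R.len := by
  rcases hb.lt_or_eq with h | h
  · exact h
  · subst h
    have := P.simpleL (i + a) i (by rw [h1, ← h2]; simp)
    have := natCast_inj_of_le (p := L.len) (a := a + 1) (t := a) (t' := 0) (by omega) (by omega)
      (by omega) (by simpa using this)
    omega

/-- The vertex where the walk closes up is a mark that belongs to the complementary arc of `R`. -/
theorem marksR_lt (hi : MarkedL L R i) (hb : b < R.len)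
    (h2 : G.vert (R.dart (j + b)) = G.vert (L.dart i)) :
    marksR L R j b + 1 ≤ R.crossingNumber L := by
  have h := marksR_add L R j b (R.len - b)
  rw [Nat.add_sub_cancel' hb.le, P.marksR_len] at h
  have := marksR_pos (b := R.len - b) (P.markedR_of_markedL h2.symm hi) (by omega)
  omega

theorem crossingNumbers_twoArcs (hi : MarkedL L R i) (ha' : MarkedL L R (i + a)) :
    (twoArcs L R i a j b hpos h1 h2).crossingNumber R = - marksL L R i a ∧
    (twoArcs L R i a j b hpos h1 h2).crossingNumber L = marksR L R j b := by
  rw [P.crossingNumber_twoArcs_R, P.crossingNumber_twoArcs_L, ind_of_not hi.2, ind_of_not ha'.2]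
  constructor <;> ring

/-- The composed walk that runs along the first cycle only from one crossing to the next is
simple. -/
theorem simple_of_marksL_eq_one (hi : MarkedL L R i) (ha' : MarkedL L R (i + a)) (ha0 : 0 < a)
    (ha : a < L.len) (hb : b ≤ R.len) (h : marksL L R i a = 1) :
    (twoArcs L R i a j b hpos h1 h2).Simple := by
  by_contra hns
  have hb' := lt_len_of_lt_len P h1 h2 ha0 ha hb
  obtain ⟨Z₁, Z₂, hm, hh, hZ⟩ := exists_split P hi ha' ha hb' hns
  obtain ⟨c1, c2⟩ := crossingNumbers_twoArcs P (hpos := hpos) (h1 := h1) (h2 := h2) hi ha'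
  have hlt := marksR_lt P hi hb' h2
  have hk := P.crossingNumber_pos
  obtain ⟨a1, b1, s1⟩ := hZ Z₁ (Or.inl rfl)
  obtain ⟨a2, b2, s2⟩ := hZ Z₂ (Or.inr rfl)
  rw [h] at c1
  simp only [crossingNumber_eq_det] at *
  set C := twoArcs L R i a j b hpos h1 h2
  -- As `C` has crossing number -1 with `R`, a class with crossing number zero is a multiple of that
  -- of `R`, and the factor is the crossing number of `Z` with `C`. A positive factor makes `Z`
  -- cross `L` at least as often as `R` does, which exceeds the number of marks on the arc of `R`.
  have key : ∀ Z : G.Walk, G.m Z * G.h R - G.h Z * G.m R = 0 →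
      1 ≤ G.m Z * G.h L - G.h Z * G.m L →
      G.m Z * G.h L - G.h Z * G.m L ≤ marksR L R j b → False := by
    intro Z h0 hpos hle
    have e1 : G.m Z = G.m R * (G.h C * G.m Z - G.m C * G.h Z) := by
      linear_combination G.m Z * c1 - G.m C * h0
    have e2 : G.h Z = G.h R * (G.h C * G.m Z - G.m C * G.h Z) := by
      linear_combination G.h Z * c1 - G.h C * h0
    set t := G.h C * G.m Z - G.m C * G.h Z
    have e3 : G.m Z * G.h L - G.h Z * G.m L = t * (G.m R * G.h L - G.h R * G.m L) := by
      rw [e1, e2]; ring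
    rw [e3] at hpos hle
    have ht : 1 ≤ t := by
      by_contra ht
      nlinarith
    nlinarith
  have hsum : (G.m Z₁ * G.h R - G.h Z₁ * G.m R) + (G.m Z₂ * G.h R - G.h Z₂ * G.m R) = -1 := by
    rw [← c1, hm, hh]; ring
  have hsum' : (G.m Z₁ * G.h L - G.h Z₁ * G.m L) + (G.m Z₂ * G.h L - G.h Z₂ * G.m L) =
      marksR L R j b := by
    rw [← c2, hm, hh]; ring
  -- Two nonpositive integers with sum -1: one is zero.
  rcases (show G.m Z₁ * G.h R - G.h Z₁ * G.m R = 0 ∨ G.m Z₂ * G.h R - G.h Z₂ * G.m R = 0 by omega)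
    with h0 | h0
  · exact key Z₁ h0 (by omega) (by omega)
  · exact key Z₂ h0 (by omega) (by omega)

/-- The composed walk that runs along the first cycle for as many crossings as the second cycle
crosses the meridian is parallel to the meridian. -/
theorem orbital_of_marksL_eq (hi : MarkedL L R i) (ha' : MarkedL L R (i + a)) (ha0 : 0 < a)
    (ha : a < L.len) (hb : b ≤ R.len) (hb0 : 0 < b) (h : marksL L R i a = G.m R)
    (hprim : ∃ W : G.Walk, W.crossingNumber R = -1)
    (hmL : G.m L < 0) (hmR : 0 < G.m R) (hhL : 0 < G.h L) (hhR : 0 < G.h R) :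
    (twoArcs L R i a j b hpos h1 h2).Simple ∧
      G.m (twoArcs L R i a j b hpos h1 h2) = 0 ∧ G.h (twoArcs L R i a j b hpos h1 h2) = 1 := by
  have hb' := lt_len_of_lt_len P h1 h2 ha0 ha hb
  obtain ⟨c1, c2⟩ := crossingNumbers_twoArcs P (hpos := hpos) (h1 := h1) (h2 := h2) hi ha'
  have hlt := marksR_lt P hi hb' h2
  have hge := marksR_pos (P.markedR_of_markedL h1 ha') hb0
  obtain ⟨W, hW⟩ := hprim
  rw [h] at c1
  have hns := fun hns => exists_split P (hpos := hpos) (h1 := h1) (h2 := h2) hi ha' ha hb' hns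
  simp only [crossingNumber_eq_det] at *
  set C := twoArcs L R i a j b hpos h1 h2
  have hclass : G.m C = 0 ∧ G.h C = 1 := by
    -- The walk `W` provides the Bézout coefficients. Coprimality then shows that the class of `C`
    -- is (0,1) plus `s` times the class of `R`.
    have hcop : IsCoprime (G.m R) (G.h R) := ⟨G.h W, -G.m W, by linear_combination -hW⟩
    have hdvd : G.m R ∣ G.m C * G.h R := ⟨G.h C - 1, by linear_combination c1⟩
    obtain ⟨s, hs⟩ := hcop.dvd_of_dvd_mul_right hdvd
    have hs' : G.h C = 1 + G.h R * s := by
      have : G.m R * (G.h C - 1 - G.h R * s) = 0 := by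
        rw [hs] at c1; linear_combination -c1
      rcases mul_eq_zero.1 this with h0 | h0 <;> linarith
    have hβ : marksR L R j b = - G.m L + s * (G.m R * G.h L - G.h R * G.m L) := by
      rw [← c2, hs, hs']; ring
    -- With k the crossing number of `R` with `L`, the number of marks on the arc of `R` is -m(L) +
    -- s·k. Both it and -m(L) lie between 1 and k - 1, which leaves no room for a nonzero `s`.
    have hs0 : s = 0 := by
      have hk : 1 ≤ G.m R * G.h L - G.h R * G.m L + G.m L := by nlinarith
      by_contra hne
      rcases lt_or_gt_of_ne hne with h' | h'
      · nlinarith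
      · nlinarith
    rw [hs, hs', hs0]; simp
  refine ⟨?_, hclass⟩
  by_contra hn
  obtain ⟨Z₁, Z₂, hm, hh, hZ⟩ := hns hn
  -- Cramer's rule writes `h Z` as a nonnegative, nontrivial combination of `h R` and `h L`. Two
  -- parts with `h ≥ 1` cannot add up to `h C = 1`.
  have key : ∀ Z : G.Walk, Z = Z₁ ∨ Z = Z₂ → 1 ≤ G.h Z := by
    intro Z hZ'
    obtain ⟨a1, b1, s1⟩ := hZ Z hZ'
    have e : G.h Z * (G.m R * G.h L - G.h R * G.m L) =
        (G.m Z * G.h L - G.h Z * G.m L) * G.h R +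
        (- (G.m Z * G.h R - G.h Z * G.m R)) * G.h L := by ring
    have hk : 0 < G.m R * G.h L - G.h R * G.m L := by nlinarith
    generalize G.m Z * G.h L - G.h Z * G.m L = β at *
    generalize G.m Z * G.h R - G.h Z * G.m R = α at *
    by_contra hle
    have : 0 < β * G.h R + -α * G.h L := by
      rcases (show 1 ≤ β ∨ α ≤ -1 by omega) with h' | h' <;> nlinarith
    nlinarith
  have k1 := key Z₁ (Or.inl rfl)
  have k2 := key Z₂ (Or.inr rfl)
  omega

end TorusGraph

/-! ## Two cycles that cross once -/

namespace EmbDigraph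

open ClosedWalk

variable {V D : Type} {X : EmbDigraph V D}

/-- The closed walk `Z` consists of the arc of `C` with `a` edges from `i` and the arc of `C'` with
`b` edges from `j`. -/
structure IsTwoArcs (Z C C' : X.ClosedWalk) (i : ZMod C.len) (a : ℕ) (j : ZMod C'.len) (b : ℕ) :
    Prop where
  len_eq : Z.len = a + b
  dart_left : ∀ n < a, Z.dart (n : ZMod Z.len) = C.dart (i + n)
  dart_right : ∀ n < b, Z.dart ((a + n : ℕ) : ZMod Z.len) = C'.dart (j + n)

theorem isTwoArcs_twoArcs {C C' : X.ClosedWalk} {i : ZMod C.len} {a : ℕ} {j : ZMod C'.len} {b : ℕ}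
    {hpos : 0 < a + b} {h1 : X.vert (C.dart (i + a)) = X.vert (C'.dart j)}
    {h2 : X.vert (C'.dart (j + b)) = X.vert (C.dart i)} :
    IsTwoArcs (twoArcs C C' i a j b hpos h1 h2) C C' i a j b where
  len_eq := rfl
  dart_left n hn := (twoArcs_dart_natCast (by omega)).trans (by rw [arcDart, if_pos hn])
  dart_right n hn := (twoArcs_dart_natCast (by omega)).trans
    (by rw [arcDart, if_neg (by omega), Nat.add_sub_cancel_left])

namespace IsTwoArcs

variable {Z C C' : X.ClosedWalk} {i : ZMod C.len} {a : ℕ} {j : ZMod C'.len} {b : ℕ}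

theorem inDart_left (h : IsTwoArcs Z C C' i a j b) {n : ℕ} (h0 : 0 < n) (hn : n ≤ a) :
    Z.inDart (n : ZMod Z.len) = C.inDart (i + n) := by
  obtain ⟨n, rfl⟩ := Nat.exists_eq_succ_of_ne_zero h0.ne'
  rw [Nat.succ_eq_add_one, Nat.cast_succ, Nat.cast_succ, ← add_assoc, inDart_add_one,
    inDart_add_one, h.dart_left n (by omega)]

theorem inDart_right (h : IsTwoArcs Z C C' i a j b) {n : ℕ} (h0 : 0 < n) (hn : n ≤ b) :
    Z.inDart ((a + n : ℕ) : ZMod Z.len) = C'.inDart (j + n) := by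
  obtain ⟨n, rfl⟩ := Nat.exists_eq_succ_of_ne_zero h0.ne'
  rw [Nat.succ_eq_add_one, ← Nat.add_assoc, Nat.cast_succ (a + n), Nat.cast_succ n, ← add_assoc,
    inDart_add_one, inDart_add_one, h.dart_right n (by omega)]

end IsTwoArcs

namespace CrossingPair

variable [Finite D] {L R : X.ClosedWalk} (P : CrossingPair L R) {i : ZMod L.len} {j : ZMod R.len}
  {C : X.ClosedWalk} (hC : IsTwoArcs C L R i L.len j R.len)
  (hv0 : X.vert (L.dart i) = X.vert (R.dart j))
include P hC hv0

/-- All of `L` followed by all of `R`, for a single mark. Away from the changeover vertex the two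
strands behave like `L` and `R`, and a crossing of theirs would yield a second mark. At the
changeover the strands exchange their outgoing darts, which turns the only crossing into a touching.
-/
theorem not_crosses_twoArcs (hi : MarkedL L R i) (hu : ∀ i', MarkedL L R i' → i' = i) {n m : ℕ}
    (hn : n < L.len) (hm : m < R.len)
    (hv : X.vert (L.dart (i + n)) = X.vert (R.dart (j + m))) :
    ¬ CrossesLR C C (n : ZMod C.len) ((L.len + m : ℕ) : ZMod C.len) ∧
    ¬ CrossesRL C C (n : ZMod C.len) ((L.len + m : ℕ) : ZMod C.len) := by
  have dL := hC.dart_left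
  have dR := hC.dart_right
  have inL := fun n => hC.inDart_left (n := n)
  have inR := fun n => hC.inDart_right (n := n)
  have hp : 0 < L.len := Nat.pos_of_ne_zero L.len_neZero.out
  have hq : 0 < R.len := Nat.pos_of_ne_zero R.len_neZero.out
  have hl : R.IsLeft j (L.dart i) := by
    obtain ⟨⟨j', hj'⟩, -⟩ := hi
    have : j' = j := P.simpleR _ _ (by rw [← hj'.vert_eq, hv0])
    rwa [← this]
  have hEL : ¬ EntersLeft L R i j := by rw [← stateLeft_iff P.simpleR hv0]; exact hi.2
  have hLn : ∀ n : ℕ, 0 < n → n ≤ L.len → i + n = i → n = L.len := by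
    intro n h0 hn h
    by_contra hne
    have := natCast_inj_of_le (p := L.len) (a := L.len) (t := n) (t' := 0) le_rfl (by omega)
      (by omega) (by simpa using h)
    omega
  have hRn : ∀ n : ℕ, 0 < n → n ≤ R.len → j + n = j → n = R.len := by
    intro n h0 hn h
    by_contra hne
    have := natCast_inj_of_le (p := R.len) (a := R.len) (t := n) (t' := 0) le_rfl (by omega)
      (by omega) (by simpa using h)
    omega
  have hnot : ∀ j', L.dart i ≠ R.dart j' := by
    intro j' h
    have : j' = j := P.simpleR _ _ (by rw [← h, hv0])
    subst this
    exact hl.ne_dart h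
  have d0 : C.dart (0 : ZMod C.len) = L.dart i := by simpa using dL 0 hp
  have dp : C.dart (L.len : ZMod C.len) = R.dart j := by simpa using dR 0 hq
  have dpq : C.dart ((L.len + R.len : ℕ) : ZMod C.len) = L.dart i := by
    rw [← hC.len_eq, ZMod.natCast_self]; exact d0
  have ipq : C.inDart ((L.len + R.len : ℕ) : ZMod C.len) = R.inDart j := by
    simpa using inR R.len hq le_rfl
  have ip : C.inDart (L.len : ZMod C.len) = L.inDart i := by
    simpa using inL L.len hp le_rfl
  rcases Nat.eq_zero_or_pos n with rfl | hn0
  -- The subwalk begins at the changeover vertex: it has no edges, and both darts of one strand lie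
  -- to the left of the other strand.
  · have hm0 : m = 0 := by
      by_contra h0
      have := P.simpleR (j + m) j (by rw [← hv, ← hv0]; simp)
      have := hRn m (by omega) hm.le this
      omega
    subst hm0
    have i0 : C.inDart (0 : ZMod C.len) = R.inDart j := by
      rwa [← hC.len_eq, ZMod.natCast_self] at ipq
    have hk0 : ∀ k, MaxShared C C (0 : ZMod C.len) (L.len : ZMod C.len) k →
        k = 0 ∧ C.IsLeft (L.len : ZMod C.len) (C.inDart (0 : ZMod C.len)) ∧
        C.IsLeft (L.len : ZMod C.len) (C.dart (0 : ZMod C.len)) := by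
      intro k hk
      have hin : L.inDart i ≠ R.inDart j := by rw [← ip, ← i0]; exact hk.inDart_ne.symm
      have hr : R.IsRight j (L.inDart i) := by
        refine (isLeft_or_isRight (by rw [vert_inDart, hv0]) hin
          (inDart_ne_dart _ _ _ _)).resolve_left fun h => hEL ?_
        exact (entersLeft_of_dart_ne fun h => hin (inDart_eq_iff.2 h)).2 h
      unfold IsLeft IsRight at *
      rw [ip, i0, dp, d0]
      refine ⟨?_, hr.rotate, (hl.trans_right hr.rotate.rotate).rotate.rotate⟩
      by_contra h0
      have := hk.2.2.1 0 (by omega)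
      rw [Nat.cast_zero, add_zero, add_zero] at this
      exact hnot j (by rw [← d0, ← dp]; exact this)
    rw [Nat.cast_zero, Nat.add_zero]
    constructor
    · rintro ⟨k, hk, -, hout⟩
      obtain ⟨rfl, -, h⟩ := hk0 k hk
      rw [Nat.cast_zero, add_zero, add_zero] at hout
      exact h.not_isRight hout
    · rintro ⟨k, hk, hin, -⟩
      obtain ⟨-, h, -⟩ := hk0 k hk
      exact h.not_isRight hin
  · have hm0 : 0 < m := by
      refine Nat.pos_of_ne_zero ?_
      rintro rfl
      have := P.simpleL (i + n) i (by rw [hv, hv0]; simp)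
      have := hLn n hn0 hn.le this
      omega
    have main : ∀ k, MaxShared C C (n : ZMod C.len)
        ((L.len + m : ℕ) : ZMod C.len) k →
        (C.IsLeft ((L.len + m : ℕ) : ZMod C.len) (C.inDart (n : ZMod C.len)) →
        C.IsRight (((L.len + m : ℕ) : ZMod C.len) + k)
          (C.dart ((n : ZMod C.len) + k)) → False) ∧
        (C.IsRight ((L.len + m : ℕ) : ZMod C.len) (C.inDart (n : ZMod C.len)) →
        C.IsLeft (((L.len + m : ℕ) : ZMod C.len) + k)
          (C.dart ((n : ZMod C.len) + k)) → False) := by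
      intro k hk
      have hin : L.inDart (i + n) ≠ R.inDart (j + m) := by
        rw [← inL n hn0 hn.le, ← inR m hm0 hm.le]; exact hk.inDart_ne
      obtain ⟨K, hK⟩ := exists_maxShared (C := L) (C' := R) hv
        fun h => hin (inDart_eq_iff.2 h)
      -- A common subwalk of `L` and `R` cannot continue beyond the changeover, because `L` leaves
      -- `R` there. So it is also a common subwalk of the two strands of `C`.
      have hbound : ∀ t ≤ K, n + t ≤ L.len ∧ m + t ≤ R.len := by
        intro t ht
        induction t with
        | zero => omega
        | succ t ih =>
          have ih := ih (by omega)
          have hs := hK.2.2.1 t (by omega)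
          constructor
          · by_contra hgt
            have e : n + t = L.len := by omega
            rw [add_assoc, ← Nat.cast_add, e] at hs
            exact hnot _ (by simpa using hs)
          · by_contra hgt
            have e : m + t = R.len := by omega
            have e' : j + m + t = j := by rw [add_assoc, ← Nat.cast_add, e]; simp
            have : i + n + t = i := P.simpleL _ _ (by rw [hs, e', hv0])
            rw [this] at hs
            exact hnot _ hs
      have hcast : ∀ t : ℕ, (n : ZMod C.len) + t = ((n + t : ℕ) : ZMod C.len) ∧
          ((L.len + m : ℕ) : ZMod C.len) + t = ((L.len + (m + t) : ℕ) : ZMod C.len) := by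
        intro t; push_cast; exact ⟨rfl, by ring⟩
      have hKk : K ≤ k := by
        by_contra hlt
        refine hk.2.2.2 ?_
        have hb := hbound (k + 1) (by omega)
        have hs := hK.2.2.1 k (by omega)
        have e1 := dL (n + k) (by omega)
        have e2 := dR (m + k) (by omega)
        rw [← (hcast k).1, Nat.cast_add n k, ← add_assoc] at e1
        rw [← (hcast k).2, Nat.cast_add m k, ← add_assoc] at e2
        exact e1.trans (hs.trans e2.symm)
      have heq : C.dart (((n + K : ℕ) : ZMod C.len)) ≠
          C.dart (((L.len + (m + K) : ℕ) : ZMod C.len)) → k = K := by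
        intro hne
        by_contra hkK
        have := hk.2.2.1 K (by omega)
        refine hne ?_
        have e := hcast K
        rw [← e.1, ← e.2]
        exact this
      have hleft : C.IsLeft ((L.len + m : ℕ) : ZMod C.len)
          (C.inDart (n : ZMod C.len)) ↔ R.IsLeft (j + m) (L.inDart (i + n)) := by
        unfold IsLeft
        rw [inL n hn0 hn.le, inR m hm0 hm.le, dR m hm]
      have hright : C.IsRight ((L.len + m : ℕ) : ZMod C.len)
          (C.inDart (n : ZMod C.len)) ↔ R.IsRight (j + m) (L.inDart (i + n)) := by
        unfold IsRight
        rw [inL n hn0 hn.le, inR m hm0 hm.le, dR m hm]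
      have hb := hbound K le_rfl
      rcases hb.1.eq_or_lt with e | hlt
      -- The subwalk ends at the changeover vertex. It was not entered from the left because `i` is
      -- marked, and with the outgoing darts exchanged it is not left to the left either.
      · have eL : i + n + K = i := by rw [add_assoc, ← Nat.cast_add, e]; simp
        have eR : j + m + K = j := P.simpleR _ _ (by rw [← hK.vert_eq, eL, hv0])
        have e' : m + K = R.len := hRn _ (by omega) hb.2 (by rw [Nat.cast_add, ← add_assoc, eR])
        have hkK := heq (by rw [e, e', dp, dpq]; exact (hnot j).symm)
        subst hkK
        have hin' : ¬ R.IsLeft (j + m) (L.inDart (i + n)) := by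
          rw [← hK.entersLeft_iff, eL, eR]; exact hEL
        refine ⟨fun h => absurd (hleft.1 h) hin', fun _ hout => ?_⟩
        have e3 := hcast k
        rw [e3.1, e3.2, e, e'] at hout
        unfold IsLeft at hout hl
        rw [ipq, dp, dpq] at hout
        exact hl.not_swap hout
      -- The subwalk ends before the changeover, so it is a genuine one of `L` and `R`:
      -- left-to-right is excluded, and right-to-left would make its end a mark other than `i`.
      · have hlt' : m + K < R.len := by
          refine lt_of_le_of_ne hb.2 fun e => ?_
          have eR : j + m + K = j := by rw [add_assoc, ← Nat.cast_add, e]; simp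
          have eL : i + n + K = i := P.simpleL _ _ (by rw [hK.vert_eq, eR, hv0])
          have := hLn (n + K) (by omega) hb.1 (by rw [Nat.cast_add, ← add_assoc, eL])
          omega
        have eL := dL (n + K) hlt
        have eR := dR (m + K) hlt'
        have eI := inR (m + K) (by omega) hlt'.le
        have hkK := heq (by
          rw [eL, eR, Nat.cast_add, Nat.cast_add, ← add_assoc, ← add_assoc]
          exact hK.2.2.2)
        subst hkK
        have e3 := hcast k
        rw [e3.1, e3.2]
        unfold IsLeft IsRight at *
        rw [eL, eR, eI, Nat.cast_add n k, Nat.cast_add m k, ← add_assoc, ← add_assoc]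
        refine ⟨fun hin hout => P.not_crossesLR _ _ ⟨k, hK, hleft.1 hin, hout⟩,
          fun hin hout => ?_⟩
        have := hu _ (P.markedL_of_crossesRL hK (hright.1 hin) hout)
        have := hLn (n + k) (by omega) hb.1 (by rw [Nat.cast_add, ← add_assoc, this])
        omega
    exact ⟨fun ⟨k, hk, h, h'⟩ => (main k hk).1 h h', fun ⟨k, hk, h, h'⟩ => (main k hk).2 h h'⟩

/-- Each of the two turns visits a vertex at most once, so a double visit pairs a position on `L`
with one on `R`, as treated in `not_crosses_twoArcs`. -/
theorem weaklySimple_of_isTwoArcs (hi : MarkedL L R i) (hu : ∀ i', MarkedL L R i' → i' = i) :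
    C.WeaklySimple := by
  have hLR := fun n m => P.not_crosses_twoArcs hC hv0 hi hu (n := n) (m := m)
  have hlt : ∀ k : ZMod C.len, k.val < L.len + R.len := fun k => hC.len_eq ▸ ZMod.val_lt k
  have hd : ∀ k : ZMod C.len, C.dart k = arcDart L R i L.len j k.val := by
    intro k
    unfold arcDart
    split_ifs with h
    · rw [← hC.dart_left _ h, ZMod.natCast_zmod_val]
    · rw [← hC.dart_right _ (by have := hlt k; omega), Nat.add_sub_cancel' (by omega),
        ZMod.natCast_zmod_val]
  have hinj : ∀ k k' : ZMod C.len, X.vert (C.dart k) = X.vert (C.dart k') →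
      (k.val < L.len ↔ k'.val < L.len) →
      k = k' := by
    intro k k' hkk hiff
    have hk := hlt k
    have hk' := hlt k'
    rw [hd, hd] at hkk
    refine ZMod.val_injective C.len ?_
    generalize k.val = n at *
    generalize k'.val = n' at *
    unfold arcDart at hkk
    split_ifs at hkk with c1 c2 c2
    · exact natCast_inj_of_le le_rfl c1 c2 (add_left_cancel (P.simpleL _ _ hkk))
    · exact absurd (hiff.1 c1) c2
    · exact absurd (hiff.2 c2) c1
    · have := natCast_inj_of_le (p := R.len) (t := n - L.len) (t' := n' - L.len) le_rfl (by omega)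
        (by omega) (add_left_cancel (P.simpleR _ _ hkk))
      omega
  have hmix : ∀ k k' : ZMod C.len, X.vert (C.dart k) = X.vert (C.dart k') →
      k.val < L.len → ¬ k'.val < L.len →
      ¬ CrossesLR C C k k' ∧ ¬ CrossesRL C C k k' := by
    intro k k' hkk c1 c2
    have hk' := hlt k'
    rw [hd, hd, arcDart, arcDart, if_pos c1, if_neg c2] at hkk
    have := hLR _ _ c1 (by omega) hkk
    rw [Nat.add_sub_cancel' (by omega), ZMod.natCast_zmod_val, ZMod.natCast_zmod_val] at this
    exact this
  refine ⟨fun v => ?_, fun k k' => ?_, fun k k' hkk => ?_⟩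
  · let f : {k : ZMod C.len // X.vert (C.dart k) = v} → Bool := fun k =>
      decide (k.1.val < L.len)
    have hf : Function.Injective f := fun k k' h => Subtype.ext
      (hinj _ _ (k.2.trans k'.2.symm) (by simpa [f] using h))
    simpa using Nat.card_le_card_of_injective f hf
  · have hsame : ∀ l, MaxShared C C k k' l →
        (k.val < L.len ↔ k'.val < L.len) →
        False := by
      intro l hl hiff
      have := hinj _ _ hl.1 hiff
      subst this
      exact hl.2.1 rfl
    by_cases c1 : k.val < L.len <;>
      by_cases c2 : k'.val < L.len
    · exact ⟨fun ⟨l, hl, _⟩ => hsame l hl (by tauto), fun ⟨l, hl, _⟩ => hsame l hl (by tauto)⟩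
    · exact ⟨fun h => (hmix k k' (by obtain ⟨l, hl, -⟩ := h; exact hl.1) c1 c2).1 h,
        fun h => (hmix k k' (by obtain ⟨l, hl, -⟩ := h; exact hl.1) c1 c2).2 h⟩
    · exact ⟨fun h => (hmix k' k (by obtain ⟨l, hl, -⟩ := h; exact hl.1.symm) c2 c1).2 h.symm,
        fun h => (hmix k' k (by obtain ⟨l, hl, -⟩ := h; exact hl.1.symm) c2 c1).1 h.symm⟩
    · exact ⟨fun ⟨l, hl, _⟩ => hsame l hl (by tauto), fun ⟨l, hl, _⟩ => hsame l hl (by tauto)⟩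
  -- Shift the first position to 0. The dart there leaves `R` to the left, so it occurs only once in
  -- the walk, which excludes a proper power.
  · by_contra! hall
    let t := (-k).val
    have ht : ((t : ℕ) : ZMod C.len) = -k := ZMod.natCast_zmod_val _
    have h0 := hall t
    have hz : k + ((t : ℕ) : ZMod C.len) = 0 := by
      have : ((t : ℕ) : ZMod C.len) = -k := ht
      rw [this, add_neg_cancel]
    rw [hz] at h0
    set k'' := k' + ((t : ℕ) : ZMod C.len) with hk''
    have hne0 : k'' ≠ 0 := by
      intro h
      rw [hk'', ← hz] at h
      exact hkk (add_right_cancel h).symm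
    have hp : 0 < L.len := Nat.pos_of_ne_zero L.len_neZero.out
    have hval0 : (0 : ZMod C.len).val = 0 := ZMod.val_zero
    have c2 : ¬ k''.val < L.len := fun c2 =>
      hne0 (hinj _ _ (congrArg X.vert h0.symm) (by rw [hval0]; exact ⟨fun _ => hp, fun _ => c2⟩))
    rw [hd, hd, hval0, arcDart, arcDart, if_pos hp, if_neg c2, Nat.cast_zero, add_zero] at h0
    obtain ⟨⟨j', hj'⟩, -⟩ := hi
    rw [h0] at hj'
    exact P.simpleR.not_isLeft_dart _ ⟨j', hj'⟩

end CrossingPair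

end EmbDigraph

/-! ### Choice of the arcs -/

namespace EmbDigraph

open ClosedWalk

variable {V D : Type} {X : EmbDigraph V D}

/-- Coinciding ends give a full turn, never the empty arc; this is what happens on both cycles if
there is only one mark. -/
theorem exists_arc (C : X.ClosedWalk) (i i' : ZMod C.len) :
    ∃ a : ℕ, 0 < a ∧ a ≤ C.len ∧ i + a = i' := by
  have hp : 0 < C.len := Nat.pos_of_ne_zero C.len_neZero.out
  by_cases h : i' = i
  · exact ⟨C.len, hp, le_rfl, by simp [h]⟩
  · refine ⟨(i' - i).val, ?_, (ZMod.val_lt _).le, by simp⟩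
    rw [Nat.pos_iff_ne_zero, Ne, ZMod.val_eq_zero, sub_eq_zero]
    exact h

/-- From each mark one gets to the next one. -/
theorem exists_marksL_eq_one {L R : X.ClosedWalk} {i : ZMod L.len} (hi : MarkedL L R i) :
    ∃ a : ℕ, 0 < a ∧ MarkedL L R (i + a) ∧ marksL L R i a = 1 := by
  classical
  have hex : ∃ a : ℕ, 0 < a ∧ MarkedL L R (i + a) :=
    ⟨L.len, Nat.pos_of_ne_zero L.len_neZero.out, by simpa using hi⟩
  refine ⟨Nat.find hex, (Nat.find_spec hex).1, (Nat.find_spec hex).2, ?_⟩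
  have hmin : ∀ t < Nat.find hex, ¬ (0 < t ∧ MarkedL L R (i + t)) := fun t ht => Nat.find_min hex ht
  unfold marksL
  rw [Finset.sum_eq_single_of_mem 0 (Finset.mem_range.2 (Nat.find_spec hex).1)]
  · rw [Nat.cast_zero, add_zero, ind_of hi]
  · intro t ht h0
    exact ind_of_not fun h => hmin t (Finset.mem_range.1 ht) ⟨Nat.pos_of_ne_zero h0, h⟩

theorem MarkedL.exists_vert_eq [Finite D] {L R : X.ClosedWalk} {i : ZMod L.len}
    (hi : MarkedL L R i) : ∃ j, X.vert (L.dart i) = X.vert (R.dart j) := by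
  obtain ⟨⟨j, hj⟩, -⟩ := hi
  exact ⟨j, hj.vert_eq⟩

end EmbDigraph

namespace TorusGraph

open EmbDigraph EmbDigraph.ClosedWalk

variable {V D : Type} [Fintype V] [Fintype D] {G : TorusGraph V D} {L R : G.Walk}

/-- The signs for which a walk parallel to the meridian is sought. -/
def Opposed (L R : G.Walk) : Prop := G.m L < 0 ∧ 0 < G.m R ∧ 0 < G.h L ∧ 0 < G.h R

/-- Composing an arc of `L` from one mark to the next with an arc of `R` shows that the class of `R`
is primitive. -/
theorem exists_crossingNumber_eq_neg_one (P : CrossingPair L R) {i : ZMod L.len}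
    (hi : MarkedL L R i) : ∃ W : G.Walk, W.crossingNumber R = -1 := by
  obtain ⟨a, ha, ha', h1⟩ := exists_marksL_eq_one hi
  obtain ⟨j, hj⟩ := ha'.exists_vert_eq
  obtain ⟨j', hj'⟩ := hi.exists_vert_eq
  obtain ⟨b, -, -, rfl⟩ := exists_arc R j j'
  refine ⟨twoArcs L R i a j b (by omega) hj hj'.symm, ?_⟩
  rw [(crossingNumbers_twoArcs P hi ha').1, h1]

theorem twoArcs_spec (P : CrossingPair L R) (hgL : G.InGraph L) (hgR : G.InGraph R)
    {i : ZMod L.len} {a : ℕ} {j : ZMod R.len} {b : ℕ} {hpos : 0 < a + b}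
    {h1 : G.vert (L.dart (i + a)) = G.vert (R.dart j)}
    {h2 : G.vert (R.dart (j + b)) = G.vert (L.dart i)}
    (hi : MarkedL L R i) (ha' : MarkedL L R (i + a)) (ha0 : 0 < a) (ha : a ≤ L.len)
    (hb0 : 0 < b) (hb : b ≤ R.len) (ho : Opposed L R → marksL L R i a = G.m R)
    (hno : ¬ Opposed L R → marksL L R i a = 1) {e : D} (he : ∃ t < a, L.dart (i + t) = e) :
    G.InGraph (twoArcs L R i a j b hpos h1 h2) ∧
    (twoArcs L R i a j b hpos h1 h2).WeaklySimple ∧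
    (twoArcs L R i a j b hpos h1 h2).Contains e ∧
    (twoArcs L R i a j b hpos h1 h2).crossingNumber L ≠ 0 ∧
    (twoArcs L R i a j b hpos h1 h2).crossingNumber R ≠ 0 ∧
    (2 ≤ R.crossingNumber L → (twoArcs L R i a j b hpos h1 h2).Simple) ∧
    (G.m L < 0 → 0 < G.m R → 0 < G.h L → 0 < G.h R →
      (twoArcs L R i a j b hpos h1 h2).Simple ∧
        G.IsOneOrbital (twoArcs L R i a j b hpos h1 h2)) := by
  have c := crossingNumbers_twoArcs P (hpos := hpos) (h1 := h1) (h2 := h2) hi ha'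
  have m1 := marksL_pos hi ha0
  have m2 := marksR_pos (P.markedR_of_markedL h1 ha') hb0
  have hk : a < L.len → (twoArcs L R i a j b hpos h1 h2).Simple ∧
      (Opposed L R → G.IsOneOrbital (twoArcs L R i a j b hpos h1 h2)) := by
    intro ha
    by_cases hopp : Opposed L R
    · have := orbital_of_marksL_eq P (hpos := hpos) (h1 := h1) (h2 := h2) hi ha' ha0 ha hb hb0
        (ho hopp) (exists_crossingNumber_eq_neg_one P hi) hopp.1 hopp.2.1 hopp.2.2.1 hopp.2.2.2
      exact ⟨this.1, fun _ => (isOneOrbital_iff _ _).2 this.2⟩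
    · exact ⟨simple_of_marksL_eq_one P hi ha' ha0 ha hb (hno hopp), fun h => absurd h hopp⟩
  -- A full turn has all the marks. With opposed signs, m(R)h(L) - h(R)m(L) exceeds m(R), so m(R)
  -- marks never require a full turn; in the other case there is just one mark.
  have hfull : a = L.len → R.crossingNumber L = 1 ∧ ¬ Opposed L R := by
    rintro rfl
    rw [P.marksL_len] at ho hno
    have hnopp : ¬ Opposed L R := by
      intro hopp
      have h := ho hopp
      obtain ⟨h1, h2, h3, h4⟩ := hopp
      rw [crossingNumber_eq_det] at h
      nlinarith
    exact ⟨hno hnopp, hnopp⟩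
  refine ⟨fun k => ?_, ?_, ?_, ?_, ?_, fun h2k => ?_, fun hm1 hm2 hm3 hm4 => ?_⟩
  · rw [twoArcs_dart, arcDart]
    split_ifs
    · exact hgL _
    · exact hgR _
  · rcases ha.lt_or_eq with h | h
    · exact (hk h).1.weaklySimple
    · have hone := (hfull h).1
      subst h
      have hv0 : G.vert (L.dart i) = G.vert (R.dart j) := by simpa using h1
      have hjb : j + (b : ZMod R.len) = j := P.simpleR _ _ (h2.trans hv0)
      have hb' : b = R.len := by
        by_contra hne
        have := natCast_inj_of_le (p := R.len) (a := R.len) (t := b) (t' := 0) le_rfl (by omega)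
          (by omega) (by simpa using hjb)
        omega
      subst hb'
      refine P.weaklySimple_of_isTwoArcs isTwoArcs_twoArcs hv0 hi fun i' hi' => ?_
      -- A second mark would split the full turn into two arcs with at least one mark each, but the
      -- total is one.
      by_contra hne
      obtain ⟨s, hs0, hs, rfl⟩ := exists_arc L i i'
      have hs' : s < L.len := lt_of_le_of_ne hs fun h => hne (by rw [h]; simp)
      have hsum := marksL_add L R i s (L.len - s)
      rw [Nat.add_sub_cancel' hs, P.marksL_len, hone] at hsum
      have := marksL_pos hi hs0
      have := marksL_pos (a := L.len - s) hi' (by omega)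
      omega
  · obtain ⟨t, ht, rfl⟩ := he
    exact ⟨_, (isTwoArcs_twoArcs (h1 := h1) (h2 := h2) (hpos := hpos)).dart_left t ht⟩
  · rw [c.2]; omega
  · rw [c.1]; omega
  · rcases ha.lt_or_eq with h | h
    · exact (hk h).1
    · have := (hfull h).1
      omega
  · have hopp : Opposed L R := ⟨hm1, hm2, hm3, hm4⟩
    rcases ha.lt_or_eq with h | h
    · exact ⟨(hk h).1, (hk h).2 hopp⟩
    · exact absurd hopp (hfull h).2

end TorusGraph

/-! ## Reasoning about programs -/

namespace RAM

/-- The program halts, and the number of steps and the final memory satisfy `Q`. -/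
def Runs (p : Program) (s : State) (Q : ℕ → State → Prop) : Prop :=
  ∃ t s', Exec p s t s' ∧ Q t s'

theorem Runs.mono {p : Program} {s : State} {Q Q' : ℕ → State → Prop} (h : Runs p s Q)
    (hQ : ∀ t s', Q t s' → Q' t s') : Runs p s Q' := by
  obtain ⟨t, s', he, hq⟩ := h
  exact ⟨t, s', he, hQ t s' hq⟩

/-- This and the following equivalences are weakest-precondition rules: rewriting with them executes
a loop-free program symbolically, including its step count. -/
theorem runs_skip {s : State} {Q : ℕ → State → Prop} : Runs .skip s Q ↔ Q 1 s :=
  ⟨fun ⟨_, _, he, hq⟩ => by cases he; exact hq, fun h => ⟨_, _, .skip s, h⟩⟩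

theorem runs_const {s : State} {x c : ℕ} {Q : ℕ → State → Prop} :
    Runs (.const x c) s Q ↔ Q 1 (s.setReg x c) :=
  ⟨fun ⟨_, _, he, hq⟩ => by cases he; exact hq, fun h => ⟨_, _, .const s x c, h⟩⟩

theorem runs_copy {s : State} {x y : ℕ} {Q : ℕ → State → Prop} :
    Runs (.copy x y) s Q ↔ Q 1 (s.setReg x (s.reg y)) :=
  ⟨fun ⟨_, _, he, hq⟩ => by cases he; exact hq, fun h => ⟨_, _, .copy s x y, h⟩⟩

theorem runs_inc {s : State} {x : ℕ} {Q : ℕ → State → Prop} :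
    Runs (.inc x) s Q ↔ Q 1 (s.setReg x (s.reg x + 1)) :=
  ⟨fun ⟨_, _, he, hq⟩ => by cases he; exact hq, fun h => ⟨_, _, .inc s x, h⟩⟩

theorem runs_dec {s : State} {x : ℕ} {Q : ℕ → State → Prop} :
    Runs (.dec x) s Q ↔ Q 1 (s.setReg x (s.reg x - 1)) :=
  ⟨fun ⟨_, _, he, hq⟩ => by cases he; exact hq, fun h => ⟨_, _, .dec s x, h⟩⟩

theorem runs_load {s : State} {x a y : ℕ} {Q : ℕ → State → Prop} :
    Runs (.load x a y) s Q ↔ Q 1 (s.setReg x (s.arr a (s.reg y))) :=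
  ⟨fun ⟨_, _, he, hq⟩ => by cases he; exact hq, fun h => ⟨_, _, .load s x a y, h⟩⟩

theorem runs_store {s : State} {a x y : ℕ} {Q : ℕ → State → Prop} :
    Runs (.store a x y) s Q ↔ Q 1 (s.setArr a (s.reg x) (s.reg y)) :=
  ⟨fun ⟨_, _, he, hq⟩ => by cases he; exact hq, fun h => ⟨_, _, .store s a x y, h⟩⟩

theorem runs_seq {s : State} {p q : Program} {Q : ℕ → State → Prop} :
    Runs (.seq p q) s Q ↔ Runs p s fun t s' => Runs q s' fun t' s'' => Q (t + t') s'' := by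
  constructor
  · rintro ⟨_, _, he, hq⟩
    cases he with
    | seq h1 h2 => exact ⟨_, _, h1, _, _, h2, hq⟩
  · rintro ⟨_, _, h1, _, _, h2, hq⟩
    exact ⟨_, _, .seq h1 h2, hq⟩

open Classical in
theorem runs_ite {s : State} {b : Test} {p q : Program} {Q : ℕ → State → Prop} :
    Runs (.ite b p q) s Q ↔
      if b.Holds s then Runs p s fun t s' => Q (t + 1) s' else Runs q s fun t s' => Q (t + 1) s' := by
  constructor
  · rintro ⟨_, _, he, hq⟩
    cases he with
    | ite_true hb h => rw [if_pos hb]; exact ⟨_, _, h, hq⟩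
    | ite_false hb h => rw [if_neg hb]; exact ⟨_, _, h, hq⟩
  · split_ifs with hb
    · rintro ⟨_, _, h, hq⟩
      exact ⟨_, _, .ite_true hb h, hq⟩
    · rintro ⟨_, _, h, hq⟩
      exact ⟨_, _, .ite_false hb h, hq⟩

/-- A loop with an invariant, a number of iterations, and a time bound for each iteration. -/
theorem runs_while {b : Test} {p : Program} (N : ℕ) (T : ℕ → ℕ) (Inv : ℕ → State → Prop)
    (hstep : ∀ k < N, ∀ s, Inv k s → b.Holds s ∧ Runs p s fun t s' => t ≤ T k ∧ Inv (k + 1) s')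
    (hend : ∀ s, Inv N s → ¬ b.Holds s) {s : State} (h0 : Inv 0 s) :
    Runs (.while b p) s fun t s' => t ≤ ∑ k ∈ Finset.range N, (T k + 1) + 1 ∧ Inv N s' := by
  have key : ∀ m k, k + m = N → ∀ s, Inv k s →
      Runs (.while b p) s fun t s' => t ≤ ∑ i ∈ Finset.range m, (T (k + i) + 1) + 1 ∧ Inv N s' := by
    intro m
    induction m with
    | zero =>
      intro k hk s hs
      rw [Nat.add_zero] at hk
      subst hk
      exact ⟨1, s, .while_false (hend s hs), by simp, hs⟩
    | succ m ih =>
      intro k hk s hs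
      obtain ⟨hb, t, s', he, ht, hs'⟩ := hstep k (by omega) s hs
      obtain ⟨t', s'', he', ht', hs''⟩ := ih (k + 1) (by omega) s' hs'
      refine ⟨_, s'', .while_true hb he he', ?_, hs''⟩
      rw [Finset.sum_range_succ']
      simp only [Nat.add_zero]
      have e : ∑ i ∈ Finset.range m, (T (k + (i + 1)) + 1) =
          ∑ i ∈ Finset.range m, (T (k + 1 + i) + 1) :=
        Finset.sum_congr rfl fun i _ => by rw [Nat.add_right_comm k 1 i]; rfl
      omega
  simpa using key N 0 (by omega) s h0

theorem runs_while_const {b : Test} {p : Program} (N T : ℕ) (Inv : ℕ → State → Prop)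
    (hstep : ∀ k < N, ∀ s, Inv k s → b.Holds s ∧ Runs p s fun t s' => t ≤ T ∧ Inv (k + 1) s')
    (hend : ∀ s, Inv N s → ¬ b.Holds s) {s : State} (h0 : Inv 0 s) :
    Runs (.while b p) s fun t s' => t ≤ N * (T + 1) + 1 ∧ Inv N s' :=
  (runs_while N (fun _ => T) Inv hstep hend h0).mono fun t s' h => by simpa using h

/-- The registers that a program may write. -/
def Program.regs : Program → List ℕ
  | .skip => []
  | .const x _ => [x]
  | .copy x _ => [x]
  | .inc x => [x]
  | .dec x => [x]
  | .load x _ _ => [x]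
  | .store _ _ _ => []
  | .seq p q => p.regs ++ q.regs
  | .ite _ p q => p.regs ++ q.regs
  | .while _ p => p.regs

/-- The arrays that a program may write. -/
def Program.arrs : Program → List ℕ
  | .store a _ _ => [a]
  | .seq p q => p.arrs ++ q.arrs
  | .ite _ p q => p.arrs ++ q.arrs
  | .while _ p => p.arrs
  | _ => []

@[simp] theorem setReg_reg (s : State) (x v y : ℕ) :
    (s.setReg x v).reg y = if y = x then v else s.reg y := by
  simp [State.setReg, Function.update_apply]

@[simp] theorem setReg_arr (s : State) (x v : ℕ) : (s.setReg x v).arr = s.arr := rfl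

@[simp] theorem setArr_reg (s : State) (a i v : ℕ) : (s.setArr a i v).reg = s.reg := rfl

@[simp] theorem setArr_arr (s : State) (a i v b : ℕ) :
    (s.setArr a i v).arr b = if b = a then Function.update (s.arr a) i v else s.arr b := by
  simp [State.setArr, Function.update_apply]

theorem Exec.frame {p : Program} {s s' : State} {t : ℕ} (h : Exec p s t s') :
    (∀ x, x ∉ p.regs → s'.reg x = s.reg x) ∧ ∀ a, a ∉ p.arrs → s'.arr a = s.arr a := by
  induction h <;> simp_all [Program.regs, Program.arrs]

/-- A program does not change what it does not write. -/
theorem Runs.frame {p : Program} {s : State} {Q : ℕ → State → Prop} (h : Runs p s Q) :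
    Runs p s fun t s' => Q t s' ∧ (∀ x, x ∉ p.regs → s'.reg x = s.reg x) ∧
      ∀ a, a ∉ p.arrs → s'.arr a = s.arr a := by
  obtain ⟨t, s', he, hq⟩ := h
  exact ⟨t, s', he, hq, he.frame⟩

theorem holds_eq {s : State} {x y : ℕ} : (Test.eq x y).Holds s ↔ s.reg x = s.reg y := Iff.rfl

theorem holds_ne {s : State} {x y : ℕ} : (Test.ne x y).Holds s ↔ s.reg x ≠ s.reg y := Iff.rfl

theorem holds_lt {s : State} {x y : ℕ} : (Test.lt x y).Holds s ↔ s.reg x < s.reg y := Iff.rfl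

end RAM

/-! ## The program: sides of the second cycle -/

open EmbDigraph EmbDigraph.ClosedWalk RAM

infixr:60 " ;; " => RAM.Program.seq

/-- Copy the position of each vertex on the second cycle to array `8`, and mark in array `9` the darts
through which this cycle arrives by `2` and the darts to its left by `1`. -/
def sidesProgram : Program :=
  .copy 12 4 ;; .dec 12 ;; .load 11 7 12 ;; .const 10 0 ;;
  .while (.lt 10 4)
    (.load 12 7 10 ;; .load 13 1 12 ;; .store 8 13 10 ;; .load 14 3 11 ;; .store 9 14 8 ;;
      .load 14 2 14 ;; .while (.ne 14 12) (.store 9 14 7 ;; .load 14 2 14) ;;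
      .copy 11 12 ;; .inc 10)

namespace EmbDigraph.ClosedWalk

variable {V D : Type} {X : EmbDigraph V D} [Finite D]

/-- Rotating clockwise from the incoming dart, one meets the darts to the left before the outgoing
dart. The inner loop of `sidesProgram` enumerates them this way. -/
theorem exists_left_darts (C : X.ClosedWalk) (j : ZMod C.len) :
    ∃ N, N + 1 < Function.minimalPeriod X.rot (C.inDart j) ∧
      X.rot^[N + 1] (C.inDart j) = C.dart j ∧
      ∀ x, C.IsLeft j x ↔ ∃ r < N, x = X.rot^[r + 1] (C.inDart j) := by
  obtain ⟨m, hm, he⟩ := X.exists_iterate_rot (vert_inDart C j)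
  have hm0 : m ≠ 0 := by
    rintro rfl
    exact inDart_ne_dart C C j j he
  obtain ⟨N, rfl⟩ := Nat.exists_eq_succ_of_ne_zero hm0
  refine ⟨N, hm, he, fun x => ⟨?_, ?_⟩⟩
  · rintro ⟨i', j', h0, hij, hj, rfl, h⟩
    have := (Function.iterate_eq_iterate_iff_of_lt_minimalPeriod (f := X.rot) (x := C.inDart j)
      hj hm).1 (h.trans he.symm)
    exact ⟨i' - 1, by omega, by rw [Nat.sub_add_cancel h0]⟩
  · rintro ⟨r, hr, rfl⟩
    exact ⟨r + 1, N + 1, by omega, by omega, hm, rfl, he⟩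

/-- The number of darts to the left of the walk at a visit. -/
noncomputable def numLeft (C : X.ClosedWalk) (j : ZMod C.len) : ℕ :=
  (C.exists_left_darts j).choose

theorem numLeft_lt (C : X.ClosedWalk) (j : ZMod C.len) :
    C.numLeft j + 1 < Function.minimalPeriod X.rot (C.inDart j) :=
  (C.exists_left_darts j).choose_spec.1

theorem iterate_numLeft (C : X.ClosedWalk) (j : ZMod C.len) :
    X.rot^[C.numLeft j + 1] (C.inDart j) = C.dart j :=
  (C.exists_left_darts j).choose_spec.2.1

theorem isLeft_iff_exists (C : X.ClosedWalk) (j : ZMod C.len) (x : D) :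
    C.IsLeft j x ↔ ∃ r < C.numLeft j, x = X.rot^[r + 1] (C.inDart j) :=
  (C.exists_left_darts j).choose_spec.2.2 x

theorem iterate_ne_dart (C : X.ClosedWalk) (j : ZMod C.len) {r : ℕ} (hr : r < C.numLeft j) :
    X.rot^[r + 1] (C.inDart j) ≠ C.dart j :=
  ((C.isLeft_iff_exists j _).2 ⟨r, hr, rfl⟩).ne_dart

/-- Different visits concern different vertices, so no dart is counted twice. This makes the nested
loop of `sidesProgram` linear. -/
theorem Simple.sum_numLeft_le {D : Type} [Fintype D] {X : EmbDigraph V D} {C : X.ClosedWalk}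
    (h : C.Simple) : ∑ k ∈ Finset.range C.len, C.numLeft (k : ZMod C.len) ≤ Fintype.card D := by
  have e : ∑ k ∈ Finset.range C.len, C.numLeft (k : ZMod C.len) = ∑ j, C.numLeft j := by
    rw [← sum_zmod_val fun k : ℕ => C.numLeft (k : ZMod C.len)]
    simp
  have e' : ∑ j, C.numLeft j = Fintype.card (Σ j, Fin (C.numLeft j)) := by simp
  rw [e, e']
  refine Fintype.card_le_of_injective
    (fun x : Σ j, Fin (C.numLeft j) => X.rot^[x.2 + 1] (C.inDart x.1)) ?_
  rintro ⟨j, r, hr⟩ ⟨j', r', hr'⟩ hx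
  simp only at hx
  have hj : j = j' := h _ _ (by
    rw [← vert_inDart, ← vert_inDart, ← X.vert_iterate_rot (r + 1), hx, vert_iterate_rot])
  subst hj
  have := C.numLeft_lt j
  have := (Function.iterate_eq_iterate_iff_of_lt_minimalPeriod (f := X.rot) (x := C.inDart j)
    (by omega) (by omega)).1 hx
  simpa using this

open Classical in
/-- The code of the side of a dart with respect to the first `k` visits. -/
noncomputable def sideUpTo (C : X.ClosedWalk) (k : ℕ) (x : D) : ℕ :=
  if ∃ j : ℕ, j < k ∧ x = C.inDart j then 2
  else if ∃ j : ℕ, j < k ∧ C.IsLeft j x then 1 else 0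

open Classical in
/-- The code of the side of a dart. -/
noncomputable def sideCode (C : X.ClosedWalk) (x : D) : ℕ :=
  if ∃ j, x = C.inDart j then 2 else if ∃ j, C.IsLeft j x then 1 else 0

theorem sideUpTo_len (C : X.ClosedWalk) (x : D) : C.sideUpTo C.len x = C.sideCode x := by
  have h : ∀ p : ZMod C.len → Prop, (∃ j : ℕ, j < C.len ∧ p j) ↔ ∃ j, p j := fun p =>
    ⟨fun ⟨j, _, hj⟩ => ⟨j, hj⟩, fun ⟨j, hj⟩ => ⟨j.val, ZMod.val_lt j, by simpa using hj⟩⟩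
  have h1 : (∃ j : ℕ, j < C.len ∧ x = C.inDart j) ↔ ∃ j, x = C.inDart j := h fun j => x = C.inDart j
  have h2 : (∃ j : ℕ, j < C.len ∧ C.IsLeft j x) ↔ ∃ j, C.IsLeft j x := h fun j => C.IsLeft j x
  classical exact if_congr h1 rfl (if_congr h2 rfl rfl)

open Classical in
/-- The code of the side of a dart with respect to the first `k` visits and to the first `r` darts to
the left of the next visit. -/
noncomputable def sideWithin (C : X.ClosedWalk) (k r : ℕ) (x : D) : ℕ :=
  if x = C.inDart k then 2
  else if ∃ r' < r, x = X.rot^[r' + 1] (C.inDart k) then 1 else C.sideUpTo k x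

theorem sideUpTo_zero (C : X.ClosedWalk) (x : D) : C.sideUpTo 0 x = 0 := by
  simp [sideUpTo]

open Classical in
theorem sideWithin_zero (C : X.ClosedWalk) (k : ℕ) (x : D) :
    C.sideWithin k 0 x = if x = C.inDart k then 2 else C.sideUpTo k x := by
  simp [sideWithin]

open Classical in
theorem sideWithin_succ (C : X.ClosedWalk) (k : ℕ) {r : ℕ} (hr : r < C.numLeft k) (x : D) :
    C.sideWithin k (r + 1) x =
      if x = X.rot^[r + 1] (C.inDart k) then 1 else C.sideWithin k r x := by
  have h0 : X.rot^[r + 1] (C.inDart k) ≠ C.inDart k := fun h => by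
    have := C.numLeft_lt k
    have := (Function.iterate_eq_iterate_iff_of_lt_minimalPeriod (f := X.rot) (x := C.inDart k)
      (m := r + 1) (n := 0) (by omega) (by omega)).1 h
    omega
  unfold sideWithin
  by_cases c : x = X.rot^[r + 1] (C.inDart k)
  · rw [if_pos c, if_neg (by rw [c]; exact h0), if_pos ⟨r, r.lt_succ_self, c⟩]
  · have e : (∃ r' < r + 1, x = X.rot^[r' + 1] (C.inDart k)) ↔
        ∃ r' < r, x = X.rot^[r' + 1] (C.inDart k) := by
      constructor
      · rintro ⟨r', h, hx⟩
        rcases Nat.lt_succ_iff_lt_or_eq.1 h with h | rfl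
        · exact ⟨r', h, hx⟩
        · exact absurd hx c
      · rintro ⟨r', h, hx⟩
        exact ⟨r', by omega, hx⟩
    simp only [if_neg c, e]

/-- Since visits of a simple walk are to distinct vertices, the entries written at visit `k` never
overwrite the code of an earlier incoming dart. -/
theorem Simple.sideUpTo_succ {C : X.ClosedWalk} (h : C.Simple) {k : ℕ} (hk : k < C.len) (x : D) :
    C.sideUpTo (k + 1) x = C.sideWithin k (C.numLeft k) x := by
  have hne : ∀ j : ℕ, j < k → (j : ZMod C.len) ≠ k := by
    intro j hj he
    have := natCast_inj_of_le (p := C.len) le_rfl (by omega) hk he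
    omega
  have h0 : ∀ p : ℕ → Prop, (∃ j : ℕ, j < k + 1 ∧ p j) ↔ p k ∨ ∃ j : ℕ, j < k ∧ p j := by
    intro p
    constructor
    · rintro ⟨j, hj, hx⟩
      rcases Nat.lt_succ_iff_lt_or_eq.1 hj with hj | rfl
      · exact Or.inr ⟨j, hj, hx⟩
      · exact Or.inl hx
    · rintro (hx | ⟨j, hj, hx⟩)
      · exact ⟨k, by omega, hx⟩
      · exact ⟨j, by omega, hx⟩
  have h1 : (∃ j : ℕ, j < k + 1 ∧ x = C.inDart j) ↔
      x = C.inDart k ∨ ∃ j : ℕ, j < k ∧ x = C.inDart j := h0 fun j => x = C.inDart j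
  have h2 : (∃ j : ℕ, j < k + 1 ∧ C.IsLeft j x) ↔
      C.IsLeft k x ∨ ∃ j : ℕ, j < k ∧ C.IsLeft j x := h0 fun j => C.IsLeft j x
  have h3 : C.IsLeft k x → ¬ ∃ j : ℕ, j < k ∧ x = C.inDart j := by
    rintro hl ⟨j, hj, rfl⟩
    exact hne j hj (h _ _ (by rw [← vert_inDart, hl.vert_eq]))
  have h4 := C.isLeft_iff_exists k x
  unfold sideWithin sideUpTo
  by_cases c1 : x = C.inDart k
  · rw [if_pos (h1.2 (Or.inl c1)), if_pos c1]
  · rw [if_neg c1]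
    by_cases c2 : C.IsLeft k x
    · rw [if_neg (by rw [h1]; exact not_or.2 ⟨c1, h3 c2⟩), if_pos (h2.2 (Or.inl c2)),
        if_pos (h4.1 c2)]
    · rw [if_neg (mt h4.2 c2)]
      classical
      exact if_congr (h1.trans (or_iff_right c1)) rfl
        (if_congr (h2.trans (or_iff_right c2)) rfl rfl)

theorem Simple.len_le_card {D : Type} [Fintype D] {X : EmbDigraph V D} {C : X.ClosedWalk}
    (h : C.Simple) : C.len ≤ Fintype.card D := by
  have := Fintype.card_le_of_injective C.dart fun i j hij => h.eq_of_dart_eq hij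
  rwa [ZMod.card] at this

end EmbDigraph.ClosedWalk

namespace RAM

variable {v n : ℕ} {G : TorusGraph (Fin v) (Fin n)} {L R : G.Walk} {e : Fin n}

/-- The memory contains the input, and the numbers `0`, `1`, `2` in registers `6`, `7`, `8`. -/
structure HasInput (G : TorusGraph (Fin v) (Fin n)) (L R : G.Walk) (e : Fin n) (s : State) :
    Prop where
  lenL : s.reg 3 = L.len
  lenR : s.reg 4 = R.len
  edge : s.reg 5 = e
  zero : s.reg 6 = 0
  one : s.reg 7 = 1
  two : s.reg 8 = 2
  vert : ∀ d : Fin n, s.arr 1 d = G.vert d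
  rot : ∀ d : Fin n, s.arr 2 d = G.rot d
  twin : ∀ d : Fin n, s.arr 3 d = G.twin d
  fwd : ∀ d : Fin n, s.arr 4 d = (G.fwd d).toNat
  kind : ∀ d : Fin n, s.arr 5 d = (G.kind d).code
  walkL : ∀ i : ZMod L.len, s.arr 6 i.val = L.dart i
  walkR : ∀ i : ZMod R.len, s.arr 7 i.val = R.dart i

theorem HasInput.of_eq {s s' : State} (h : HasInput G L R e s)
    (hr : s'.reg 3 = s.reg 3 ∧ s'.reg 4 = s.reg 4 ∧ s'.reg 5 = s.reg 5 ∧ s'.reg 6 = s.reg 6 ∧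
      s'.reg 7 = s.reg 7 ∧ s'.reg 8 = s.reg 8)
    (ha : s'.arr 1 = s.arr 1 ∧ s'.arr 2 = s.arr 2 ∧ s'.arr 3 = s.arr 3 ∧ s'.arr 4 = s.arr 4 ∧
      s'.arr 5 = s.arr 5 ∧ s'.arr 6 = s.arr 6 ∧ s'.arr 7 = s.arr 7) : HasInput G L R e s' := by
  obtain ⟨h3, h4, h5, h6, h7, h8⟩ := hr
  obtain ⟨a1, a2, a3, a4, a5, a6, a7⟩ := ha
  constructor <;> simp only [h3, h4, h5, h6, h7, h8, a1, a2, a3, a4, a5, a6, a7]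
  exacts [h.lenL, h.lenR, h.edge, h.zero, h.one, h.two, h.vert, h.rot, h.twin, h.fwd, h.kind,
    h.walkL, h.walkR]

/-- The result of `sidesProgram`. -/
structure HasSides (R : G.Walk) (s : State) : Prop where
  pos : ∀ j : ZMod R.len, s.arr 8 (G.vert (R.dart j)) = j.val
  side : ∀ x : Fin n, s.arr 9 x = R.sideCode x

theorem HasInput.walkL_natCast {s : State} (h : HasInput G L R e s) {i : ℕ} (hi : i < L.len) :
    s.arr 6 i = L.dart (i : ZMod L.len) := by
  rw [← h.walkL, ZMod.val_natCast_of_lt hi]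

theorem HasInput.walkR_natCast {s : State} (h : HasInput G L R e s) {i : ℕ} (hi : i < R.len) :
    s.arr 7 i = R.dart (i : ZMod R.len) := by
  rw [← h.walkR, ZMod.val_natCast_of_lt hi]

open Classical in
theorem runs_sidesProgram (hR : R.Simple) {s : State} (hs : HasInput G L R e s)
    (h9 : ∀ x, s.arr 9 x = 0) :
    Runs sidesProgram s fun t s' => t ≤ 20 * n + 10 ∧ HasSides R s' := by
  have hq : 0 < R.len := Nat.pos_of_ne_zero R.len_neZero.out
  have hqn : R.len ≤ n := by simpa using hR.len_le_card
  unfold sidesProgram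
  -- …
  simp only [runs_seq, runs_copy, runs_dec, runs_load, runs_const]
  refine Runs.mono (runs_while R.len (fun k => 12 + 3 * R.numLeft k) (fun k s' =>
    HasInput G L R e s' ∧ s'.reg 10 = k ∧ s'.reg 11 = R.dart (k - 1) ∧
    (∀ j : ℕ, j < k → s'.arr 8 (G.vert (R.dart j)) = j) ∧
    ∀ x : Fin n, s'.arr 9 x = R.sideUpTo k x) ?_ ?_ ?_) ?_
  · rintro k hk s1 ⟨hin, h10, h11, hpos, hside⟩
    refine ⟨by rw [holds_lt, h10, hin.lenR]; exact hk, ?_⟩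
    have hd : s1.arr 7 k = R.dart (k : ZMod R.len) := hin.walkR_natCast hk
    have hin' : s1.arr 3 (R.dart (k - 1)) = R.inDart (k : ZMod R.len) := hin.twin _
    simp only [runs_seq, runs_copy, runs_inc, runs_load, runs_store, setReg_reg, setReg_arr,
      setArr_reg, setArr_arr, h10, h11, hin.two, hd, hin', hin.vert, hin.rot, reduceIte,
      Nat.reduceEqDiff]
    refine Runs.mono (runs_while_const (R.numLeft k) 2 (fun r s' =>
      HasInput G L R e s' ∧ s'.reg 10 = k ∧ s'.reg 12 = R.dart (k : ZMod R.len) ∧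
      s'.reg 14 = (G.rot^[r + 1] (R.inDart k) : Fin n) ∧
      (∀ j : ℕ, j < k + 1 → s'.arr 8 (G.vert (R.dart j)) = j) ∧
      ∀ x : Fin n, s'.arr 9 x = R.sideWithin k r x) ?_ ?_ ?_) ?_
    · rintro r hr s2 ⟨hin2, g10, g12, g14, gpos, gside⟩
      refine ⟨?_, ?_⟩
      · rw [holds_ne, g12, g14]
        exact fun h => R.iterate_ne_dart _ hr (Fin.ext h)
      · simp only [runs_seq, runs_load, runs_store, setReg_reg, setReg_arr,
          setArr_reg, setArr_arr, g14, hin2.rot, hin2.one, reduceIte, Nat.reduceEqDiff]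
        refine ⟨le_rfl, hin2.of_eq (by simp) (by simp), by simp [g10], by simp [g12], ?_, ?_, ?_⟩
        · simp [Function.iterate_succ_apply']
        · simpa using gpos
        · intro x
          rw [R.sideWithin_succ k hr]
          by_cases hx : x = G.rot^[r + 1] (R.inDart k)
          · subst hx
            simp
          · simp only [if_neg hx, Function.update_of_ne (mt Fin.ext hx), gside]
    · rintro s2 ⟨hin2, g10, g12, g14, gpos, gside⟩
      rw [holds_ne, g12, g14, not_not, ← R.iterate_numLeft]
    · refine ⟨hin.of_eq (by simp) (by simp), by simp [h10], by simp, by simp, ?_, ?_⟩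
      · intro j hj
        simp only [setReg_arr, setArr_arr, Nat.reduceEqDiff, reduceIte, Function.update_apply,
          Fin.val_inj]
        split_ifs with hv
        · have := natCast_inj_of_le (p := R.len) le_rfl (by omega) hk (hR _ _ hv)
          omega
        · refine hpos j ((Nat.lt_succ_iff_lt_or_eq.1 hj).resolve_right ?_)
          rintro rfl
          exact hv rfl
      · intro x
        simp [Function.update_apply, R.sideWithin_zero, hside, Fin.val_inj]
    · rintro t s2 ⟨ht, hin2, g10, g12, g14, gpos, gside⟩
      refine ⟨by omega, hin2.of_eq (by simp) (by simp), by simp [g10], by simp [g12], ?_, ?_⟩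
      · simpa using gpos
      · intro x
        simp [gside, hR.sideUpTo_succ hk]
  · rintro s1 ⟨hin, h10, -⟩
    rw [holds_lt, h10, hin.lenR]
    exact lt_irrefl _
  -- Register `11` holds the previous dart, whose twin is the incoming one. Initially this is the
  -- dart at `R.len - 1`, which is the cyclic position `-1`.
  · refine ⟨hs.of_eq (by simp) (by simp), by simp, ?_, by simp, ?_⟩
    · have h1 := hs.walkR_natCast (i := R.len - 1) (by omega)
      simp [hs.lenR, h1, Nat.cast_sub (show 1 ≤ R.len from hq)]
    · simp [h9, sideUpTo_zero]
  · rintro t s1 ⟨ht, hin, h10, h11, hpos, hside⟩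
    refine ⟨?_, ?_, ?_⟩
    · have h1 := hR.sum_numLeft_le
      rw [Fintype.card_fin] at h1
      have h2 : ∑ k ∈ Finset.range R.len, (12 + 3 * R.numLeft k + 1) =
          13 * R.len + 3 * ∑ k ∈ Finset.range R.len, R.numLeft k := by
        simp only [Finset.sum_add_distrib, Finset.sum_const, Finset.card_range, Finset.mul_sum,
          smul_eq_mul]
        ring
      omega
    · intro j
      simpa using hpos j.val (ZMod.val_lt j)
    · intro x
      rw [hside, sideUpTo_len]

end RAM

/-! ## The program: scanning the first cycle for marks -/

open EmbDigraph EmbDigraph.ClosedWalk RAM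

namespace EmbDigraph.ClosedWalk

variable {V D : Type} {X : EmbDigraph V D} [Finite D]

theorem sideCode_eq_two_iff (C : X.ClosedWalk) (x : D) : C.sideCode x = 2 ↔ ∃ j, x = C.inDart j := by
  unfold sideCode
  split_ifs <;> simp_all

theorem Simple.sideCode_eq_one_iff {C : X.ClosedWalk} (h : C.Simple) (x : D) :
    C.sideCode x = 1 ↔ ∃ j, C.IsLeft j x := by
  unfold sideCode
  split_ifs with h1 h2
  · obtain ⟨j, rfl⟩ := h1
    simpa using h.not_isLeft_inDart j
  · simpa using h2
  · simpa using h2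

/-- An edge of `L` is shared exactly when its reversed dart is an incoming dart of `R`, so array `9`
also detects shared edges. -/
theorem sideCode_inDart_eq_two_iff (L R : X.ClosedWalk) (i : ZMod L.len) :
    R.sideCode (L.inDart (i + 1)) = 2 ↔ ∃ j, L.dart i = R.dart j := by
  rw [sideCode_eq_two_iff]
  constructor
  · rintro ⟨j, hj⟩
    refine ⟨j - 1, X.twin.injective ?_⟩
    rwa [inDart_add_one] at hj
  · rintro ⟨j, hj⟩
    exact ⟨j + 1, by rw [inDart_add_one, inDart_add_one, hj]⟩

theorem Simple.markedL_iff_sideCode {L R : X.ClosedWalk} (h : R.Simple) (i : ZMod L.len) :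
    MarkedL L R i ↔ R.sideCode (L.dart i) = 1 ∧ ¬ StateLeft L R i := by
  rw [h.sideCode_eq_one_iff, MarkedL]

/-- Guarantees that a full round along `L` passes an edge at which the state is reset. -/
theorem Simple.exists_not_shared {L R : X.ClosedWalk} (h : R.Simple) {i : ZMod L.len}
    (hi : MarkedL L R i) : ¬ ∃ j, L.dart i = R.dart j := by
  rintro ⟨j, hj⟩
  have := hi.1
  rw [hj] at this
  exact h.not_isLeft_dart j this

end EmbDigraph.ClosedWalk

namespace RAM

/-- Add one to register `x`, modulo register `l`. -/
def advance (x l : ℕ) : Program := .inc x ;; .ite (.eq x l) (.const x 0) .skip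

/-- Find the edge whose number is in register `5` on the first cycle. -/
def findProgram : Program :=
  .const 20 0 ;; .load 21 6 20 ;; .while (.ne 21 5) (.inc 20 ;; .load 21 6 20)

/-- Proceed by one edge on the first cycle. Register `23` tells whether the walk is on a common
subwalk that it has entered from the left. The marked positions are appended to array `10`. -/
def scanStep : Program :=
  .load 25 3 21 ;; .load 25 9 25 ;; .ite (.ne 25 8) (.copy 23 25) .skip ;; advance 20 3 ;;
    .load 21 6 20 ;; .load 26 9 21 ;;
    .ite (.eq 26 7) (.ite (.eq 23 6) (.store 10 24 20 ;; .inc 24) .skip) .skip ;; .inc 22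

/-- Proceed once around the first cycle. -/
def scanRound : Program := .const 22 0 ;; .while (.lt 22 3) scanStep

/-- Make a list of the marked positions. The first round finds the initial value of register `23`. -/
def scanProgram : Program := scanRound ;; .const 24 0 ;; scanRound

theorem State.setReg_self (s : State) (x : ℕ) : s.setReg x (s.reg x) = s := by
  simp [State.setReg]

theorem State.setReg_setReg (s : State) (x v w : ℕ) : (s.setReg x v).setReg x w = s.setReg x w := by
  simp [State.setReg]

theorem runs_advance {p : ℕ} [NeZero p] {s : State} {x l : ℕ} (hl : l ≠ x) (u : ZMod p)
    (hx : s.reg x = u.val) (hp : s.reg l = p) {Q : ℕ → State → Prop}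
    (hQ : ∀ t ≤ 3, Q t (s.setReg x (u + 1).val)) : Runs (advance x l) s Q := by
  have hu := ZMod.val_lt u
  have h1 : (u + 1).val = if u.val + 1 = p then 0 else u.val + 1 := by
    have : u + 1 = ((u.val + 1 : ℕ) : ZMod p) := by simp
    rw [this, ZMod.val_natCast]
    split_ifs with h
    · rw [h, Nat.mod_self]
    · exact Nat.mod_eq_of_lt (by omega)
  unfold advance
  simp only [runs_seq, runs_inc, runs_ite, runs_const, runs_skip, holds_eq, setReg_reg, reduceIte,
    if_neg hl, hx, hp, State.setReg_setReg]
  rw [h1] at hQ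
  split_ifs with h
  · simpa [h] using hQ 3 le_rfl
  · simpa [h] using hQ 3 le_rfl

variable {v n : ℕ} {G : TorusGraph (Fin v) (Fin n)} {L R : G.Walk} {e : Fin n}

theorem runs_findProgram (hL : L.Simple) (he : L.Contains e) {s : State}
    (hs : HasInput G L R e s) :
    Runs findProgram s fun t s' => t ≤ 3 * n + 3 ∧
      ∃ u : ZMod L.len, L.dart u = e ∧ s'.reg 20 = u.val ∧ s'.reg 21 = L.dart u := by
  obtain ⟨u, rfl⟩ := he
  have hu := ZMod.val_lt u
  have hn : L.len ≤ n := by simpa using hL.len_le_card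
  unfold findProgram
  simp only [runs_seq, runs_const, runs_load]
  refine Runs.mono (runs_while_const u.val 2 (fun k s' => HasInput G L R (L.dart u) s' ∧
    s'.reg 20 = k ∧ s'.reg 21 = L.dart (k : ZMod L.len)) ?_ ?_ ?_) ?_
  · rintro k hk s1 ⟨hin, h20, h21⟩
    refine ⟨?_, ?_⟩
    · rw [holds_ne, h21, hin.edge]
      intro h
      have := congrArg ZMod.val (hL.eq_of_dart_eq (Fin.ext h))
      rw [ZMod.val_natCast_of_lt (by omega)] at this
      omega
    · simp only [runs_seq, runs_inc, runs_load]
      refine ⟨le_rfl, hin.of_eq (by simp) (by simp), by simp [h20], ?_⟩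
      simp [h20, hin.walkL_natCast (show k + 1 < L.len by omega)]
  · rintro s1 ⟨hin, h20, h21⟩
    rw [holds_ne, h21, hin.edge, not_not]
    simp
  · refine ⟨hs.of_eq (by simp) (by simp), by simp, ?_⟩
    simpa using hs.walkL 0
  · rintro t s1 ⟨ht, hin, h20, h21⟩
    refine ⟨by omega, u, rfl, h20, ?_⟩
    simpa using h21

/-- The memory while the first cycle is scanned at the position `u`. -/
structure Scanning (G : TorusGraph (Fin v) (Fin n)) (L R : G.Walk) (e : Fin n) (u : ZMod L.len)
    (s : State) : Prop where
  input : HasInput G L R e s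
  sides : HasSides R s
  pos : s.reg 20 = u.val
  dart : s.reg 21 = L.dart u

/-- The new state is correct if the edge is not shared, since it is then read off afresh, or if the
old state was correct. The disjunction is what lets the first round start from an arbitrary register
`23`. -/
theorem runs_scanStep (hR : R.Simple) {u : ZMod L.len} {s : State} (hs : Scanning G L R e u s) :
    Runs scanStep s fun t s' => t ≤ 20 ∧ Scanning G L R e (u + 1) s' ∧
      s'.reg 22 = s.reg 22 + 1 ∧
      ((¬ ∃ j, L.dart u = R.dart j) ∨ (s.reg 23 = 0 ↔ ¬ StateLeft L R u) →
        (s'.reg 23 = 0 ↔ ¬ StateLeft L R (u + 1)) ∧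
        (MarkedL L R (u + 1) → s'.reg 24 = s.reg 24 + 1 ∧
          s'.arr 10 = Function.update (s.arr 10) (s.reg 24) (u + 1).val) ∧
        (¬ MarkedL L R (u + 1) → s'.reg 24 = s.reg 24 ∧ s'.arr 10 = s.arr 10)) := by
  have htw : s.arr 3 (L.dart u) = L.inDart (u + 1) := by rw [hs.input.twin, inDart_add_one]
  have hmark := hR.markedL_iff_sideCode (L := L) (u + 1)
  -- The new value of register `23`.
  have hc : ∃ c, c = if R.sideCode (L.inDart (u + 1)) = 2 then s.reg 23
      else R.sideCode (L.inDart (u + 1)) := ⟨_, rfl⟩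
  obtain ⟨c, hc⟩ := hc
  have hstate : (¬ ∃ j, L.dart u = R.dart j) ∨ (s.reg 23 = 0 ↔ ¬ StateLeft L R u) →
      (c = 0 ↔ ¬ StateLeft L R (u + 1)) := by
    intro h
    rw [hc]
    split_ifs with h2
    · rw [sideCode_inDart_eq_two_iff] at h2
      rw [h.resolve_left (not_not.2 h2)]
      obtain ⟨j, hj⟩ := h2
      rw [stateLeft_succ_of_dart_eq hR hj]
    · rw [stateLeft_succ_of_dart_ne (mt (sideCode_inDart_eq_two_iff L R u).2 h2),
        ← hR.sideCode_eq_one_iff]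
      have : R.sideCode (L.inDart (u + 1)) ≤ 2 := by
        unfold sideCode
        split_ifs <;> omega
      omega
  unfold scanStep
  simp only [runs_seq, runs_load, setReg_reg, setReg_arr, reduceIte, hs.dart, htw, hs.sides.side, State.setReg_setReg]
  refine Runs.mono (Q := fun t s' => t ≤ 2 ∧
    s' = (s.setReg 25 (R.sideCode (L.inDart (u + 1)))).setReg 23 c) ?_ ?_
  · simp only [runs_ite, runs_copy, runs_skip, holds_ne, setReg_reg, Nat.reduceEqDiff, reduceIte,
      hs.input.two, hc]
    by_cases h2 : R.sideCode (L.inDart (u + 1)) = 2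
    · rw [if_neg (not_not.2 h2), if_pos h2]
      refine ⟨le_rfl, ?_⟩
      conv_lhs => rw [← State.setReg_self (s.setReg 25 _) 23]
      simp
    · rw [if_pos h2, if_neg h2]
      exact ⟨le_rfl, rfl⟩
  rintro t1 _ ⟨ht1, rfl⟩
  refine runs_advance (by norm_num) u (by simp [hs.pos]) (by simp [hs.input.lenL]) ?_
  intro t2 ht2
  simp only [setReg_reg, setReg_arr, Nat.reduceEqDiff, reduceIte, hs.input.walkL,
    hs.sides.side]
  set s2 := (((((s.setReg 25 (R.sideCode (L.inDart (u + 1)))).setReg 23 c).setReg 20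
    (u + 1).val).setReg 21 (L.dart (u + 1))).setReg 26 (R.sideCode (L.dart (u + 1)))) with hs2
  have hin2 : HasInput G L R e s2 := hs.input.of_eq (by simp [hs2]) (by simp [hs2])
  refine Runs.mono (Q := fun t s' => t ≤ 4 ∧ s' =
    if R.sideCode (L.dart (u + 1)) = 1 ∧ c = 0 then
      (s2.setArr 10 (s.reg 24) (u + 1).val).setReg 24 (s.reg 24 + 1) else s2) ?_ ?_
  · simp only [runs_ite, runs_seq, runs_store, runs_inc, runs_skip, holds_eq]
    by_cases k1 : R.sideCode (L.dart (u + 1)) = 1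
    · by_cases k2 : c = 0
      · rw [if_pos (by simp [hs2, k1, hs.input.one]), if_pos (by simp [hs2, hs.input.zero, k2]),
          if_pos ⟨k1, k2⟩]
        simp [hs2]
      · rw [if_pos (by simp [hs2, k1, hs.input.one]), if_neg (by simp [hs2, hs.input.zero, k2]),
          if_neg (by tauto)]
        simp
    · rw [if_neg (by simp [hs2, k1, hs.input.one]), if_neg (by tauto)]
      simp
  rintro t3 s3 ⟨ht3, rfl⟩
  rw [runs_inc]
  refine ⟨by omega, ⟨?_, ⟨?_, ?_⟩, ?_, ?_⟩, ?_, fun h => ⟨?_, fun hM => ?_, fun hM => ?_⟩⟩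
  · refine hin2.of_eq ?_ ?_ <;> split_ifs <;> simp
  · intro j
    rw [← hs.sides.pos]
    split_ifs <;> simp [hs2]
  · intro j
    refine Eq.trans ?_ (hs.sides.side j)
    split_ifs <;> simp [hs2]
  · split_ifs <;> simp [hs2]
  · split_ifs <;> simp [hs2]
  · split_ifs <;> simp [hs2]
  · rw [← hstate h]
    split_ifs <;> simp [hs2]
  · rw [hmark, ← hstate h] at hM
    rw [if_pos hM]
    simp [hs2]
  · rw [hmark, ← hstate h] at hM
    rw [if_neg hM]
    simp [hs2]

/-- The invariant says that all edges so far were shared or that register `23` is correct. A mark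
rules out the first alternative after a full round. -/
theorem runs_scanRound_first (hR : R.Simple) {u : ZMod L.len} {s : State}
    (hs : Scanning G L R e u s) (hm : ∃ i, MarkedL L R i) :
    Runs scanRound s fun t s' => t ≤ 21 * L.len + 2 ∧ Scanning G L R e u s' ∧
      (s'.reg 23 = 0 ↔ ¬ StateLeft L R u) := by
  unfold scanRound
  rw [runs_seq, runs_const]
  refine Runs.mono (runs_while_const L.len 20 (fun k s' =>
    Scanning G L R e (u + (k : ℕ)) s' ∧ s'.reg 22 = k ∧
    ((∀ r < k, ∃ j, L.dart (u + (r : ℕ)) = R.dart j) ∨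
      (s'.reg 23 = 0 ↔ ¬ StateLeft L R (u + (k : ℕ))))) ?_ ?_ ?_) ?_
  · rintro k hk s1 ⟨h1, h22, h23⟩
    refine ⟨by rw [holds_lt, h22, h1.input.lenL]; exact hk, ?_⟩
    refine (runs_scanStep hR h1).mono ?_
    rintro t s2 ⟨ht, h2, g22, g⟩
    rw [Nat.cast_succ, ← add_assoc]
    refine ⟨ht, h2, by rw [g22, h22], ?_⟩
    by_cases hsh : ∃ j, L.dart (u + (k : ℕ)) = R.dart j
    · rcases h23 with h | h
      · left
        intro r hr
        rcases Nat.lt_succ_iff_lt_or_eq.1 hr with hr | rfl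
        · exact h r hr
        · exact hsh
      · exact Or.inr (g (Or.inr h)).1
    · exact Or.inr (g (Or.inl hsh)).1
  · rintro s1 ⟨h1, h22, -⟩
    rw [holds_lt, h22, h1.input.lenL]
    exact lt_irrefl _
  · refine ⟨?_, by simp, Or.inl (by simp)⟩
    rw [Nat.cast_zero, add_zero]
    exact ⟨hs.input.of_eq (by simp) (by simp), ⟨by simpa using hs.sides.pos,
      by simpa using hs.sides.side⟩, by simpa using hs.pos, by simpa using hs.dart⟩
  · rintro t s1 ⟨ht, h1, h22, h23⟩
    rw [ZMod.natCast_self, add_zero] at h1 h23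
    refine ⟨by omega, h1, h23.resolve_left fun h => ?_⟩
    obtain ⟨i, hi⟩ := hm
    refine hR.exists_not_shared hi ?_
    have := h (i - u).val (ZMod.val_lt _)
    simpa using this

-- A step advances before it tests, so the offsets of the listed marks are counted from `u + 1`, and
-- the position `u` itself is tested last.
open Classical in
theorem runs_scanRound_second (hR : R.Simple) {u : ZMod L.len} {s : State}
    (hs : Scanning G L R e u s) (h23 : s.reg 23 = 0 ↔ ¬ StateLeft L R u) (h24 : s.reg 24 = 0) :
    Runs scanRound s fun t s' => t ≤ 21 * L.len + 2 ∧ Scanning G L R e u s' ∧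
      s'.reg 24 = Nat.count (fun τ => MarkedL L R (u + 1 + (τ : ℕ))) L.len ∧
      ∀ m < s'.reg 24,
        s'.arr 10 m = (u + 1 + (Nat.nth (fun τ => MarkedL L R (u + 1 + (τ : ℕ))) m : ℕ)).val := by
  unfold scanRound
  rw [runs_seq, runs_const]
  refine Runs.mono (runs_while_const L.len 20 (fun k s' =>
    Scanning G L R e (u + (k : ℕ)) s' ∧ s'.reg 22 = k ∧
    (s'.reg 23 = 0 ↔ ¬ StateLeft L R (u + (k : ℕ))) ∧
    s'.reg 24 = Nat.count (fun τ => MarkedL L R (u + 1 + (τ : ℕ))) k ∧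
    ∀ m < s'.reg 24, s'.arr 10 m =
      (u + 1 + (Nat.nth (fun τ => MarkedL L R (u + 1 + (τ : ℕ))) m : ℕ)).val) ?_ ?_ ?_) ?_
  · rintro k hk s1 ⟨h1, h22, h23, h24, h10⟩
    refine ⟨by rw [holds_lt, h22, h1.input.lenL]; exact hk, ?_⟩
    refine (runs_scanStep hR h1).mono ?_
    rintro t s2 ⟨ht, h2, g22, g⟩
    obtain ⟨g23, gM, gN⟩ := g (Or.inr h23)
    have hcomm : u + (k : ℕ) + 1 = u + 1 + (k : ℕ) := add_right_comm _ _ _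
    rw [Nat.cast_succ, ← add_assoc]
    refine ⟨ht, h2, by rw [g22, h22], g23, ?_⟩
    rw [Nat.count_succ]
    by_cases hM : MarkedL L R (u + 1 + (k : ℕ))
    · obtain ⟨g24, g10⟩ := gM (hcomm ▸ hM)
      rw [if_pos hM]
      refine ⟨by rw [g24, h24], fun m hm => ?_⟩
      rw [g10, Function.update_apply]
      split_ifs with hm'
      · rw [hm', h24, Nat.nth_count (p := fun τ : ℕ => MarkedL L R (u + 1 + (τ : ℕ))) hM, hcomm]
      · exact h10 m (by omega)
    · obtain ⟨g24, g10⟩ := gN (hcomm ▸ hM)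
      rw [if_neg hM, g24, g10]
      exact ⟨h24, h10⟩
  · rintro s1 ⟨h1, h22, -⟩
    rw [holds_lt, h22, h1.input.lenL]
    exact lt_irrefl _
  · refine ⟨?_, by simp, by simpa using h23, by simp [h24], by simp [h24]⟩
    rw [Nat.cast_zero, add_zero]
    exact ⟨hs.input.of_eq (by simp) (by simp), ⟨by simpa using hs.sides.pos,
      by simpa using hs.sides.side⟩, by simpa using hs.pos, by simpa using hs.dart⟩
  · rintro t s1 ⟨ht, h1, h22, h23, h24, h10⟩
    rw [ZMod.natCast_self, add_zero] at h1
    exact ⟨by omega, h1, h24, h10⟩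

open Classical in
theorem runs_scanProgram (hR : R.Simple) {u : ZMod L.len} {s : State}
    (hs : Scanning G L R e u s) (hm : ∃ i, MarkedL L R i) :
    Runs scanProgram s fun t s' => t ≤ 42 * L.len + 5 ∧
      s'.reg 24 = Nat.count (fun τ => MarkedL L R (u + 1 + (τ : ℕ))) L.len ∧
      ∀ m < s'.reg 24,
        s'.arr 10 m = (u + 1 + (Nat.nth (fun τ => MarkedL L R (u + 1 + (τ : ℕ))) m : ℕ)).val := by
  unfold scanProgram
  rw [runs_seq]
  refine (runs_scanRound_first hR hs hm).mono ?_
  rintro t1 s1 ⟨ht1, hs1, h23⟩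
  rw [runs_seq, runs_const]
  refine (runs_scanRound_second hR (u := u) ⟨hs1.input.of_eq (by simp) (by simp), ⟨?_, ?_⟩, ?_, ?_⟩
    ?_ ?_).mono ?_
  · simpa using hs1.sides.pos
  · simpa using hs1.sides.side
  · simpa using hs1.pos
  · simpa using hs1.dart
  · simpa using h23
  · simp
  · rintro t2 s2 ⟨ht2, -, h24, h10⟩
    exact ⟨by omega, h24, h10⟩

end RAM

/-! ## The program: homotopy classes -/

open EmbDigraph EmbDigraph.ClosedWalk RAM

theorem EdgeKind.code_injective : Function.Injective EdgeKind.code := by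
  intro κ κ' h
  cases κ <;> cases κ' <;> simp_all [EdgeKind.code]

namespace TorusGraph

variable {V D : Type} [Fintype V] [Fintype D] (G : TorusGraph V D)

open Classical in
/-- Whether the next dart clockwise is the start of an edge of the given kind. -/
noncomputable def startsNext (κ : EdgeKind) (d : D) : ℕ :=
  if G.kind (G.rot d) = κ ∧ G.fwd (G.rot d) = true then 1 else 0

theorem startsNext_le_one (κ : EdgeKind) (d : D) : G.startsNext κ d ≤ 1 := by
  unfold startsNext
  split_ifs <;> omega

theorem flux_M {d : D} (hd : G.kind d = EdgeKind.graph) :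
    G.M.flux d = G.startsNext .meridian d - G.startsNext .meridian (G.twin d) := by
  rw [flux, G.leftCount_orbit (by simp) G.M_simple G.M_contains (by simp [hd]),
    G.leftCount_orbit (by simp) G.M_simple G.M_contains (by simp [G.kind_twin, hd])]
  simp [startsNext]

theorem flux_H {d : D} (hd : G.kind d = EdgeKind.graph) :
    G.H.flux d = G.startsNext .horizon d - G.startsNext .horizon (G.twin d) := by
  rw [flux, G.leftCount_orbit (by simp) G.H_simple G.H_contains (by simp [hd]),
    G.leftCount_orbit (by simp) G.H_simple G.H_contains (by simp [G.kind_twin, hd])]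
  simp [startsNext]

/-- The number of edges of the walk after whose start an edge of the given kind starts. -/
noncomputable def startsAt (C : G.Walk) (κ : EdgeKind) (k : ℕ) : ℕ :=
  ∑ i ∈ Finset.range k, G.startsNext κ (C.dart (i : ZMod C.len))

/-- The number of edges of the walk after whose end an edge of the given kind starts. -/
noncomputable def startsAtEnd (C : G.Walk) (κ : EdgeKind) (k : ℕ) : ℕ :=
  ∑ i ∈ Finset.range k, G.startsNext κ (G.twin (C.dart (i : ZMod C.len)))

theorem sum_dart_eq (C : G.Walk) (F : D → ℤ) :
    ∑ i, F (C.dart i) = ∑ i ∈ Finset.range C.len, F (C.dart (i : ZMod C.len)) := by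
  rw [← sum_zmod_val fun k : ℕ => F (C.dart (k : ZMod C.len))]
  simp

theorem m_eq_starts {C : G.Walk} (hC : G.InGraph C) :
    G.m C = G.startsAtEnd C .meridian C.len - G.startsAt C .meridian C.len := by
  rw [G.m_eq, Finset.sum_congr rfl fun i _ => G.flux_M (hC i), Finset.sum_sub_distrib,
    G.sum_dart_eq C fun d => (G.startsNext .meridian d : ℤ),
    G.sum_dart_eq C fun d => (G.startsNext .meridian (G.twin d) : ℤ), startsAt, startsAtEnd]
  push_cast
  ring

theorem h_eq_starts {C : G.Walk} (hC : G.InGraph C) :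
    G.h C = G.startsAt C .horizon C.len - G.startsAtEnd C .horizon C.len := by
  rw [G.h_eq, Finset.sum_congr rfl fun i _ => G.flux_H (hC i), Finset.sum_sub_distrib,
    G.sum_dart_eq C fun d => (G.startsNext .horizon d : ℤ),
    G.sum_dart_eq C fun d => (G.startsNext .horizon (G.twin d) : ℤ), startsAt, startsAtEnd]
  push_cast
  ring

/-- Bounds the number of rounds of the loop in `subtractProgram`. -/
theorem startsAt_le (C : G.Walk) (κ : EdgeKind) (k : ℕ) : G.startsAt C κ k ≤ k := by
  refine (Finset.sum_le_card_nsmul _ _ 1 fun i _ => G.startsNext_le_one κ _).trans ?_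
  simp

end TorusGraph

namespace RAM

/-- If an edge starts at the next dart after that in register `x`, then count it in array `a`. -/
def countStart (x a : ℕ) : Program :=
  .load 32 2 x ;; .load 33 4 32 ;;
    .ite (.ne 33 6) (.load 33 5 32 ;; .load 34 a 33 ;; .inc 34 ;; .store a 33 34) .skip

/-- Count for the walk in array `w` of the length in register `l`. -/
def countStarts (w l a b : ℕ) : Program :=
  .const 30 0 ;; .while (.lt 30 l)
    (.load 31 w 30 ;; countStart 31 a ;; .load 31 3 31 ;; countStart 31 b ;; .inc 30)

/-- Decrement registers `43` and `40` until the former is zero. -/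
def subtractProgram : Program :=
  .copy 40 44 ;; .while (.lt 6 43) (.dec 43 ;; .dec 40) ;; .dec 40

/-- Compute the number of marks between the ends of the arc of the first cycle, minus one. -/
def offsetProgram : Program :=
  .load 41 11 7 ;; .load 42 12 7 ;; .load 43 13 7 ;; .load 44 14 7 ;;
    .load 45 11 8 ;; .load 46 12 8 ;; .load 47 13 8 ;; .load 48 14 8 ;; .const 40 0 ;;
    .ite (.lt 42 41) (.ite (.lt 43 44) (.ite (.lt 46 45) (.ite (.lt 48 47)
      subtractProgram .skip) .skip) .skip) .skip

/-- Registers hold natural numbers, so each of `m` and `h` is kept as a pair of counts, and its sign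
is found by comparing the two. -/
def homotopyProgram : Program :=
  countStarts 6 3 11 12 ;; countStarts 7 4 13 14 ;; offsetProgram

variable {v n : ℕ} {G : TorusGraph (Fin v) (Fin n)} {L R : G.Walk} {e : Fin n}

theorem runs_countStart {s : State} (hs : HasInput G L R e s) {x a : ℕ} {d : Fin n}
    (hx : s.reg x = d) :
    Runs (countStart x a) s fun t s' => t ≤ 7 ∧
      (∀ κ, s'.arr a (EdgeKind.code κ) = s.arr a (EdgeKind.code κ) + G.startsNext κ d) ∧
      (∀ y, y ∉ [32, 33, 34] → s'.reg y = s.reg y) ∧ ∀ b, b ≠ a → s'.arr b = s.arr b := by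
  refine Runs.mono (Runs.frame (Q := fun t s' => t ≤ 7 ∧
    ∀ κ, s'.arr a (EdgeKind.code κ) = s.arr a (EdgeKind.code κ) + G.startsNext κ d) ?_) ?_
  · unfold countStart
    simp only [runs_seq, runs_ite, runs_load, runs_store, runs_inc, runs_skip, setReg_reg,
      setReg_arr, setArr_arr, Nat.reduceEqDiff, reduceIte, hx, hs.rot, hs.fwd, hs.kind, hs.zero,
      holds_ne]
    cases hf : G.fwd (G.rot d)
    · simp [TorusGraph.startsNext, hf]
    · rw [if_pos (by simp)]
      refine ⟨le_rfl, fun κ => ?_⟩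
      unfold TorusGraph.startsNext
      by_cases hκ : G.kind (G.rot d) = κ
      · rw [if_pos ⟨hκ, hf⟩, hκ, Function.update_self]
      · rw [if_neg fun h => hκ h.1,
          Function.update_of_ne fun h => hκ (EdgeKind.code_injective h).symm]
        rfl
  · rintro t s' ⟨⟨ht, h⟩, hr, ha⟩
    refine ⟨ht, h, fun y hy => hr y ?_, fun b hb => ha b ?_⟩
    · simpa [countStart, Program.regs] using hy
    · simpa [countStart, Program.arrs] using hb

theorem runs_countStarts {C : G.Walk} {w l a b : ℕ}
    (hC : ∀ s, HasInput G L R e s → s.reg l = C.len ∧ ∀ i : ZMod C.len, s.arr w i.val = C.dart i)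
    (ha : 10 < a) (hb : a < b) {s : State} (hs : HasInput G L R e s)
    (ha0 : ∀ x, s.arr a x = 0) (hb0 : ∀ x, s.arr b x = 0) :
    Runs (countStarts w l a b) s fun t s' => t ≤ 18 * C.len + 2 ∧
      (∀ κ, s'.arr a (EdgeKind.code κ) = G.startsAt C κ C.len ∧
        s'.arr b (EdgeKind.code κ) = G.startsAtEnd C κ C.len) ∧
      HasInput G L R e s' ∧ ∀ c, c ≠ a → c ≠ b → s'.arr c = s.arr c := by
  unfold countStarts
  rw [runs_seq, runs_const]
  refine Runs.mono (runs_while_const C.len 17 (fun k s' => HasInput G L R e s' ∧ s'.reg 30 = k ∧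
    (∀ κ, s'.arr a (EdgeKind.code κ) = G.startsAt C κ k ∧
      s'.arr b (EdgeKind.code κ) = G.startsAtEnd C κ k) ∧
    ∀ c, c ≠ a → c ≠ b → s'.arr c = s.arr c) ?_ ?_ ?_) ?_
  · rintro k hk s1 ⟨h1, h30, hab, hc⟩
    refine ⟨by rw [holds_lt, h30, (hC _ h1).1]; exact hk, ?_⟩
    have hd : s1.arr w k = C.dart (k : ZMod C.len) := by
      rw [← (hC _ h1).2, ZMod.val_natCast_of_lt hk]
    simp only [runs_seq, runs_load, runs_inc, h30, hd]
    refine (runs_countStart (d := C.dart (k : ZMod C.len)) (G := G) (L := L) (R := R) (e := e)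
      (h1.of_eq (by simp) (by simp)) (by simp)).mono ?_
    rintro t2 s2 ⟨ht2, ha2, hr2, hc2⟩
    have h2 : HasInput G L R e s2 := h1.of_eq
      (by simp (disch := simp) [hr2]) (by simp (disch := omega) [hc2])
    have hd2 : s2.arr 3 (s2.reg 31) = G.twin (C.dart (k : ZMod C.len)) := by
      rw [hr2 31 (by simp), setReg_reg, if_pos rfl, h2.twin]
    rw [hd2]
    refine (runs_countStart (d := G.twin (C.dart (k : ZMod C.len))) (G := G) (L := L) (R := R)
      (e := e) (h2.of_eq (by simp) (by simp)) (by simp)).mono ?_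
    rintro t3 s3 ⟨ht3, ha3, hr3, hc3⟩
    refine ⟨by omega, h2.of_eq (by simp (disch := simp) [hr3])
      (by simp (disch := omega) [hc3]), ?_, fun κ => ⟨?_, ?_⟩, fun c hca hcb => ?_⟩
    · rw [setReg_reg, if_pos rfl, hr3 30 (by simp), setReg_reg, if_neg (by simp), hr2 30 (by simp),
        setReg_reg, if_neg (by simp), h30]
    · rw [setReg_arr, hc3 a hb.ne, setReg_arr, ha2, setReg_arr, (hab κ).1, TorusGraph.startsAt,
        TorusGraph.startsAt, Finset.sum_range_succ]
    · rw [setReg_arr, ha3, setReg_arr, hc2 b hb.ne', setReg_arr, (hab κ).2, TorusGraph.startsAtEnd,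
        TorusGraph.startsAtEnd, Finset.sum_range_succ]
    · rw [setReg_arr, hc3 c hcb, setReg_arr, hc2 c hca, setReg_arr, hc c hca hcb]
  · rintro s1 ⟨h1, h30, -⟩
    rw [holds_lt, h30, (hC _ h1).1]
    exact lt_irrefl _
  · exact ⟨hs.of_eq (by simp) (by simp), by simp, fun κ => by
      simp [ha0, hb0, TorusGraph.startsAt, TorusGraph.startsAtEnd], fun _ _ _ => rfl⟩
  · rintro t s1 ⟨ht, h1, h30, hab, hc⟩
    exact ⟨by omega, hab, h1, hc⟩

theorem runs_subtractProgram {s : State} (h6 : s.reg 6 = 0) :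
    Runs subtractProgram s fun t s' => t ≤ 3 * s.reg 43 + 3 ∧
      s'.reg 40 = s.reg 44 - s.reg 43 - 1 := by
  unfold subtractProgram
  rw [runs_seq, runs_copy, runs_seq]
  refine Runs.mono (runs_while_const (s.reg 43) 2 (fun k s' => s'.reg 6 = 0 ∧
    s'.reg 43 = s.reg 43 - k ∧ s'.reg 40 = s.reg 44 - k) ?_ ?_ ?_) ?_
  · rintro k hk s1 ⟨g6, g43, g40⟩
    rw [holds_lt, runs_seq, runs_dec, runs_dec]
    refine ⟨by omega, le_rfl, by simp [g6], ?_, ?_⟩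
    · simp [g43]; omega
    · simp [g40]; omega
  · rintro s1 ⟨g6, g43, g40⟩
    rw [holds_lt]
    omega
  · simp [h6]
  · rintro t s1 ⟨ht, g6, g43, g40⟩
    rw [runs_dec]
    refine ⟨by omega, ?_⟩
    simp [g40]

theorem runs_homotopyProgram (hL : G.IsCycle L) (hR : G.IsCycle R) {s : State}
    (hs : HasInput G L R e s) (h0 : ∀ a x, 10 < a → s.arr a x = 0) :
    Runs homotopyProgram s fun t s' => t ≤ 40 * n + 40 ∧
      (TorusGraph.Opposed L R → (s'.reg 40 : ℤ) = G.m R - 1) ∧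
      (¬ TorusGraph.Opposed L R → s'.reg 40 = 0) := by
  have hnL : L.len ≤ n := by simpa using hL.2.len_le_card
  have hnR : R.len ≤ n := by simpa using hR.2.len_le_card
  unfold homotopyProgram
  rw [runs_seq]
  refine (runs_countStarts (C := L) (fun s h => ⟨h.lenL, h.walkL⟩) (by omega) (by omega) hs
    (fun x => h0 _ x (by omega)) (fun x => h0 _ x (by omega))).mono ?_
  rintro t1 s1 ⟨ht1, hL1, hs1, hc1⟩
  rw [runs_seq]
  refine (runs_countStarts (C := R) (fun s h => ⟨h.lenR, h.walkR⟩) (by omega) (by omega) hs1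
    (fun x => ?_) (fun x => ?_)).mono ?_
  · rw [hc1 13 (by omega) (by omega)]
    exact h0 _ x (by omega)
  · rw [hc1 14 (by omega) (by omega)]
    exact h0 _ x (by omega)
  rintro t2 s2 ⟨ht2, hR2, hs2, hc2⟩
  rw [← hc2 11 (by omega) (by omega), ← hc2 12 (by omega) (by omega)] at hL1
  have hLM := hL1 .meridian
  have hLH := hL1 .horizon
  have hRM := hR2 .meridian
  have hRH := hR2 .horizon
  have hb := G.startsAt_le R .meridian R.len
  have mL := G.m_eq_starts hL.1
  have mR := G.m_eq_starts hR.1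
  have hL' := G.h_eq_starts hL.1
  have hR' := G.h_eq_starts hR.1
  simp only [EdgeKind.code] at hLM hLH hRM hRH
  unfold offsetProgram TorusGraph.Opposed
  simp only [runs_seq, runs_load, runs_const, setReg_reg, setReg_arr, Nat.reduceEqDiff, reduceIte,
    hs2.one, hs2.two, hLM, hLH, hRM, hRH]
  simp only [runs_ite, runs_skip, holds_lt, setReg_reg, Nat.reduceEqDiff, reduceIte]
  split_ifs with c1 c2 c3 c4
  -- All four sign tests have succeeded, in particular `m R > 0`, so the truncated subtraction is
  -- exact.
  · refine (runs_subtractProgram (by simp [hs2.zero])).mono ?_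
    rintro t3 s3 ⟨ht3, h40⟩
    simp only [setReg_reg, Nat.reduceEqDiff, reduceIte] at ht3 h40
    rw [h40]
    exact ⟨by omega, fun _ => by omega, fun h => absurd ⟨by omega, by omega, by omega, by omega⟩ h⟩
  all_goals exact ⟨by omega, fun h => by omega, fun _ => by simp⟩

end RAM

/-! ## The program: output -/

open EmbDigraph EmbDigraph.ClosedWalk RAM

namespace EmbDigraph

variable {V D : Type} {X : EmbDigraph V D} [Finite D] {L R : X.ClosedWalk}

open Classical in
theorem marksL_eq_count (L R : X.ClosedWalk) (i : ZMod L.len) (a : ℕ) :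
    marksL L R i a = Nat.count (fun τ => MarkedL L R (i + (τ : ℕ))) a := by
  unfold marksL
  induction a with
  | zero => simp
  | succ a ih =>
    rw [Finset.sum_range_succ, ih, Nat.count_succ]
    by_cases h : MarkedL L R (i + (a : ℕ))
    · rw [ind_of h, if_pos h]
      push_cast
      rfl
    · rw [ind_of_not h, if_neg h]
      simp

/-- A mark recurs in every turn. Thus `Nat.nth` enumerates an infinite set and needs no finiteness
side conditions. -/
theorem infinite_markedL {i i' : ZMod L.len} (h : MarkedL L R i') :
    (Set.ofPred fun τ : ℕ => MarkedL L R (i + (τ : ℕ))).Infinite := by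
  refine Set.infinite_of_forall_exists_gt fun N => ⟨(i' - i).val + (N + 1) * L.len, ?_, ?_⟩
  · change MarkedL L R _
    simpa using h
  · have := Nat.pos_of_ne_zero L.len_neZero.out
    nlinarith

open Classical in
/-- The arc of the first cycle from the last mark before a given edge to the mark with the number
`o` after it. -/
theorem exists_arc_of_marks {u : ZMod L.len} {o k : ℕ}
    (hk : k = Nat.count (fun τ => MarkedL L R (u + 1 + (τ : ℕ))) L.len) (ho : o < k) :
    ∃ i : ZMod L.len, ∃ a, 0 < a ∧ a ≤ L.len ∧ MarkedL L R i ∧ MarkedL L R (i + a) ∧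
      marksL L R i a = o + 1 ∧ (∃ t < a, L.dart (i + t) = L.dart u) ∧
      i = u + 1 + (Nat.nth (fun τ => MarkedL L R (u + 1 + (τ : ℕ))) (k - 1) : ℕ) ∧
      i + a = u + 1 + (Nat.nth (fun τ => MarkedL L R (u + 1 + (τ : ℕ))) o : ℕ) := by
  set p : ℕ → Prop := fun τ => MarkedL L R (u + 1 + (τ : ℕ)) with hp
  have hk : k = Nat.count p L.len := hk
  have hex : ∃ i', MarkedL L R i' := by
    by_contra hno
    have : Nat.count p L.len = 0 := by
      rw [Nat.count_eq_card_filter_range, Finset.card_eq_zero, Finset.filter_eq_empty_iff]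
      exact fun τ _ h => hno ⟨_, h⟩
    omega
  obtain ⟨i', hi'⟩ := hex
  have hinf : (Set.ofPred p).Infinite := infinite_markedL hi'
  -- Offsets count from `u + 1`, so offset `L.len - 1` is the position `u` of the given edge. Of the
  -- marks in this round, the last one is the start `x` of the arc, and the one with number `o` is
  -- its end `y`, reached after wrapping around; `y ≤ x` keeps the arc within one turn.
  have hx : Nat.nth p (k - 1) < L.len := Nat.nth_lt_of_lt_count (by omega)
  have hyx : Nat.nth p o ≤ Nat.nth p (k - 1) := Nat.nth_monotone hinf (by omega)
  have cx : Nat.count p (Nat.nth p (k - 1)) = k - 1 := Nat.count_nth_of_infinite hinf _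
  have cy : Nat.count p (Nat.nth p o) = o := Nat.count_nth_of_infinite hinf _
  have mx : p (Nat.nth p (k - 1)) := Nat.nth_mem_of_infinite hinf _
  have my : p (Nat.nth p o) := Nat.nth_mem_of_infinite hinf _
  generalize Nat.nth p (k - 1) = x at *
  generalize Nat.nth p o = y at *
  have hend : u + 1 + (x : ZMod L.len) + (L.len - x + y : ℕ) = u + 1 + (y : ℕ) := by
    rw [Nat.cast_add, Nat.cast_sub hx.le, ZMod.natCast_self]
    ring
  refine ⟨u + 1 + (x : ℕ), L.len - x + y, by omega, by omega, mx, ?_, ?_, ?_, rfl, hend⟩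
  · rw [hend]
    exact my
  -- The marks before offset `x` number `k - 1`, those before `L.len + y` number `k + o`; the arc
  -- carries the difference.
  · have e1 := marksL_add L R (u + 1) x (L.len - x + y)
    have e2 := marksL_add L R (u + 1) L.len y
    rw [ZMod.natCast_self, add_zero] at e2
    rw [show x + (L.len - x + y) = L.len + y by omega, e2, marksL_eq_count, marksL_eq_count,
      marksL_eq_count L R _ x] at e1
    change ((Nat.count p L.len : ℕ) : ℤ) + (Nat.count p y : ℕ) = (Nat.count p x : ℕ) + _ at e1
    rw [cx, cy, ← hk] at e1
    omega
  · refine ⟨L.len - x - 1, by omega, congrArg L.dart ?_⟩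
    rw [Nat.sub_sub, Nat.cast_sub (by omega), ZMod.natCast_self]
    push_cast
    ring

end EmbDigraph

namespace RAM

/-- Write one dart of the walk in array `w` to the output. Its position is in register `x` and its
length in register `l`. -/
def emitStep (w x l : ℕ) : Program :=
  .load 54 w x ;; .store 0 0 54 ;; .inc 0 ;; advance x l

/-- Write an arc of the walk in array `w` to the output. -/
def emitArc (w x l y : ℕ) : Program := emitStep w x l ;; .while (.ne x y) (emitStep w x l)

/-- The arc of the first cycle goes from the last listed mark to the one whose number is in register
`40`. Array `8` translates the end vertices into positions on the second cycle for the way back. -/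
def outputProgram : Program :=
  .copy 50 24 ;; .dec 50 ;; .load 51 10 50 ;; .load 52 10 40 ;;
    .load 55 6 52 ;; .load 55 1 55 ;; .load 56 8 55 ;;
    .load 57 6 51 ;; .load 57 1 57 ;; .load 57 8 57 ;; .const 0 0 ;;
    emitArc 6 51 3 52 ;; emitArc 7 56 4 57

variable {v n : ℕ} {G : TorusGraph (Fin v) (Fin n)} {L R : G.Walk} {e : Fin n}

theorem runs_emitStep {C : G.Walk} {w x l : ℕ} (hl : l ≤ 8) (hl0 : 0 < l)
    (hx : 8 < x) (hx' : x ≠ 54) {s : State} (hs : HasInput G L R e s)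
    (hC : s.reg l = C.len ∧ ∀ i : ZMod C.len, s.arr w i.val = C.dart i) (i : ZMod C.len)
    (hi : s.reg x = i.val) :
    Runs (emitStep w x l) s fun t s' => t ≤ 6 ∧ HasInput G L R e s' ∧
      s'.reg x = (i + 1).val ∧ s'.reg 0 = s.reg 0 + 1 ∧
      s'.arr 0 = Function.update (s.arr 0) (s.reg 0) (C.dart i) ∧
      (∀ y, y ≠ x → y ≠ 0 → y ≠ 54 → s'.reg y = s.reg y) := by
  unfold emitStep
  simp only [runs_seq, runs_load, runs_store, runs_inc]
  have h1 : x ≠ 0 := by omega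
  have h2 : l ≠ 0 := by omega
  have h3 : l ≠ 54 := by omega
  refine runs_advance (by omega) i ?_ ?_ fun t ht => ⟨by omega, hs.of_eq ?_ ?_, ?_, ?_, ?_, ?_⟩
  · simp [h1, hx', hi]
  · simp [h2, h3, hC.1]
  · simp; omega
  · simp
  · simp
  · simp [h1.symm]
  · simp [hi, hC.2]
  · intro y k1 k2 k3
    simp [k1, k2, k3]

/-- The first dart is written before the end is tested for, so coinciding ends yield the full turn
that `exists_arc` prescribes. -/
theorem runs_emitArc {C : G.Walk} {w x l y : ℕ} (hl : l ≤ 8) (hl0 : 0 < l)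
    (hx : 8 < x) (hx' : x ≠ 54) (hy : 8 < y) (hy' : y ≠ 54) (hxy : y ≠ x)
    (hC : ∀ s, HasInput G L R e s → s.reg l = C.len ∧ ∀ i : ZMod C.len, s.arr w i.val = C.dart i)
    {s : State} (hs : HasInput G L R e s) {i : ZMod C.len} {a : ℕ} (ha : 0 < a) (ha' : a ≤ C.len)
    (hi : s.reg x = i.val) (hend : s.reg y = (i + (a : ℕ)).val) :
    Runs (emitArc w x l y) s fun t s' => t ≤ 7 * a + 1 ∧ HasInput G L R e s' ∧
      s'.reg 0 = s.reg 0 + a ∧ (∀ q < s.reg 0, s'.arr 0 q = s.arr 0 q) ∧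
      (∀ q < a, s'.arr 0 (s.reg 0 + q) = C.dart (i + (q : ℕ))) ∧
      (∀ z, z ≠ x → z ≠ 0 → z ≠ 54 → s'.reg z = s.reg z) := by
  have hset : ∀ (c : ℕ) (s1 s2 : State), s1.reg 0 = s.reg 0 + c →
      (∀ q < s.reg 0, s1.arr 0 q = s.arr 0 q) →
      (∀ q < c, s1.arr 0 (s.reg 0 + q) = C.dart (i + (q : ℕ))) →
      s2.arr 0 = Function.update (s1.arr 0) (s1.reg 0) (C.dart (i + (c : ℕ))) →
      (∀ q < s.reg 0, s2.arr 0 q = s.arr 0 q) ∧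
      ∀ q < c + 1, s2.arr 0 (s.reg 0 + q) = C.dart (i + (q : ℕ)) := by
    intro c s1 s2 h0 hb hq h2
    rw [h2, h0]
    refine ⟨fun q hq' => ?_, fun q hq' => ?_⟩
    · rw [Function.update_of_ne (by omega), hb q hq']
    · rcases Nat.lt_succ_iff_lt_or_eq.1 hq' with hq' | rfl
      · rw [Function.update_of_ne (by omega), hq q hq']
      · rw [Function.update_self]
  unfold emitArc
  rw [runs_seq]
  refine (runs_emitStep hl hl0 hx hx' hs (hC _ hs) i hi).mono ?_
  rintro t1 s1 ⟨ht1, hs1, hx1, h01, ha1, hr1⟩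
  refine Runs.mono (runs_while_const (a - 1) 6 (fun c s' => HasInput G L R e s' ∧
    s'.reg x = (i + (c + 1 : ℕ)).val ∧ s'.reg 0 = s.reg 0 + (c + 1) ∧
    (∀ q < s.reg 0, s'.arr 0 q = s.arr 0 q) ∧
    (∀ q < c + 1, s'.arr 0 (s.reg 0 + q) = C.dart (i + (q : ℕ))) ∧
    (∀ z, z ≠ x → z ≠ 0 → z ≠ 54 → s'.reg z = s.reg z)) ?_ ?_ ?_) ?_
  · rintro c hc s2 ⟨hs2, hx2, h02, hb2, hq2, hr2⟩
    refine ⟨?_, ?_⟩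
    · rw [holds_ne, hx2, hr2 y hxy (by omega) hy', hend]
      intro h
      have h := add_left_cancel (ZMod.val_injective _ h)
      rcases ha'.lt_or_eq with hlt | heq
      · have := natCast_inj_of_le (p := C.len) le_rfl (by omega) hlt h
        omega
      · rw [heq, ZMod.natCast_self] at h
        have := natCast_inj_of_le (p := C.len) (t' := 0) le_rfl (by omega) (by omega)
          (h.trans Nat.cast_zero.symm)
        omega
    · refine (runs_emitStep hl hl0 hx hx' hs2 (hC _ hs2) _ hx2).mono ?_
      rintro t3 s3 ⟨ht3, hs3, hx3, h03, ha3, hr3⟩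
      have := hset (c + 1) s2 s3 h02 hb2 hq2 ha3
      refine ⟨ht3, hs3, ?_, by omega, this.1, this.2, fun z k1 k2 k3 => ?_⟩
      · rw [hx3, Nat.cast_succ (c + 1), add_assoc]
      · rw [hr3 z k1 k2 k3, hr2 z k1 k2 k3]
  · rintro s2 ⟨hs2, hx2, h02, hb2, hq2, hr2⟩
    rw [holds_ne, hx2, hr2 y hxy (by omega) hy', hend, Nat.sub_add_cancel ha, not_not]
  · have := hset 0 s s1 rfl (fun _ _ => rfl) (by simp) (by simpa using ha1)
    exact ⟨hs1, by simpa using hx1, by omega, this.1, this.2, hr1⟩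
  · rintro t2 s2 ⟨ht2, hs2, hx2, h02, hb2, hq2, hr2⟩
    rw [Nat.sub_add_cancel ha] at h02 hq2
    exact ⟨by omega, hs2, h02, hb2, hq2, hr2⟩

theorem runs_outputProgram {s : State} (hs : HasInput G L R e s) (hR : HasSides R s)
    {i : ZMod L.len} {a : ℕ} {j : ZMod R.len} {b : ℕ}
    (h1 : G.vert (L.dart (i + a)) = G.vert (R.dart j))
    (h2 : G.vert (R.dart (j + b)) = G.vert (L.dart i)) (ha : 0 < a) (ha' : a ≤ L.len)
    (hb : 0 < b) (hb' : b ≤ R.len) (hi : s.arr 10 (s.reg 24 - 1) = i.val)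
    (hj : s.arr 10 (s.reg 40) = (i + (a : ℕ)).val) :
    Runs outputProgram s fun t s' => t ≤ 7 * (L.len + R.len) + 13 ∧ s'.reg 0 = a + b ∧
      ∀ q < a + b, s'.arr 0 q = arcDart L R i a j q := by
  unfold outputProgram
  simp only [runs_seq, runs_copy, runs_dec, runs_load, runs_const, setReg_reg, setReg_arr,
    Nat.reduceEqDiff, reduceIte, hi, hj, hs.walkL, hs.vert, h1, ← h2, hR.pos]
  refine (runs_emitArc (C := L) (by omega) (by omega) (by omega) (by omega) (by omega) (by omega)
    (by omega) (fun s h => ⟨h.lenL, h.walkL⟩) (G := G) (L := L) (R := R) (e := e)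
    (hs.of_eq (by simp) (by simp)) (i := i) ha ha' (by simp) (by simp)).mono ?_
  rintro t1 s1 ⟨ht1, hs1, h01, -, hq1, hr1⟩
  refine (runs_emitArc (C := R) (by omega) (by omega) (by omega) (by omega) (by omega) (by omega)
    (by omega) (fun s h => ⟨h.lenR, h.walkR⟩) hs1 (i := j) hb hb' ?_ ?_).mono ?_
  · rw [hr1 56 (by omega) (by omega) (by omega)]
    simp
  · rw [hr1 57 (by omega) (by omega) (by omega)]
    simp
  rintro t2 s2 ⟨ht2, -, h02, hb2, hq2, -⟩
  simp only [setReg_reg, reduceIte, zero_add] at h01 hq1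
  rw [h01] at h02 hb2 hq2
  refine ⟨by omega, h02, fun q hq => ?_⟩
  unfold arcDart
  split_ifs with hqa
  · rw [hb2 q hqa, hq1 q hqa]
  · rw [← hq2 (q - a) (by omega), Nat.add_sub_of_le (by omega)]

end RAM

/-! ## The main theorem -/

open EmbDigraph EmbDigraph.ClosedWalk RAM

namespace RAM

variable {v n : ℕ} {G : TorusGraph (Fin v) (Fin n)} {L R : G.Walk} {e : Fin n}

/-- The program of the main theorem. -/
def twoArcsProgram : Program :=
  .const 7 1 ;; .const 8 2 ;; sidesProgram ;; findProgram ;; scanProgram ;; homotopyProgram ;;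
    outputProgram

theorem tableOf_val {n : ℕ} (f : Fin n → ℕ) (d : Fin n) : tableOf f d = f d := by
  simp [tableOf]

theorem walkTable_val {V : Type} {n : ℕ} {X : EmbDigraph V (Fin n)} (C : X.ClosedWalk)
    (i : ZMod C.len) : walkTable C i.val = C.dart i := by
  simp [walkTable, ZMod.val_lt]

theorem hasInput_inputState (G : TorusGraph (Fin v) (Fin n)) (L R : G.Walk) (e : Fin n) :
    HasInput G L R e (((inputState G L R e).setReg 7 1).setReg 8 2) := by
  constructor <;> simp [inputState, tableOf_val, walkTable_val]

theorem runs_twoArcsProgram (hL : G.IsCycle L) (hR : G.IsCycle R) (P : CrossingPair L R)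
    (he : L.Contains e) :
    Runs twoArcsProgram (inputState G L R e) fun t s' => t ≤ 250 * n ∧
      ∃ (i : ZMod L.len) (a : ℕ) (j : ZMod R.len) (b : ℕ),
        0 < a ∧ a ≤ L.len ∧ 0 < b ∧ b ≤ R.len ∧ G.vert (L.dart (i + a)) = G.vert (R.dart j) ∧
        G.vert (R.dart (j + b)) = G.vert (L.dart i) ∧ MarkedL L R i ∧ MarkedL L R (i + a) ∧
        (TorusGraph.Opposed L R → marksL L R i a = G.m R) ∧
        (¬ TorusGraph.Opposed L R → marksL L R i a = 1) ∧
        (∃ t < a, L.dart (i + t) = e) ∧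
        s'.reg 0 = a + b ∧ ∀ q < a + b, s'.arr 0 q = arcDart L R i a j q := by
  classical
  have hnL : L.len ≤ n := by simpa using hL.2.len_le_card
  have hnR : R.len ≤ n := by simpa using hR.2.len_le_card
  have hL0 := Nat.pos_of_ne_zero L.len_neZero.out
  have hk0 := P.crossingNumber_pos
  unfold twoArcsProgram
  rw [runs_seq, runs_const, runs_seq, runs_const, runs_seq]
  have hs0 := hasInput_inputState G L R e
  set s0 := ((inputState G L R e).setReg 7 1).setReg 8 2 with hs0'
  have h0 : ∀ a x, 7 < a → s0.arr a x = 0 := by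
    intro a x ha
    rw [hs0']
    simp only [setReg_arr, inputState]
    split <;> first | omega | rfl
  refine (runs_sidesProgram hR.2 hs0 fun x => h0 _ x (by omega)).frame.mono ?_
  rintro t1 s1 ⟨⟨ht1, hsides⟩, hr1, ha1⟩
  have hs1 : HasInput G L R e s1 := hs0.of_eq
    (by simp (disch := simp [sidesProgram, Program.regs]) [hr1])
    (by simp (disch := simp [sidesProgram, Program.arrs]) [ha1])
  rw [runs_seq]
  refine (runs_findProgram hL.2 he hs1).frame.mono ?_
  rintro t2 s2 ⟨⟨ht2, u, hue, h20, h21⟩, hr2, ha2⟩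
  have ha2 : s2.arr = s1.arr := by
    funext a
    exact ha2 a (by simp [findProgram, Program.arrs])
  have hs2 : HasInput G L R e s2 := hs1.of_eq
    (by simp (disch := simp [findProgram, Program.regs]) [hr2]) (by simp [ha2])
  have hsides2 : HasSides R s2 := ⟨by rw [ha2]; exact hsides.pos, by rw [ha2]; exact hsides.side⟩
  obtain ⟨i', hi'⟩ : ∃ i, MarkedL L R i := by
    obtain ⟨-, i, j, k, hk, hr, hl⟩ := P.crosses
    exact ⟨_, P.markedL_of_crossesRL hk hr hl⟩
  rw [runs_seq]
  refine (runs_scanProgram hR.2 (u := u) ⟨hs2, hsides2, h20, h21⟩ ⟨i', hi'⟩).frame.mono ?_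
  rintro t3 s3 ⟨⟨ht3, h24, h10⟩, hr3, ha3⟩
  have ha3 : ∀ a, a ≠ 10 → s3.arr a = s2.arr a := fun a ha => ha3 a (by
    simpa [scanProgram, scanRound, scanStep, advance, Program.arrs] using ha)
  have hs3 : HasInput G L R e s3 := hs2.of_eq
    (by simp (disch := simp [scanProgram, scanRound, scanStep, advance, Program.regs]) [hr3])
    (by simp (disch := omega) [ha3])
  rw [runs_seq]
  refine (runs_homotopyProgram hL hR hs3 fun a x ha => ?_).frame.mono ?_
  · rw [ha3 a (by omega), ha2, ha1 a (by simp [sidesProgram, Program.arrs]; omega)]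
    exact h0 a x (by omega)
  rintro t4 s4 ⟨⟨ht4, ho, hno⟩, hr4, ha4⟩
  have hs4 : HasInput G L R e s4 := hs3.of_eq
    (by simp (disch := simp [homotopyProgram, countStarts, countStart, offsetProgram,
      subtractProgram, Program.regs]) [hr4])
    (by simp (disch := simp [homotopyProgram, countStarts, countStart, offsetProgram,
      subtractProgram, Program.arrs]) [ha4])
  have ha4 : ∀ a, a < 11 → s4.arr a = s3.arr a := fun a ha => ha4 a (by
    simp [homotopyProgram, countStarts, countStart, offsetProgram, subtractProgram, Program.arrs]
    omega)
  have h24' : s4.reg 24 = s3.reg 24 := hr4 24 (by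
    simp [homotopyProgram, countStarts, countStart, offsetProgram, subtractProgram, Program.regs])
  have hsides4 : HasSides R s4 := by
    constructor <;> rw [ha4 _ (by omega), ha3 _ (by omega), ha2]
    exacts [hsides.pos, hsides.side]
  have hk : (s3.reg 24 : ℤ) = R.crossingNumber L := by
    rw [h24, ← P.marksL_len (u + 1), marksL_eq_count]
  -- The required mark is on the list: with opposed signs, m(R) is at most the number m(R)h(L) -
  -- h(R)m(L) of all marks.
  have hlt : s4.reg 40 < s3.reg 24 := by
    by_cases hopp : TorusGraph.Opposed L R
    · have h1 := ho hopp
      have h2 := G.crossingNumber_eq_det R L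
      obtain ⟨o1, o2, o3, o4⟩ := hopp
      have : G.m R ≤ R.crossingNumber L := by
        rw [h2]
        nlinarith
      omega
    · rw [hno hopp]
      omega
  obtain ⟨i, a, ha, haL, hmi, hma, hα, hea, hix, hiy⟩ := exists_arc_of_marks h24 hlt
  obtain ⟨j, hj⟩ := hma.exists_vert_eq
  obtain ⟨j', hj'⟩ := hmi.exists_vert_eq
  obtain ⟨b, hb, hbR, hjb⟩ := exists_arc R j j'
  have hvb : G.vert (R.dart (j + b)) = G.vert (L.dart i) := by rw [hjb, hj']
  refine (runs_outputProgram hs4 hsides4 hj hvb ha haL hb hbR ?_ ?_).mono ?_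
  · rw [ha4 10 (by omega), h24', h10 _ (by omega), ← hix]
  · rw [ha4 10 (by omega), h10 _ hlt, ← hiy]
  rintro t5 s5 ⟨ht5, h50, h5⟩
  -- The additive constants of the time bounds are absorbed into `250 * n` because `n ≥ L.len ≥ 1`.
  refine ⟨by omega, i, a, j, b, ha, haL, hb, hbR, hj, hvb, hmi, hma, fun hopp => ?_, fun hopp => ?_,
    hue ▸ hea, h50, h5⟩
  · rw [hα, ho hopp]
    ring
  · rw [hα, hno hopp]
    rfl

end RAM

/-- One program and one constant `c` work for all inputs; `n` is the number of darts, i.e. twice the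
number of edges, of the planarization. -/
theorem mainTheorem10 :
    ∃ (P : RAM.Program) (c : ℕ),
      ∀ (v n : ℕ) (G : TorusGraph (Fin v) (Fin n)) (Cl Cr : G.Walk) (e : Fin n),
        G.EssentiallyAcyclic →
        G.IsCycle Cl → G.IsCycle Cr →
        Cl.CrossesOnlyRL Cr →
        Cl.TouchUnidirectionally Cr →
        Cl.Contains e →
        ∃ (t : ℕ) (s : RAM.State) (C : G.Walk),
          RAM.Exec P (inputState G Cl Cr e) t s ∧ t ≤ c * n ∧ IsOutput s C ∧
          G.InGraph C ∧ C.WeaklySimple ∧ C.Contains e ∧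
          C.crossingNumber Cl ≠ 0 ∧ C.crossingNumber Cr ≠ 0 ∧
          (2 ≤ Cr.crossingNumber Cl → C.Simple) ∧
          (G.m Cl < 0 → 0 < G.m Cr → 0 < G.h Cl → 0 < G.h Cr →
            C.Simple ∧ G.IsOneOrbital C) := by
  refine ⟨twoArcsProgram, 250, fun v n G L R e _ hL hR hc ht he => ?_⟩
  have P : CrossingPair L R := ⟨hL.2, hR.2, hc, ht⟩
  obtain ⟨t, s, hexec, htn, i, a, j, b, ha, haL, hb, hbR, hj, hvb, hmi, hma, ho, hno, hea, h0, hq⟩ :=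
    runs_twoArcsProgram hL hR P he
  refine ⟨t, s, twoArcs L R i a j b (by omega) hj hvb, hexec, htn, ⟨h0, fun q hqab => ?_⟩,
    TorusGraph.twoArcs_spec P hL.1 hR.1 hmi hma ha haL hb hbR ho hno hea⟩
  exact (hq q hqab).trans (congrArg Fin.val (twoArcs_dart_natCast hqab).symm)
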